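/- Let $n\ge 3$ and let $I_n\subset\mathbb{R}^2$ be the dihedral root system with positive roots $\alpha_j=(\cos\frac{\pi j}{n},\sin\frac{\pi j}{n})$, $0\le j<n$, i.e. $I_n=\{\pm\alpha_j: 0\le j<n\}$. Its Weyl group $W$ consists of the rotations $r_j$ by the angle $\frac{2\pi j}{n}$ and the reflections $s_j=s\,r_j$, where $s(v_0,v_1)=(-v_0,v_1)$, $j\in\mathbb{Z}/n\mathbb{Z}$. Let $\kappa$ be a positive $W$-invariant function on $I_n$. For $\xi\in\mathbb{R}^2$ let $$T_\xi f(x)=\langle\xi,\nabla f(x)\rangle+\sum_{j=0}^{n-1}\kappa(\alpha_j)\langle\alpha_j,\xi\rangle\frac{f(x)-f(s_{\alpha_j}x)}{\langle\alpha_j,x\rangle}$$ be the Dunkl operator, where $s_{\alpha}$ is the orthogonal reflection with respect to $\alpha^\perp$. For every $y\in\mathbb{R}^2$ there is a unique smooth function $f:\mathbb{R}^2\to\mathbb{R}$ with $T_\xi f=\langle\xi,y\rangle f$ for all $\xi\in\mathbb{R}^2$ and $f(0)=1$; the Dunkl kernel $E$ is defined by $E(\cdot,y)=f$. Let $\tilde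 r$ be the rotation by the angle $\frac{\pi}{2}-\frac{\pi}{n}$, and let $\overline{\mathfrak a_+}=\{x\in\mathbb{R}^2:\langle\alpha_0,x\rangle\ge0,\ \langle\alpha_{n-1},x\rangle\ge0\}$ be the closed positive Weyl chamber. Then there are constants $C_1,C_2>0$, depending only on $n$ and $\kappa$, such that for all $w\in W$ and all $x,y\in\overline{\mathfrak a_+}$ $$C_1\,F_w(x,y)\,e^{\langle x,y\rangle}\prod_{j=0}^{n-1}\bigl(1+\langle\alpha_j,x\rangle\langle\alpha_j,y\rangle\bigr)^{-\kappa(\alpha_j)}\le E(x,w.y)\le C_2\,F_w(x,y)\,e^{\langle x,y\rangle}\prod_{j=0}^{n-1}\bigl(1+\langle\alpha_j,x\rangle\langle\alpha_j,y\rangle\bigr)^{-\kappa(\alpha_j)},$$ where, with $a=1+\langle\alpha_0,x\rangle\langle\alpha_0,y\rangle$, $b=1+\langle\alpha_{n-1},x\rangle\langle\alpha_{n-1},y\rangle$ and $d=1+\langle x,y\rangle$, $$F_w(x,y)=\begin{cases}1 & w=\mathrm{Id},\\ 1/a & w=s_0,\\ 1/b & w=s_1,\\ 1/d & w=s_j,\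 1<j<n,\\ (1+\langle x,\tilde r.y\rangle)/(a\,b\,d) & w=r_1,\\ (1+\langle\tilde r.x,y\rangle)/(a\,b\,d) & w=r_{n-1},\\ (1+\langle\tilde r.x,y\rangle)(1+\langle x,\tilde r.y\rangle)/(a\,b\,d^2) & w=r_j,\ 1<j<n-1.\end{cases}$$ -/

import Mathlib

noncomputable section

namespace DihedralDunkl

/-- The Euclidean plane. -/
abbrev Plane : Type := EuclideanSpace ℝ (Fin 2)

/-- The unit vectors `α_j = (cos (π j / n), sin (π j / n))`; for `0 ≤ j < n` these are the positive
roots of the dihedral root system `I_n`. -/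
def posRoot (n j : ℕ) : Plane :=
  !₂[Real.cos (Real.pi * j / n), Real.sin (Real.pi * j / n)]

/-- The dihedral root system `I_n = {± α_j : 0 ≤ j < n}`. -/
def rootSystem (n : ℕ) : Set Plane :=
  {α | ∃ j < n, α = posRoot n j ∨ α = -posRoot n j}

/-- The orthogonal reflection with respect to the line orthogonal to `α`. -/
def reflect (α x : Plane) : Plane :=
  x - (2 * inner ℝ α x / inner ℝ α α) • α

/-- The rotation about the origin by the angle `θ`. -/
def rot (θ : ℝ) (v : Plane) : Plane :=
  !₂[Real.cos θ * v 0 - Real.sin θ * v 1, Real.sin θ * v 0 + Real.cos θ * v 1]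

/-- The action on the plane of the Weyl group of `I_n`, i.e. of the dihedral group of order `2 n`:
`r j` acts as the rotation `r_j` by the angle `2 π j / n`, and `sr j` acts as `s_j = s r_j`, where
`s` is the reflection `(v₀, v₁) ↦ (-v₀, v₁)`. -/
def act {n : ℕ} : DihedralGroup n → Plane → Plane
  | .r j, v => rot (2 * Real.pi * j.val / n) v
  | .sr j, v =>
      !₂[-(rot (2 * Real.pi * j.val / n) v) 0, (rot (2 * Real.pi * j.val / n) v) 1]

/-- `κ` is a positive multiplicity function on `I_n`: it is positive on the roots and invariant
under the Weyl group. (Values of `κ` outside `I_n` play no role.) -/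
structure IsPositiveMultiplicity (n : ℕ) (κ : Plane → ℝ) : Prop where
  pos : ∀ α ∈ rootSystem n, 0 < κ α
  invariant : ∀ (w : DihedralGroup n), ∀ α ∈ rootSystem n, κ (act w α) = κ α

/-- The closed positive Weyl chamber. -/
def closedChamber (n : ℕ) : Set Plane :=
  {x | 0 ≤ inner ℝ (posRoot n 0) x ∧ 0 ≤ inner ℝ (posRoot n (n - 1)) x}

/-- The Dunkl operator `T_ξ` for `I_n` with multiplicity `κ`, evaluated at a point `x`
(meaningful at points `x` that lie on no line `α_j^⊥`). -/
def dunklOp (n : ℕ) (κ : Plane → ℝ) (ξ : Plane) (f : Plane → ℝ) (x : Plane) : ℝ :=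
  fderiv ℝ f x ξ + ∑ j ∈ Finset.range n, κ (posRoot n j) * inner ℝ (posRoot n j) ξ *
    ((f x - f (reflect (posRoot n j) x)) / inner ℝ (posRoot n j) x)

/-- `f` is a smooth solution of `T_ξ f = ⟪ξ, y⟫ f` for all `ξ`, with `f 0 = 1`. For smooth `f` the
difference quotients in `T_ξ f` extend continuously across the lines `α_j^⊥`, so it is the same to
impose the equations on the whole plane or, as here, on the dense set off these lines. -/
structure IsDunklEigenfunction (n : ℕ) (κ : Plane → ℝ) (y : Plane) (f : Plane → ℝ) : Prop where
  smooth : ContDiff ℝ ((⊤ : ℕ∞) : WithTop ℕ∞) f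
  eigen : ∀ ξ x : Plane, (∀ j < n, inner ℝ (posRoot n j) x ≠ 0) →
    dunklOp n κ ξ f x = inner ℝ ξ y * f x
  map_zero : f 0 = 1

/-- The Dunkl kernel: `E(·, y)` is the smooth function `f` with `T_ξ f = ⟪ξ, y⟫ f` for all `ξ`
and `f 0 = 1`. -/
def dunklKernel (n : ℕ) (κ : Plane → ℝ) (x y : Plane) : ℝ :=
  Classical.epsilon (fun f : Plane → ℝ => IsDunklEigenfunction n κ y f) x

/-- The factor common to all the Weyl group elements:
`e^⟪x, y⟫ ∏_j (1 + ⟪α_j, x⟫ ⟪α_j, y⟫) ^ (-κ(α_j))`. -/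
def commonFactor (n : ℕ) (κ : Plane → ℝ) (x y : Plane) : ℝ :=
  Real.exp (inner ℝ x y) * ∏ j ∈ Finset.range n,
    (1 + inner ℝ (posRoot n j) x * inner ℝ (posRoot n j) y) ^ (-κ (posRoot n j))

/-- The rotation `r̃` by the angle `π / 2 - π / n`. -/
def rTilde (n : ℕ) : Plane → Plane := rot (Real.pi / 2 - Real.pi / n)

/-- The rational factor that depends on the Weyl group element. In `ZMod n`, `-1` is the class
of `n - 1`. -/
def weylFactor (n : ℕ) (x y : Plane) : DihedralGroup n → ℝ
  | .r j =>
      if j = 0 then 1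
      else if j = 1 then
        (1 + inner ℝ x (rTilde n y)) /
          ((1 + inner ℝ (posRoot n 0) x * inner ℝ (posRoot n 0) y) *
            (1 + inner ℝ (posRoot n (n - 1)) x * inner ℝ (posRoot n (n - 1)) y) *
            (1 + inner ℝ x y))
      else if j = -1 then
        (1 + inner ℝ (rTilde n x) y) /
          ((1 + inner ℝ (posRoot n 0) x * inner ℝ (posRoot n 0) y) *
            (1 + inner ℝ (posRoot n (n - 1)) x * inner ℝ (posRoot n (n - 1)) y) *
            (1 + inner ℝ x y))
      else
        (1 + inner ℝ (rTilde n x) y) * (1 + inner ℝ x (rTilde n y)) /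
          ((1 + inner ℝ (posRoot n 0) x * inner ℝ (posRoot n 0) y) *
            (1 + inner ℝ (posRoot n (n - 1)) x * inner ℝ (posRoot n (n - 1)) y) *
            (1 + inner ℝ x y) ^ 2)
  | .sr j =>
      if j = 0 then 1 / (1 + inner ℝ (posRoot n 0) x * inner ℝ (posRoot n 0) y)
      else if j = 1 then
        1 / (1 + inner ℝ (posRoot n (n - 1)) x * inner ℝ (posRoot n (n - 1)) y)
      else 1 / (1 + inner ℝ x y)

end DihedralDunkl

end

/-! For `ξ = x` the denominators of the Dunkl operator cancel, leaving the radial equation `∂ₓf(x) +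
∑ₖ κₖ (f(x) - f(sₖx)) = ⟪x, y⟫ f(x)`. Since `E(sₖx, y) = E(x, sₖy)`, the functions `ψ_w(t) =
exp(-t⟪x, y⟫) E(tx, wy)` satisfy a closed linear system along a ray: `t ψ_w' + t λ_w ψ_w + ∑ₖ κₖ
(ψ_w - ψ_{sₖw}) = 0`, `ψ_w(0) = 1`, with `λ_w = ⟪x, y⟫ - ⟪x, wy⟫`. The coupling is cooperative, so
sub- and supersolutions bound the solution (`nonneg_of_cooperative`).

The barriers are explicit. With `A0`, `A1` the products over the two simple roots and `R = ⟪x, y⟫`,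
put `u0 = c/(c+tA0)`, `u1 = c/(c+tA1)`, `u = c/(c+tR)`. The component at `w` is `profile` times
`u0^κ₀ u1^κ₁ u^(remaining multiplicity) exp(M(u-1))`. A large `c` with `M = 0` gives a
supersolution, a small `c` with large `M` a subsolution (`residual_nonneg`, `residual_nonpos`). Both
are comparable at `t = 1` to the same expression with `c = 1`, `M = 0`.

The geometric input is the size of the `λ_w`: `2A0` and `2A1` at the simple reflections, and
comparable to `R` at every other nontrivial element except one of `r₁`, `r₋₁`, whose rate is
comparable to `A0 + A1`. Which one depends on the half of the chamber containing `x`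
(`exists_slowRotation`). The stated rational factors are then comparable to `profile`
(`SlowRotation.weylFactor_bounds`).

The same comparison principle handles the existence and uniqueness of the kernel. A radial solution
is built as a power series and is unique on each ray. Its defect in the angular equation, multiplied
by the sign character, solves a homogeneous system of the same form with zero initial value, so it
vanishes, and all the Dunkl equations hold. -/

namespace DihedralDunkl

/-! ### The Weyl group action, with roots and multiplicities indexed by reflections. -/

section

open Real

theorem inner_eq (x y : Plane) : inner ℝ x y = x 0 * y 0 + x 1 * y 1 := by
  simp [PiLp.inner_apply, Fin.sum_univ_two, mul_comm]

theorem plane_ext {x y : Plane} (h0 : x 0 = y 0) (h1 : x 1 = y 1) : x = y := by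
  ext i; fin_cases i <;> assumption

@[simp] theorem rot_zero' (θ : ℝ) (v : Plane) : rot θ v 0 = cos θ * v 0 - sin θ * v 1 := by
  simp [rot]

@[simp] theorem rot_one' (θ : ℝ) (v : Plane) : rot θ v 1 = sin θ * v 0 + cos θ * v 1 := by
  simp [rot]

variable {n : ℕ}

theorem act_r (j : ZMod n) (v : Plane) : act (.r j) v = rot (2 * π * j.val / n) v := rfl

@[simp] theorem act_sr_zero (j : ZMod n) (v : Plane) :
    act (.sr j) v 0 = -rot (2 * π * j.val / n) v 0 := by simp [act]

@[simp] theorem act_sr_one (j : ZMod n) (v : Plane) :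
    act (.sr j) v 1 = rot (2 * π * j.val / n) v 1 := by simp [act]

theorem two_pi_val [NeZero n] (k : ZMod n) (m : ℤ) (h : (m : ZMod n) = k) :
    ∃ q : ℤ, 2 * π * m / n = 2 * π * k.val / n + q * (2 * π) := by
  have h1 : ((m - (k.val : ℤ) : ℤ) : ZMod n) = 0 := by simp [h]
  obtain ⟨q, hq⟩ := (ZMod.intCast_zmod_eq_zero_iff_dvd _ n).1 h1
  refine ⟨q, ?_⟩
  have hn : (n : ℝ) ≠ 0 := by exact_mod_cast NeZero.ne n
  have : (m : ℝ) - k.val = n * q := by exact_mod_cast hq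
  have : (m : ℝ) = k.val + n * q := by linarith
  rw [this]; field_simp

theorem cos_two_pi_val [NeZero n] (k : ZMod n) (m : ℤ) (h : (m : ZMod n) = k) :
    cos (2 * π * k.val / n) = cos (2 * π * m / n) := by
  obtain ⟨q, hq⟩ := two_pi_val k m h
  rw [hq, cos_add_int_mul_two_pi]

theorem sin_two_pi_val [NeZero n] (k : ZMod n) (m : ℤ) (h : (m : ZMod n) = k) :
    sin (2 * π * k.val / n) = sin (2 * π * m / n) := by
  obtain ⟨q, hq⟩ := two_pi_val k m h
  rw [hq, sin_add_int_mul_two_pi]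

theorem cos_val_add [NeZero n] (i j : ZMod n) : cos (2 * π * (i + j).val / n) =
    cos (2 * π * i.val / n) * cos (2 * π * j.val / n) -
      sin (2 * π * i.val / n) * sin (2 * π * j.val / n) := by
  rw [cos_two_pi_val (i + j) (i.val + j.val) (by simp), ← cos_add]
  congr 1; push_cast; ring

theorem sin_val_add [NeZero n] (i j : ZMod n) : sin (2 * π * (i + j).val / n) =
    sin (2 * π * i.val / n) * cos (2 * π * j.val / n) +
      cos (2 * π * i.val / n) * sin (2 * π * j.val / n) := by
  rw [sin_two_pi_val (i + j) (i.val + j.val) (by simp), ← sin_add]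
  congr 1; push_cast; ring

theorem cos_val_neg [NeZero n] (i : ZMod n) :
    cos (2 * π * (-i).val / n) = cos (2 * π * i.val / n) := by
  rw [cos_two_pi_val (-i) (-i.val) (by simp), ← cos_neg]
  congr 1; push_cast; ring

theorem sin_val_neg [NeZero n] (i : ZMod n) :
    sin (2 * π * (-i).val / n) = -sin (2 * π * i.val / n) := by
  rw [sin_two_pi_val (-i) (-i.val) (by simp), ← sin_neg]
  congr 1; push_cast; ring

theorem act_mul [NeZero n] (a b : DihedralGroup n) (v : Plane) :
    act (a * b) v = act a (act b v) := by
  rcases a with i | i <;> rcases b with j | j <;>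
    simp only [DihedralGroup.r_mul_r, DihedralGroup.r_mul_sr, DihedralGroup.sr_mul_r,
      DihedralGroup.sr_mul_sr, sub_eq_add_neg] <;>
    apply plane_ext <;>
    simp only [act_r, rot_zero', rot_one', act_sr_zero, act_sr_one, cos_val_add, sin_val_add,
      cos_val_neg, sin_val_neg] <;> ring

@[simp] theorem act_one (v : Plane) : act (1 : DihedralGroup n) v = v := by
  change act (.r 0) v = v
  rw [act_r]
  apply plane_ext <;> simp

theorem inner_act_act (w : DihedralGroup n) (x y : Plane) :
    inner ℝ (act w x) (act w y) = (inner ℝ x y : ℝ) := by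
  rcases w with j | j
  all_goals
    simp only [inner_eq, act_r, rot_zero', rot_one', act_sr_zero, act_sr_one]
    linear_combination (x 0 * y 0 + x 1 * y 1) * sin_sq_add_cos_sq (2 * π * j.val / n)

/-- The action of a Weyl group element as a continuous linear map. -/
noncomputable def actL (w : DihedralGroup n) : Plane →L[ℝ] Plane :=
  LinearMap.toContinuousLinearMap
    { toFun := act w
      map_add' := fun x y => by
        rcases w with j | j <;> apply plane_ext <;> simp [act_r] <;> ring
      map_smul' := fun c x => by
        rcases w with j | j <;> apply plane_ext <;> simp [act_r] <;> ring }

@[simp] theorem actL_apply (w : DihedralGroup n) (x : Plane) : actL w x = act w x := rfl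

theorem norm_act (w : DihedralGroup n) (x : Plane) : ‖act w x‖ = ‖x‖ := by
  have := inner_act_act w x x
  rw [real_inner_self_eq_norm_sq, real_inner_self_eq_norm_sq] at this
  exact (sq_eq_sq₀ (norm_nonneg _) (norm_nonneg _)).1 this

theorem act_smul (w : DihedralGroup n) (c : ℝ) (x : Plane) : act w (c • x) = c • act w x :=
  (actL w).map_smul c x

@[simp] theorem act_zero (w : DihedralGroup n) : act w 0 = 0 := (actL w).map_zero

theorem act_inv_act [NeZero n] (w : DihedralGroup n) (x : Plane) : act w⁻¹ (act w x) = x := by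
  rw [← act_mul, inv_mul_cancel, act_one]

theorem inner_act_left [NeZero n] (w : DihedralGroup n) (x y : Plane) :
    inner ℝ (act w x) y = (inner ℝ x (act w⁻¹ y) : ℝ) := by
  rw [← inner_act_act w⁻¹, act_inv_act]

/-- The positive root whose reflection is `s_k`. -/
noncomputable def root (n : ℕ) (k : ZMod n) : Plane := posRoot n (-k).val

/-- The value of the multiplicity function attached to the reflection `s_k`. -/
noncomputable def mult (n : ℕ) (κ : Plane → ℝ) (k : ZMod n) : ℝ := κ (root n k)

theorem root_zero' (k : ZMod n) : root n k 0 = cos (π * (-k).val / n) := by simp [root, posRoot]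
theorem root_one' (k : ZMod n) : root n k 1 = sin (π * (-k).val / n) := by simp [root, posRoot]

theorem cos_two_pi_root [NeZero n] (k : ZMod n) :
    cos (2 * π * k.val / n) = root n k 0 ^ 2 - root n k 1 ^ 2 := by
  rw [root_zero', root_one', ← cos_val_neg, ← cos_two_mul']
  congr 1; ring

theorem sin_two_pi_root [NeZero n] (k : ZMod n) :
    sin (2 * π * k.val / n) = -(2 * root n k 1 * root n k 0) := by
  rw [root_zero', root_one', ← neg_neg (sin _), ← sin_val_neg, ← sin_two_mul]
  congr 2; ring

theorem root_sq (k : ZMod n) : root n k 0 ^ 2 + root n k 1 ^ 2 = 1 := by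
  rw [root_zero', root_one']; exact cos_sq_add_sin_sq _

theorem inner_posRoot_self (j : ℕ) : inner ℝ (posRoot n j) (posRoot n j) = (1 : ℝ) := by
  rw [inner_eq]; simp only [posRoot]
  simpa [sq] using cos_sq_add_sin_sq (π * j / n)

theorem inner_root_self (k : ZMod n) : inner ℝ (root n k) (root n k) = (1 : ℝ) :=
  inner_posRoot_self _

/-- The map `s_k` sends the polar angle `φ` to `π - φ - 2πk/n`, so its mirror has angle `π/2 - πk/n`
and its normal `-πk/n` modulo `π`. This explains the index `-k` in `root`. -/
theorem act_sr_eq [NeZero n] (k : ZMod n) (x : Plane) :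
    act (.sr k) x = x - (2 * inner ℝ (root n k) x : ℝ) • root n k := by
  have h := root_sq k
  apply plane_ext
  all_goals
    simp only [act_sr_zero, act_sr_one, rot_zero', rot_one', cos_two_pi_root, sin_two_pi_root,
      PiLp.sub_apply, PiLp.smul_apply, smul_eq_mul, inner_eq]
  · linear_combination x 0 * h
  · linear_combination x 1 * h

theorem reflect_root [NeZero n] (k : ZMod n) (x : Plane) :
    reflect (root n k) x = act (.sr k) x := by
  rw [reflect, act_sr_eq, inner_root_self, div_one]

theorem posRoot_eq_or_neg [NeZero n] (a b : ℤ) (h : (a : ZMod n) = b) (x y : Plane)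
    (hx : x 0 = cos (π * a / n) ∧ x 1 = sin (π * a / n))
    (hy : y 0 = cos (π * b / n) ∧ y 1 = sin (π * b / n)) : x = y ∨ x = -y := by
  obtain ⟨q, hq⟩ := (ZMod.intCast_eq_intCast_iff_dvd_sub b a n).1 h.symm
  have hn : (n : ℝ) ≠ 0 := by exact_mod_cast NeZero.ne n
  have hq' : (a : ℝ) - b = n * q := by exact_mod_cast hq
  have ha : π * a / n = π * b / n + q * π := by
    rw [show (a : ℝ) = b + n * q by linarith]; field_simp
  rw [ha, cos_add_int_mul_pi, sin_add_int_mul_pi, ← hy.1, ← hy.2] at hx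
  rcases Int.even_or_odd q with hq | hq
  · left; rw [hq.neg_one_zpow] at hx; exact plane_ext (by simp [hx.1]) (by simp [hx.2])
  · right; rw [hq.neg_one_zpow] at hx; exact plane_ext (by simp [hx.1]) (by simp [hx.2])

/-- This is `s_i s_k s_i = s_{2i-k}` read on normals. The sign is undetermined because reducing an
index modulo `n` shifts the angle by multiples of `π`. -/
theorem root_conj [NeZero n] (i k : ZMod n) :
    root n (2 * i - k) = act (.sr i) (root n k) ∨ root n (2 * i - k) = -act (.sr i) (root n k) := by
  have hn : (n : ℝ) ≠ 0 := by exact_mod_cast NeZero.ne n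
  refine posRoot_eq_or_neg (n := n) (-(2 * i - k)).val
    (n - (-k).val - 2 * i.val) (by push_cast; simp) _ _ ⟨?_, ?_⟩ ⟨?_, ?_⟩
  · simp [root_zero']
  · simp [root_one']
  · have : π * ((n - (-k).val - 2 * i.val : ℤ) : ℝ) / n =
      π - (2 * π * i.val / n + π * (-k).val / n) := by push_cast; field_simp; ring
    rw [this, cos_pi_sub, cos_add, act_sr_zero, rot_zero', root_zero', root_one']
  · have : π * ((n - (-k).val - 2 * i.val : ℤ) : ℝ) / n =
      π - (2 * π * i.val / n + π * (-k).val / n) := by push_cast; field_simp; ring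
    rw [this, sin_pi_sub, sin_add, act_sr_one, rot_one', root_zero', root_one']

theorem root_mem [NeZero n] (k : ZMod n) : root n k ∈ rootSystem n :=
  ⟨_, ZMod.val_lt _, Or.inl rfl⟩

theorem mult_pos [NeZero n] {κ : Plane → ℝ} (hκ : IsPositiveMultiplicity n κ) (k : ZMod n) :
    0 < mult n κ k := hκ.pos _ (root_mem k)

theorem mult_conj [NeZero n] {κ : Plane → ℝ} (hκ : IsPositiveMultiplicity n κ) (i k : ZMod n) :
    mult n κ (2 * i - k) = mult n κ k := by
  unfold mult
  rcases root_conj i k with h | h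
  · rw [h, hκ.invariant _ _ (root_mem k)]
  -- Reflecting a root in its own mirror negates it, so invariance of `κ` also removes the sign
  -- ambiguity.
  · have h1 : act (.sr (2 * i - k)) (root n (2 * i - k)) = -root n (2 * i - k) := by
      rw [act_sr_eq, inner_root_self]; module
    rw [← hκ.invariant (.sr (2 * i - k)) _ (root_mem _), h1, h, neg_neg,
      hκ.invariant _ _ (root_mem k)]

theorem sum_range_eq_sum_zmod [NeZero n] (f : ℕ → ℝ) :
    ∑ j ∈ Finset.range n, f j = ∑ k : ZMod n, f (-k).val := by
  rw [Fintype.sum_equiv (Equiv.neg (ZMod n)) (fun k => f (-k).val) (fun k => f k.val)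
    (fun k => by simp)]
  refine (Finset.sum_bij (fun k _ => k.val) ?_ ?_ ?_ ?_).symm
  · intro k _; exact Finset.mem_range.2 (ZMod.val_lt k)
  · intro a _ b _ h; exact ZMod.val_injective n h
  · intro j hj; exact ⟨(j : ZMod n), Finset.mem_univ _, ZMod.val_cast_of_lt (Finset.mem_range.1 hj)⟩
  · intros; rfl

/-- Conjugation of the reflections by `s_i` leaves weighted sums over the reflections unchanged. -/
theorem sum_conj [NeZero n] {κ : Plane → ℝ} (hκ : IsPositiveMultiplicity n κ) (i : ZMod n)
    (f : ZMod n → ℝ) :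
    ∑ k, mult n κ k * f (2 * i - k) = ∑ k, mult n κ k * f k := by
  refine Fintype.sum_equiv (Equiv.subLeft (2 * i)) _ _ fun k => ?_
  simp [Equiv.subLeft_apply, mult_conj hκ]

theorem dunklOp_eq [NeZero n] (κ : Plane → ℝ) (ξ : Plane) (f : Plane → ℝ) (x : Plane) :
    dunklOp n κ ξ f x = fderiv ℝ f x ξ + ∑ k : ZMod n, mult n κ k * inner ℝ (root n k) ξ *
      ((f x - f (act (.sr k) x)) / inner ℝ (root n k) x) := by
  rw [dunklOp, sum_range_eq_sum_zmod]
  congr 1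
  refine Finset.sum_congr rfl fun k _ => ?_
  rw [← reflect_root]; rfl

theorem forall_posRoot_iff [NeZero n] (x : Plane) :
    (∀ j < n, inner ℝ (posRoot n j) x ≠ (0 : ℝ)) ↔ ∀ k : ZMod n, inner ℝ (root n k) x ≠ (0 : ℝ) := by
  refine ⟨fun h k => h _ (ZMod.val_lt _), fun h j hj => ?_⟩
  have := h (-(j : ZMod n))
  rwa [root, neg_neg, ZMod.val_cast_of_lt hj] at this

/-- The rotation by the angle `π / 2`. -/
noncomputable def quarterTurn : Plane →L[ℝ] Plane :=
  LinearMap.toContinuousLinearMap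
    { toFun := fun v => !₂[-v 1, v 0]
      map_add' := fun x y => by
        apply plane_ext
        · simp; ring
        · simp
      map_smul' := fun c x => by apply plane_ext <;> simp }

@[simp] theorem quarterTurn_zero' (v : Plane) : quarterTurn v 0 = -v 1 := by simp [quarterTurn]
@[simp] theorem quarterTurn_one' (v : Plane) : quarterTurn v 1 = v 0 := by simp [quarterTurn]

theorem quarterTurn_act_sr (k : ZMod n) (v : Plane) :
    quarterTurn (act (.sr k) v) = -act (.sr k) (quarterTurn v) := by
  apply plane_ext <;> simp <;> ring

end

end DihedralDunkl

/-! ### Comparison principle for the singular linear system. -/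

namespace DihedralDunkl

section

open Set

/-- Comparison principle for a cooperative linear system with a regular singularity at `0`. -/
theorem nonneg_of_cooperative {W ι : Type*} [Finite W] [Fintype ι] (q : ι → ℝ) (hq : ∀ i, 0 ≤ q i)
    (σ : ι → W → W) (lam : W → ℝ) (D D' : W → ℝ → ℝ)
    (hc : ∀ w, ContinuousOn (D w) (Icc 0 1))
    (hd : ∀ w, ∀ t ∈ Ioc (0 : ℝ) 1, HasDerivAt (D w) (D' w t) t)
    (h0 : ∀ w, 0 ≤ D w 0)
    (h : ∀ w, ∀ t ∈ Ioc (0 : ℝ) 1,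
      0 ≤ t * D' w t + t * lam w * D w t + ∑ i, q i * (D w t - D (σ i w) t)) :
    ∀ w, ∀ t ∈ Icc (0 : ℝ) 1, 0 ≤ D w t := by
  obtain ⟨C, hC⟩ : ∃ C : ℝ, ∀ w, -lam w < C := by
    obtain ⟨C, hC⟩ := (Set.finite_range fun w => -lam w).bddAbove
    exact ⟨C + 1, fun w => by linarith [hC ⟨w, rfl⟩]⟩
  -- The perturbation makes the inequalities strict, since `C + lam w > 0` for all `w`. At the first
  -- time when some perturbed component vanishes, its derivative is nonpositive and so is its
  -- coupling term, which contradicts the differential inequality. That time is positive because the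
  -- initial values are at least `ε`.
  have key : ∀ ε > 0, ∀ t ∈ Icc (0 : ℝ) 1, ∀ w, 0 < D w t + ε * Real.exp (C * t) := by
    intro ε hε
    by_contra! hcon
    set E : W → ℝ → ℝ := fun w t => D w t + ε * Real.exp (C * t) with hE
    have hEc : ∀ w, ContinuousOn (E w) (Icc 0 1) := fun w =>
      (hc w).add (by fun_prop)
    set Z : Set ℝ := ⋃ w, {t ∈ Icc (0 : ℝ) 1 | E w t ≤ 0} with hZ
    have hZc : IsCompact Z := by
      refine isCompact_iUnion fun w => ?_
      refine IsCompact.of_isClosed_subset isCompact_Icc ?_ (fun t ht => ht.1)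
      exact (hEc w).preimage_isClosed_of_isClosed isClosed_Icc isClosed_Iic
    obtain ⟨t₁, ht₁, w₁, hw₁⟩ := hcon
    obtain ⟨t, htZ, htmin⟩ := hZc.exists_isLeast ⟨t₁, mem_iUnion.2 ⟨w₁, ht₁, hw₁⟩⟩
    obtain ⟨w, htI, hEw⟩ := mem_iUnion.1 htZ
    have hpos : ∀ s ∈ Ico 0 t, ∀ v, 0 < E v s := by
      intro s hs v
      by_contra! hv
      have := htmin (mem_iUnion.2 ⟨v, ⟨hs.1, hs.2.le.trans htI.2⟩, hv⟩)
      linarith [hs.2]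
    have ht0 : 0 < t := by
      rcases htI.1.eq_or_lt with h' | h'
      · subst h'
        have := h0 w
        simp only [hE, mul_zero, Real.exp_zero, mul_one] at hEw
        linarith
      · exact h'
    have htI' : t ∈ Ioc (0 : ℝ) 1 := ⟨ht0, htI.2⟩
    have hnn : ∀ v, 0 ≤ E v t := by
      intro v
      have hcl : t ∈ closure (Ico 0 t) := by
        rw [closure_Ico ht0.ne]; exact ⟨ht0.le, le_rfl⟩
      refine ContinuousWithinAt.closure_le hcl (f := fun _ => (0 : ℝ)) (g := E v)
        continuousWithinAt_const ?_ (fun s hs => (hpos s hs v).le)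
      exact (hEc v t htI).mono fun s hs => ⟨hs.1, hs.2.le.trans htI.2⟩
    have hE0 : E w t = 0 := le_antisymm hEw (hnn w)
    have hder : HasDerivAt (E w) (D' w t + ε * (Real.exp (C * t) * C)) t := by
      refine (hd w t htI').add (HasDerivAt.const_mul _ ?_)
      simpa using ((hasDerivAt_id t).const_mul C).exp
    have hderle : D' w t + ε * (Real.exp (C * t) * C) ≤ 0 := by
      have hs := (hasDerivAt_iff_tendsto_slope.1 hder).mono_left
        (nhdsWithin_mono t (fun s (hs : s ∈ Iio t) => ne_of_lt hs))
      refine le_of_tendsto hs ?_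
      filter_upwards [Ioo_mem_nhdsLT ht0] with s hs
      rw [slope_def_field, hE0, sub_zero]
      exact div_nonpos_of_nonneg_of_nonpos (hpos s ⟨hs.1.le, hs.2⟩ w).le (by linarith [hs.2])
    have hsum : ∑ i, q i * (D w t - D (σ i w) t) ≤ 0 := by
      refine Finset.sum_nonpos fun i _ => mul_nonpos_of_nonneg_of_nonpos (hq i) ?_
      have h1 := hnn (σ i w)
      simp only [hE] at h1 hE0
      linarith
    have h2 := h w t htI'
    have h3 : D w t = -(ε * Real.exp (C * t)) := by simp only [hE] at hE0; linarith
    have h5 : t * lam w * D w t = -(t * lam w * (ε * Real.exp (C * t))) := by rw [h3]; ring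
    have h4 : 0 < t * (ε * Real.exp (C * t)) * (C + lam w) := by
      have := hC w
      have : 0 < C + lam w := by linarith
      positivity
    nlinarith [mul_le_mul_of_nonneg_left hderle ht0.le]
  intro w t ht
  by_contra! hneg
  have hexp : 0 < Real.exp (C * t) := Real.exp_pos _
  have := key (-D w t / Real.exp (C * t)) (by rw [gt_iff_lt]; apply div_pos <;> linarith) t ht w
  rw [div_mul_cancel₀ _ hexp.ne'] at this
  linarith

theorem eq_zero_of_cooperative {W ι : Type*} [Finite W] [Fintype ι] (q : ι → ℝ) (hq : ∀ i, 0 ≤ q i)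
    (σ : ι → W → W) (lam : W → ℝ) (D D' : W → ℝ → ℝ)
    (hc : ∀ w, ContinuousOn (D w) (Icc 0 1))
    (hd : ∀ w, ∀ t ∈ Ioc (0 : ℝ) 1, HasDerivAt (D w) (D' w t) t)
    (h0 : ∀ w, D w 0 = 0)
    (h : ∀ w, ∀ t ∈ Ioc (0 : ℝ) 1,
      t * D' w t + t * lam w * D w t + ∑ i, q i * (D w t - D (σ i w) t) = 0) :
    ∀ w, D w 1 = 0 := by
  intro w
  refine le_antisymm ?_ (nonneg_of_cooperative q hq σ lam D D' hc hd (fun w => (h0 w).ge)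
    (fun w t ht => (h w t ht).ge) w 1 (by simp))
  have := nonneg_of_cooperative q hq σ lam (fun w t => -D w t) (fun w t => -D' w t)
    (fun w => (hc w).neg) (fun w t ht => (hd w t ht).neg) (fun w => by simp [h0 w])
    (fun w t ht => by
      have h1 := h w t ht
      have h2 : ∑ i, q i * (-D w t - -D (σ i w) t) = -∑ i, q i * (D w t - D (σ i w) t) := by
        rw [← Finset.sum_neg_distrib]
        exact Finset.sum_congr rfl fun i _ => by ring
      rw [h2]; linarith) w 1 (by simp)
  simpa using this

end

end DihedralDunkl

/-! ### Existence of a smooth radial solution as an entire power series. -/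

namespace DihedralDunkl

section

open Set Finset

/-- `f` is smooth, normalized at the origin, and solves the Dunkl eigenvalue equation in the radial
direction. -/
structure IsRadialSolution (n : ℕ) [NeZero n] (κ : Plane → ℝ) (y : Plane) (f : Plane → ℝ) :
    Prop where
  smooth : ContDiff ℝ ((⊤ : ℕ∞) : WithTop ℕ∞) f
  radial : ∀ x, fderiv ℝ f x x + ∑ k, mult n κ k * (f x - f (act (.sr k) x)) = inner ℝ x y * f x
  map_zero : f 0 = 1

theorem exists_dependent_sequence {X : ℕ → Type*} (a : X 0) (next : ∀ m, X m → X (m + 1)) :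
    ∃ p : ∀ m, X m, p 0 = a ∧ ∀ m, p (m + 1) = next m (p m) :=
  ⟨fun m => Nat.rec a next m, rfl, fun _ => rfl⟩

/-- Neumann series for `1 - T/(a+K)`, whose perturbation has norm less than one. The norm bound,
free of `K`, follows from `(a+K)‖P‖ ≤ ‖Q‖ + K‖P‖`. -/
theorem exists_smul_sub_eq {E : Type*} [NormedAddCommGroup E] [NormedSpace ℝ E] [CompleteSpace E]
    (T : E →ₗ[ℝ] E) {K a : ℝ} (ha : 0 < a) (hK : 0 ≤ K) (hT : ∀ P, ‖T P‖ ≤ K * ‖P‖) (Q : E) :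
    ∃ P : E, (a + K) • P - T P = Q ∧ a * ‖P‖ ≤ ‖Q‖ := by
  set S : E →L[ℝ] E := T.mkContinuous K hT with hSdef
  have hS : ‖S‖ ≤ K := T.mkContinuous_norm_le hK hT
  have haK : 0 < a + K := by linarith
  have hlt : ‖(a + K)⁻¹ • S‖ < 1 := by
    rw [norm_smul, norm_inv, Real.norm_of_nonneg haK.le, inv_mul_lt_iff₀ haK]; linarith
  set U := Units.oneSub ((a + K)⁻¹ • S) hlt with hU
  refine ⟨(U⁻¹).1 ((a + K)⁻¹ • Q), ?_⟩
  set P := (U⁻¹).1 ((a + K)⁻¹ • Q) with hP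
  have h1 : U.1 P = (a + K)⁻¹ • Q := by
    rw [hP, ← mul_apply_eq_comp, Units.mul_inv, one_apply_eq_self]
  have h2 : P - (a + K)⁻¹ • S P = (a + K)⁻¹ • Q := by
    rw [← h1, hU]; rfl
  have h3 : (a + K) • P - S P = Q := by
    have := congrArg (fun z => (a + K) • z) h2
    simpa [smul_sub, smul_smul, mul_inv_cancel₀ haK.ne'] using this
  refine ⟨h3, ?_⟩
  have h4 : ‖(a + K) • P‖ ≤ ‖Q‖ + ‖S P‖ := by
    rw [← h3]; simpa using norm_add_le ((a + K) • P - S P) (S P)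
  rw [norm_smul, Real.norm_of_nonneg haK.le] at h4
  have h5 : ‖S P‖ ≤ K * ‖P‖ := (S.le_opNorm P).trans (by gcongr)
  linarith

theorem exists_tensor (y : Plane) {m : ℕ} (P : Plane [×m]→L[ℝ] ℝ) :
    ∃ Q : Plane [×(m + 1)]→L[ℝ] ℝ, (∀ x : Plane, Q (fun _ => x) = inner ℝ y x * P (fun _ => x)) ∧
      ‖Q‖ ≤ ‖y‖ * ‖P‖ := by
  refine ⟨((innerSL ℝ y).smulRight P).uncurryLeft, fun x => ?_, ?_⟩
  · simp only [ContinuousLinearMap.uncurryLeft_apply, ContinuousLinearMap.smulRight_apply,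
      smul_apply, innerSL_apply_apply, smul_eq_mul]
    rfl
  · rw [ContinuousLinearMap.uncurryLeft_norm, ContinuousLinearMap.norm_smulRight_apply,
      innerSL_apply_norm]

variable (n : ℕ) [NeZero n] (κ : Plane → ℝ)

/-- The weighted sum of the reflections acting on `m`-linear forms. -/
noncomputable def reflectionSum (m : ℕ) :
    (Plane [×m]→L[ℝ] ℝ) →ₗ[ℝ] (Plane [×m]→L[ℝ] ℝ) where
  toFun P := ∑ k : ZMod n, mult n κ k • P.compContinuousLinearMap fun _ => actL (.sr k)
  map_add' P Q := by ext v; simp [mul_add, sum_add_distrib]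
  map_smul' c P := by ext v; simp [mul_sum, mul_left_comm]

theorem reflectionSum_apply (m : ℕ) (P : Plane [×m]→L[ℝ] ℝ) (v : Fin m → Plane) :
    reflectionSum n κ m P v = ∑ k, mult n κ k * P (fun i => act (.sr k) (v i)) := by
  simp [reflectionSum]

variable {n κ}

theorem norm_reflectionSum_le (hκ : IsPositiveMultiplicity n κ) (m : ℕ)
    (P : Plane [×m]→L[ℝ] ℝ) : ‖reflectionSum n κ m P‖ ≤ (∑ k, mult n κ k) * ‖P‖ := by
  have hK : 0 ≤ ∑ k, mult n κ k := sum_nonneg fun k _ => (mult_pos hκ k).le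
  refine ContinuousMultilinearMap.opNorm_le_bound (by positivity) fun v => ?_
  rw [reflectionSum_apply, sum_mul, sum_mul]
  refine (norm_sum_le _ _).trans (sum_le_sum fun k _ => ?_)
  rw [norm_mul, Real.norm_of_nonneg (mult_pos hκ k).le, mul_assoc]
  have h := P.le_opNorm fun i => act (.sr k) (v i)
  simp only [norm_act] at h
  exact mul_le_mul_of_nonneg_left h (mult_pos hκ k).le

theorem exists_reflectionSum_resolvent (hκ : IsPositiveMultiplicity n κ) (m : ℕ) {a : ℝ}
    (ha : 0 < a) (Q : Plane [×m]→L[ℝ] ℝ) : ∃ P : Plane [×m]→L[ℝ] ℝ,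
      (a + ∑ k, mult n κ k) • P - reflectionSum n κ m P = Q ∧ a * ‖P‖ ≤ ‖Q‖ :=
  exists_smul_sub_eq (reflectionSum n κ m) ha (sum_nonneg fun k _ => (mult_pos hκ k).le)
    (norm_reflectionSum_le hκ m) Q

/-- These are the homogeneous components of the radial equation: by Euler's identity the radial
derivative multiplies degree `m + 1` by `m + 1`. Solving for the next term with the resolvent at `a
= m + 1` gains a factor `1/(m+1)`, hence the factorial. -/
theorem exists_homogeneous_terms (hκ : IsPositiveMultiplicity n κ) (y : Plane) :
    ∃ p : FormalMultilinearSeries ℝ Plane ℝ,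
      (∀ x, p 0 (fun _ => x) = 1) ∧ (∀ m, ‖p m‖ ≤ ‖y‖ ^ m / m.factorial) ∧
      ∀ m (x : Plane), (m + 1) * p (m + 1) (fun _ => x) +
        ∑ k, mult n κ k * (p (m + 1) (fun _ => x) - p (m + 1) (fun _ => act (.sr k) x)) =
          inner ℝ x y * p m (fun _ => x) := by
  have step : ∀ m (P : Plane [×m]→L[ℝ] ℝ), ∃ P' : Plane [×(m + 1)]→L[ℝ] ℝ,
      (∀ x : Plane, (m + 1 + ∑ k, mult n κ k) * P' (fun _ => x) -
        ∑ k, mult n κ k * P' (fun _ => act (.sr k) x) = inner ℝ y x * P (fun _ => x)) ∧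
      (m + 1 : ℝ) * ‖P'‖ ≤ ‖y‖ * ‖P‖ := fun m P => by
    obtain ⟨Q, hQ, hQn⟩ := exists_tensor y P
    obtain ⟨P', h1, h2⟩ := exists_reflectionSum_resolvent hκ (m + 1)
      (a := m + 1) (by positivity) Q
    refine ⟨P', fun x => ?_, h2.trans hQn⟩
    rw [← hQ, ← h1]
    simp only [sub_apply, smul_apply,
      reflectionSum_apply, smul_eq_mul]
  choose next hnext hnorm using step
  obtain ⟨p, hp0, hp⟩ := exists_dependent_sequence (X := fun m => Plane [×m]→L[ℝ] ℝ)
    (ContinuousMultilinearMap.constOfIsEmpty ℝ _ 1) next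
  refine ⟨p, fun x => by rw [hp0]; rfl, fun m => ?_, fun m x => ?_⟩
  · induction m with
    | zero => simp [hp0]
    | succ m ih =>
      have h1 := hnorm m (p m)
      rw [← hp] at h1
      have h2 : (m + 1 : ℝ) * ‖p (m + 1)‖ ≤ ‖y‖ * (‖y‖ ^ m / m.factorial) :=
        h1.trans (by gcongr)
      have h3 : ‖y‖ ^ (m + 1) / ((m + 1).factorial : ℝ) =
          (‖y‖ * (‖y‖ ^ m / m.factorial)) / (m + 1 : ℝ) := by
        rw [Nat.factorial_succ]; push_cast; field_simp; ring
      rw [h3, le_div_iff₀ (by positivity)]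
      linarith
  · have h1 := hnext m (p m) x
    rw [← hp] at h1
    simp only [mul_sub, sum_sub_distrib, ← Finset.sum_mul]
    rw [real_inner_comm]
    linarith

theorem exists_isRadialSolution (hκ : IsPositiveMultiplicity n κ) (y : Plane) :
    ∃ f, IsRadialSolution n κ y f := by
  obtain ⟨p, hp0, hpn, hp⟩ := exists_homogeneous_terms hκ y
  have hsum : ∀ r : ℝ, Summable fun m => (‖y‖ * r) ^ m / (m.factorial : ℝ) := fun r =>
    Real.summable_pow_div_factorial _
  have hrad : p.radius = ⊤ := by
    refine p.radius_eq_top_of_summable_norm fun r => ?_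
    refine Summable.of_nonneg_of_le (fun m => by positivity) (fun m => ?_) (hsum r)
    rw [mul_pow, mul_div_right_comm]
    gcongr; exact hpn m
  have hball := p.hasFPowerSeriesOnBall (by rw [hrad]; exact ENNReal.zero_lt_top)
  rw [hrad] at hball
  set f := p.sum with hf
  have han : AnalyticOnNhd ℝ f univ := by
    have := hball.analyticOnNhd
    rwa [Metric.eball_top] at this
  have hsmooth : ContDiff ℝ ((⊤ : ℕ∞) : WithTop ℕ∞) f := han.contDiff
  have hbound : ∀ m (x : Plane), ‖p m (fun _ => x)‖ ≤ (‖y‖ * ‖x‖) ^ m / m.factorial := by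
    intro m x
    refine ((p m).le_opNorm _).trans ?_
    rw [Finset.prod_const, Finset.card_univ, Fintype.card_fin, mul_pow, mul_div_right_comm]
    gcongr; exact hpn m
  have hterm : ∀ x : Plane, Summable fun m => p m (fun _ => x) := fun x =>
    Summable.of_norm_bounded (hsum _) (fun m => hbound m x)
  have hfx : ∀ x, f x = ∑' m, p m (fun _ => x) := fun x => rfl
  have hfsum : ∀ x, HasSum (fun m => p m (fun _ => x)) (f x) := fun x => (hterm x).hasSum
  have hder : ∀ x, HasSum (fun m : ℕ => (m + 1 : ℝ) * p (m + 1) (fun _ => x)) (fderiv ℝ f x x) := by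
    intro x
    have hsc : ∀ (t : ℝ) m, p m (fun _ => t • x) = t ^ m * p m (fun _ => x) := by
      intro t m
      simpa using (p m).map_smul_univ (fun _ => t) (fun _ => x)
    have hline : HasDerivAt (fun t : ℝ => f (t • x)) (fderiv ℝ f x x) 1 := by
      have h1 : HasFDerivAt f (fderiv ℝ f ((1 : ℝ) • x)) ((1 : ℝ) • x) :=
        (hsmooth.differentiable (by simp) _).hasFDerivAt
      have h2 : HasDerivAt (fun t : ℝ => t • x) x 1 := by
        simpa using (hasDerivAt_id (1 : ℝ)).smul_const x
      have h3 := h1.comp_hasDerivAt 1 h2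
      rw [one_smul] at h3
      exact h3
    -- The series in `t` is differentiated termwise at `t = 1`, inside the interval `|t| < 2`; this
    -- is the uniform majorant of the derivatives there.
    have hu : Summable fun m : ℕ => (m : ℝ) * 2 ^ (m - 1) * ‖p m (fun _ => x)‖ := by
      refine Summable.of_nonneg_of_le (fun m => by positivity) (fun m => ?_)
        (hsum (4 * ‖x‖))
      have h4 : (m : ℝ) * 2 ^ (m - 1) ≤ 4 ^ m := by
        have h5 : (m : ℝ) ≤ 2 ^ m := by exact_mod_cast Nat.lt_two_pow_self.le
        have h6 : (2 : ℝ) ^ (m - 1) ≤ 2 ^ m := pow_le_pow_right₀ (by norm_num) (by omega)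
        calc (m : ℝ) * 2 ^ (m - 1) ≤ 2 ^ m * 2 ^ m := by gcongr
          _ = 4 ^ m := by rw [← mul_pow]; norm_num
      calc (m : ℝ) * 2 ^ (m - 1) * ‖p m (fun _ => x)‖
          ≤ 4 ^ m * ((‖y‖ * ‖x‖) ^ m / m.factorial) := by gcongr; exact hbound m x
        _ = (‖y‖ * (4 * ‖x‖)) ^ m / m.factorial := by
            rw [show ‖y‖ * (4 * ‖x‖) = 4 * (‖y‖ * ‖x‖) by ring, mul_pow]; ring
    have hd := hasDerivAt_tsum_of_isPreconnected
      (g := fun (m : ℕ) (t : ℝ) => t ^ m * p m (fun _ => x))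
      (g' := fun m t => (m : ℝ) * t ^ (m - 1) * p m (fun _ => x))
      (t := Ioo (-2) 2) (y₀ := 0) (y := 1) hu isOpen_Ioo isPreconnected_Ioo
      (fun m t _ => (hasDerivAt_pow m t).mul_const _)
      (fun m t ht => by
        rw [norm_mul, norm_mul, norm_pow, Real.norm_natCast]
        gcongr
        exact abs_le.2 ⟨ht.1.le, ht.2.le⟩)
      (by norm_num) (by
        have := hterm ((0 : ℝ) • x)
        simpa only [hsc] using this) (by norm_num)
    have heq : (fun t : ℝ => ∑' m, t ^ m * p m (fun _ => x)) = fun t => f (t • x) := by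
      funext t; rw [hfx]; simp only [hsc]
    rw [heq] at hd
    have hu' : Summable fun m : ℕ => (m : ℝ) * (1 : ℝ) ^ (m - 1) * p m (fun _ => x) := by
      refine Summable.of_norm_bounded hu fun m => ?_
      rw [norm_mul, norm_mul, norm_pow, Real.norm_natCast]
      gcongr; norm_num
    have h7 := hu'.hasSum
    rw [hd.unique hline, ← hasSum_nat_add_iff' 1] at h7
    simpa using h7
  refine ⟨f, hsmooth, fun x => ?_, ?_⟩
  · have h1 : ∀ z, HasSum (fun m => p (m + 1) (fun _ => z)) (f z - 1) := by
      intro z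
      have := (hasSum_nat_add_iff' 1).2 (hfsum z)
      simpa [hp0] using this
    have h2 : HasSum (fun m : ℕ => (m + 1 : ℝ) * p (m + 1) (fun _ => x) + ∑ k : ZMod n, mult n κ k *
        (p (m + 1) (fun _ => x) - p (m + 1) (fun _ => act (.sr k) x)))
        (fderiv ℝ f x x + ∑ k : ZMod n, mult n κ k *
          ((f x - 1) - (f (act (.sr k) x) - 1))) :=
      (hder x).add (hasSum_sum fun k _ => ((h1 x).sub (h1 _)).mul_left _)
    simp only [hp] at h2
    have h3 := h2.unique ((hfsum x).mul_left _)
    simpa using h3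
  · have h1 := hfsum 0
    have h2 : HasSum (fun m => p m (fun _ => (0 : Plane))) 1 := by
      have := hasSum_single (f := fun m => p m (fun _ => (0 : Plane))) 0 (fun m hm => by
        have : Nonempty (Fin m) := ⟨⟨0, Nat.pos_of_ne_zero hm⟩⟩
        exact (p m).map_zero)
      simpa [hp0] using this
    exact h1.unique h2

end

end DihedralDunkl

/-! ### Uniqueness along rays, and the defect of the angular equation. -/

namespace DihedralDunkl

section

open Set Finset

variable {n : ℕ} [NeZero n] {κ : Plane → ℝ}

/-- `x` lies on none of the reflection lines. -/
def IsRegular (n : ℕ) (x : Plane) : Prop := ∀ k : ZMod n, inner ℝ (root n k) x ≠ (0 : ℝ)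

theorem inner_act_sr_left (k : ZMod n) (x y : Plane) :
    inner ℝ (act (.sr k) x) y = (inner ℝ x (act (.sr k) y) : ℝ) := by
  rw [inner_act_left]; rfl

theorem IsRegular.act_sr {x : Plane} (hx : IsRegular n x) (i : ZMod n) :
    IsRegular n (act (.sr i) x) := by
  intro k
  rw [← inner_act_sr_left]
  have h := hx (2 * i - k)
  rcases root_conj i k with h1 | h1 <;> rw [h1] at h
  · exact h
  · rwa [inner_neg_left, neg_ne_zero] at h

theorem IsRegular.act {x : Plane} (hx : IsRegular n x) (w : DihedralGroup n) :
    IsRegular n (act w x) := by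
  rcases w with j | j
  · have : (.r j : DihedralGroup n) = .sr 0 * .sr j := by simp
    rw [this, act_mul]
    exact (hx.act_sr j).act_sr 0
  · exact hx.act_sr j

theorem IsRegular.smul {x : Plane} (hx : IsRegular n x) {t : ℝ} (ht : t ≠ 0) :
    IsRegular n (t • x) := by
  intro k
  rw [inner_smul_right]
  exact mul_ne_zero ht (hx k)

theorem hasDerivAt_ray {f : Plane → ℝ} (hf : Differentiable ℝ f) (x : Plane) (t : ℝ) :
    HasDerivAt (fun s : ℝ => f (s • x)) (fderiv ℝ f (t • x) x) t := by
  have h2 : HasDerivAt (fun s : ℝ => s • x) x t := by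
    simpa using (hasDerivAt_id t).smul_const x
  exact (hf _).hasFDerivAt.comp_hasDerivAt t h2

/-- The values of `f₁ - f₂` at `t • act w x` form a closed system in `w`, as reflections permute
these rays. The equation is demanded only on the orbit of one ray, so that the lemma also applies to
functions satisfying it merely at regular points. -/
theorem eq_of_radial_on_ray (hκ : IsPositiveMultiplicity n κ) {y x : Plane} {f₁ f₂ : Plane → ℝ}
    (hf₁ : Differentiable ℝ f₁) (hf₂ : Differentiable ℝ f₂) (h0 : f₁ 0 = f₂ 0)
    (h₁ : ∀ w : DihedralGroup n, ∀ t ∈ Ioc (0 : ℝ) 1,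
      fderiv ℝ f₁ (t • act w x) (t • act w x) + ∑ k, mult n κ k *
        (f₁ (t • act w x) - f₁ (act (.sr k) (t • act w x))) =
          inner ℝ (t • act w x) y * f₁ (t • act w x))
    (h₂ : ∀ w : DihedralGroup n, ∀ t ∈ Ioc (0 : ℝ) 1,
      fderiv ℝ f₂ (t • act w x) (t • act w x) + ∑ k, mult n κ k *
        (f₂ (t • act w x) - f₂ (act (.sr k) (t • act w x))) =
          inner ℝ (t • act w x) y * f₂ (t • act w x)) : f₁ x = f₂ x := by
  have key := eq_zero_of_cooperative (W := DihedralGroup n) (mult n κ)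
    (fun k => (mult_pos hκ k).le) (fun k w => .sr k * w) (fun w => -inner ℝ (act w x) y)
    (fun w t => f₁ (t • act w x) - f₂ (t • act w x))
    (fun w t => fderiv ℝ f₁ (t • act w x) (act w x) - fderiv ℝ f₂ (t • act w x) (act w x))
    (fun w => ((hf₁.continuous.comp (by fun_prop)).sub
      (hf₂.continuous.comp (by fun_prop))).continuousOn)
    (fun w t _ => (hasDerivAt_ray hf₁ _ t).sub (hasDerivAt_ray hf₂ _ t))
    (fun w => by simp [h0])
    (fun w t ht => by
      have e₁ := h₁ w t ht
      have e₂ := h₂ w t ht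
      simp only [act_smul, ← act_mul, map_smul, smul_eq_mul, inner_smul_left, RCLike.conj_to_real]
        at e₁ e₂
      have e₃ : ∑ k, mult n κ k * (f₁ (t • act w x) - f₂ (t • act w x) -
          (f₁ (t • act (.sr k * w) x) - f₂ (t • act (.sr k * w) x))) =
          ∑ k, mult n κ k * (f₁ (t • act w x) - f₁ (t • act (.sr k * w) x)) -
          ∑ k, mult n κ k * (f₂ (t • act w x) - f₂ (t • act (.sr k * w) x)) := by
        rw [← sum_sub_distrib]
        exact sum_congr rfl fun k _ => by ring
      rw [e₃]
      linear_combination e₁ - e₂)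
  have := key 1
  simp only [act_one, one_smul] at this
  linarith

theorem IsRadialSolution.differentiable {y : Plane} {f : Plane → ℝ}
    (hf : IsRadialSolution n κ y f) : Differentiable ℝ f := hf.smooth.differentiable (by simp)

theorem IsRadialSolution.unique (hκ : IsPositiveMultiplicity n κ) {y : Plane} {f₁ f₂ : Plane → ℝ}
    (h₁ : IsRadialSolution n κ y f₁) (h₂ : IsRadialSolution n κ y f₂) : f₁ = f₂ := by
  funext x
  exact eq_of_radial_on_ray hκ h₁.differentiable h₂.differentiable
    (h₁.map_zero.trans h₂.map_zero.symm) (fun w t _ => h₁.radial _) (fun w t _ => h₂.radial _)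

theorem IsDunklEigenfunction.radial {y : Plane} {f : Plane → ℝ}
    (hf : IsDunklEigenfunction n κ y f) {x : Plane} (hx : IsRegular n x) :
    fderiv ℝ f x x + ∑ k, mult n κ k * (f x - f (act (.sr k) x)) = inner ℝ x y * f x := by
  rw [← hf.eigen x x ((forall_posRoot_iff x).2 hx), dunklOp_eq]
  congr 1
  refine sum_congr rfl fun k _ => ?_
  have := hx k
  field_simp

theorem dense_isRegular : Dense {x : Plane | IsRegular n x} := by
  have : {x : Plane | IsRegular n x} = ⋂ k : ZMod n, {x | inner ℝ (root n k) x ≠ (0 : ℝ)} := by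
    ext x; simp [IsRegular]
  rw [this]
  refine dense_iInter_of_isOpen (fun k => ?_) fun k => ?_
  · exact isOpen_ne_fun (by fun_prop) continuous_const
  · refine (dense_compl_singleton (0 : ℝ)).preimage (f := fun x => inner ℝ (root n k) x) ?_
    exact (innerSL ℝ (root n k)).isOpenMap fun c =>
      ⟨c • root n k, by
        rw [innerSL_apply_apply, inner_smul_right, inner_root_self, mul_one]⟩

/-- The orbit of a regular ray stays regular for `t > 0`, so the solutions agree at regular points,
and these are dense. -/
theorem IsDunklEigenfunction.unique (hκ : IsPositiveMultiplicity n κ) {y : Plane}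
    {f₁ f₂ : Plane → ℝ} (h₁ : IsDunklEigenfunction n κ y f₁) (h₂ : IsDunklEigenfunction n κ y f₂) :
    f₁ = f₂ := by
  refine Continuous.ext_on (dense_isRegular (n := n)) h₁.smooth.continuous h₂.smooth.continuous
    fun x hx => ?_
  have hreg : ∀ w : DihedralGroup n, ∀ t ∈ Ioc (0 : ℝ) 1, IsRegular n (t • DihedralDunkl.act w x) :=
    fun w t ht => (IsRegular.act hx w).smul ht.1.ne'
  exact eq_of_radial_on_ray hκ (h₁.smooth.differentiable (by simp))
    (h₂.smooth.differentiable (by simp)) (h₁.map_zero.trans h₂.map_zero.symm)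
    (fun w t ht => h₁.radial (hreg w t ht)) (fun w t ht => h₂.radial (hreg w t ht))

/-- The coefficient of the `k`-th difference quotient in the angular Dunkl operator. -/
noncomputable def angularCoeff (n : ℕ) (k : ZMod n) (x : Plane) : ℝ :=
  inner ℝ (root n k) (quarterTurn x) / inner ℝ (root n k) x

theorem angularCoeff_conj (i k : ZMod n) (x : Plane) :
    angularCoeff n (2 * i - k) (act (.sr i) x) = -angularCoeff n k x := by
  have h : ∀ z, inner ℝ (act (.sr i) (root n k)) (act (.sr i) z) = (inner ℝ (root n k) z : ℝ) :=
    fun z => inner_act_act _ _ _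
  rcases root_conj i k with h1 | h1 <;> unfold angularCoeff <;>
    rw [h1, quarterTurn_act_sr] <;> simp only [inner_neg_left, inner_neg_right, h] <;> ring

theorem angularCoeff_smul (k : ZMod n) (x : Plane) {t : ℝ} (ht : t ≠ 0) :
    angularCoeff n k (t • x) = angularCoeff n k x := by
  simp only [angularCoeff, map_smul, inner_smul_right]
  exact mul_div_mul_left _ _ ht

/-- With `J` the quarter turn and `α` the root, `x - s_k x = 2⟪α, x⟫ α`, so the coefficient turns it
into `2⟪α, Jx⟫ α = Jx - s_k Jx`. As `J` anticommutes with reflections, this is `Jx + J s_k x`. -/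
theorem angularCoeff_mul {x : Plane} (hx : IsRegular n x) (k : ZMod n) (y : Plane) :
    angularCoeff n k x * inner ℝ (x - act (.sr k) x) y =
      inner ℝ (quarterTurn x) y + inner ℝ (quarterTurn (act (.sr k) x)) y := by
  have := hx k
  rw [quarterTurn_act_sr, ← inner_add_left, act_sr_eq, act_sr_eq, angularCoeff]
  simp only [sub_sub_cancel, ← sub_eq_add_neg, inner_smul_left, RCLike.conj_to_real]
  field_simp

/-- The defect of the angular eigenvalue equation. -/
noncomputable def angularDefect (n : ℕ) [NeZero n] (κ : Plane → ℝ) (y : Plane) (f : Plane → ℝ)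
    (x : Plane) : ℝ :=
  fderiv ℝ f x (quarterTurn x) +
    ∑ k, mult n κ k * (angularCoeff n k x * (f x - f (act (.sr k) x))) -
    inner ℝ (quarterTurn x) y * f x

/-- Reindexing by `k ↦ 2i - k` brings the difference quotients at `s_i x` back to coefficients at
`x`, using `s_{2i-k} s_i = s_i s_k`. The minus sign reflects the reversed orientation. -/
theorem angularDefect_act_sr (hκ : IsPositiveMultiplicity n κ) (y : Plane) (f : Plane → ℝ)
    (x : Plane) (i : ZMod n) :
    angularDefect n κ y f (act (.sr i) x) =
      fderiv ℝ f (act (.sr i) x) (quarterTurn (act (.sr i) x)) -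
      ∑ k, mult n κ k * (angularCoeff n k x *
        (f (act (.sr i) x) - f (act (.sr i) (act (.sr k) x)))) -
      inner ℝ (quarterTurn (act (.sr i) x)) y * f (act (.sr i) x) := by
  rw [angularDefect, ← sum_conj hκ i, sub_left_inj, sub_eq_add_neg, ← sum_neg_distrib]
  congr 1
  refine sum_congr rfl fun k _ => ?_
  have : (.sr (2 * i - k) : DihedralGroup n) * .sr i = .sr i * .sr k := by
    simp only [DihedralGroup.sr_mul_sr]; congr 1; ring
  rw [angularCoeff_conj, ← act_mul, this, ← act_mul]
  ring

theorem IsRadialSolution.fderiv_radial {y : Plane} {f : Plane → ℝ}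
    (hf : IsRadialSolution n κ y f) (x v : Plane) :
    fderiv ℝ (fderiv ℝ f) x v x + fderiv ℝ f x v +
      ∑ k, mult n κ k * (fderiv ℝ f x v - fderiv ℝ f (act (.sr k) x) (act (.sr k) v)) =
      inner ℝ v y * f x + inner ℝ x y * fderiv ℝ f x v := by
  have hd := hf.differentiable
  have hd2 : Differentiable ℝ (fderiv ℝ f) :=
    (hf.smooth.fderiv_right (m := 1) (by norm_cast)).differentiable (by simp)
  have hid : HasDerivAt (fun s : ℝ => x + s • v) v 0 := by
    simpa using ((hasDerivAt_id (0 : ℝ)).smul_const v).const_add x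
  have hline : ∀ (A : Plane →L[ℝ] Plane),
      HasDerivAt (fun s : ℝ => f (A (x + s • v))) (fderiv ℝ f (A x) (A v)) 0 := by
    intro A
    have h1 : HasDerivAt (fun s : ℝ => A (x + s • v)) (A v) 0 :=
      A.hasFDerivAt.comp_hasDerivAt 0 hid
    have h2 : HasFDerivAt f (fderiv ℝ f (A x)) (A (x + (0 : ℝ) • v)) := by
      simpa using (hd (A x)).hasFDerivAt
    exact h2.comp_hasDerivAt 0 h1
  have hf0 : HasDerivAt (fun s : ℝ => f (x + s • v)) (fderiv ℝ f x v) 0 :=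
    hline (ContinuousLinearMap.id ℝ _)
  have hfd : HasDerivAt (fun s : ℝ => fderiv ℝ f (x + s • v)) (fderiv ℝ (fderiv ℝ f) x v) 0 := by
    have h2 : HasFDerivAt (fderiv ℝ f) (fderiv ℝ (fderiv ℝ f) x) (x + (0 : ℝ) • v) := by
      simpa using (hd2 x).hasFDerivAt
    exact h2.comp_hasDerivAt 0 hid
  have hin : HasDerivAt (fun s : ℝ => (inner ℝ (x + s • v) y : ℝ)) (inner ℝ v y) 0 := by
    simpa using hid.inner ℝ (hasDerivAt_const (0 : ℝ) y)
  have hL := (hfd.clm_apply hid).add (HasDerivAt.fun_sum (u := Finset.univ) fun (k : ZMod n) _ =>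
    (hf0.sub (hline (actL (.sr k)))).const_mul (mult n κ k))
  have hR := hin.mul hf0
  have : (fun s : ℝ => (inner ℝ (x + s • v) y : ℝ)) * (fun s : ℝ => f (x + s • v)) =
      (fun s : ℝ => fderiv ℝ f (x + s • v) (x + s • v)) + fun s : ℝ => ∑ k, mult n κ k *
        (f (x + s • v) - f (actL (.sr k) (x + s • v))) := by
    funext s
    exact (hf.radial (x + s • v)).symm
  rw [this] at hR
  have := hL.unique hR
  simpa using this

end

end DihedralDunkl

/-! ### Vanishing of the angular defect, and existence and equivariance of the kernel. -/

namespace DihedralDunkl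

section

open Set Finset

variable {n : ℕ} [NeZero n] {κ : Plane → ℝ}

/-- The sign character of the Weyl group. -/
def weylSign : DihedralGroup n → ℝ
  | .r _ => 1
  | .sr _ => -1

theorem weylSign_sr_mul (k : ZMod n) (w : DihedralGroup n) :
    weylSign (.sr k * w) = -weylSign w := by
  rcases w with j | j <;> simp [weylSign]

/-- The angular coefficients are homogeneous of degree zero, and at `t = 0` the differences they
multiply vanish. Freezing them at `x` makes the defect differentiable up to the origin. -/
theorem angularDefect_smul (y : Plane) (f : Plane → ℝ) (x : Plane) (t : ℝ) :
    angularDefect n κ y f (t • x) = t * fderiv ℝ f (t • x) (quarterTurn x) +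
      ∑ k, mult n κ k * (angularCoeff n k x * (f (t • x) - f (t • act (.sr k) x))) -
      t * inner ℝ (quarterTurn x) y * f (t • x) := by
  have : ∀ k : ZMod n, angularCoeff n k (t • x) * (f (t • x) - f (t • act (.sr k) x)) =
      angularCoeff n k x * (f (t • x) - f (t • act (.sr k) x)) := by
    intro k
    rcases eq_or_ne t 0 with rfl | ht
    · simp
    · rw [angularCoeff_smul k x ht]
  simp only [angularDefect, act_smul, this, map_smul, smul_eq_mul, inner_smul_left,
    RCLike.conj_to_real]

theorem IsRadialSolution.hasDerivAt_angularDefect {y : Plane} {f : Plane → ℝ}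
    (hf : IsRadialSolution n κ y f) (x : Plane) (t : ℝ) :
    HasDerivAt (fun s : ℝ => angularDefect n κ y f (s • x))
      (fderiv ℝ f (t • x) (quarterTurn x) + t * fderiv ℝ (fderiv ℝ f) (t • x) x (quarterTurn x) +
        ∑ k, mult n κ k * (angularCoeff n k x *
          (fderiv ℝ f (t • x) x - fderiv ℝ f (t • act (.sr k) x) (act (.sr k) x))) -
        (inner ℝ (quarterTurn x) y * f (t • x) +
          t * inner ℝ (quarterTurn x) y * fderiv ℝ f (t • x) x)) t := by
  have hd := hf.differentiable
  have hd2 : Differentiable ℝ (fderiv ℝ f) :=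
    (hf.smooth.fderiv_right (m := 1) (by norm_cast)).differentiable (by simp)
  have hray : HasDerivAt (fun s : ℝ => s • x) x t := by
    simpa using (hasDerivAt_id t).smul_const x
  have h1 : HasDerivAt (fun s : ℝ => fderiv ℝ f (s • x)) (fderiv ℝ (fderiv ℝ f) (t • x) x) t :=
    (hd2 _).hasFDerivAt.comp_hasDerivAt t hray
  have h2 : HasDerivAt (fun s : ℝ => fderiv ℝ f (s • x) (quarterTurn x))
      (fderiv ℝ (fderiv ℝ f) (t • x) x (quarterTurn x)) t := by
    simpa using h1.clm_apply (hasDerivAt_const t (quarterTurn x))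
  have h3 := (((hasDerivAt_id t).mul h2).add (HasDerivAt.fun_sum (u := Finset.univ)
    fun (k : ZMod n) _ => (((hasDerivAt_ray hd x t).sub
      (hasDerivAt_ray hd (act (.sr k) x) t)).const_mul (angularCoeff n k x)).const_mul
        (mult n κ k))).sub
    (((hasDerivAt_id t).mul_const (inner ℝ (quarterTurn x) y)).mul (hasDerivAt_ray hd x t))
  refine (h3.congr_of_eventuallyEq (Filter.Eventually.of_forall fun s => ?_)).congr_deriv ?_
  · rw [angularDefect_smul]; rfl
  · simp

/-- This is where the commutation of Dunkl operators enters. The left side is the radial derivative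
of the defect; it is evaluated with the radial equation at `z` and its reflections, and with that
equation differentiated along the quarter turn of `z`. The double sums over pairs of reflections
match those in the defects at the reflected points. -/
theorem IsRadialSolution.angularDefect_ode (hκ : IsPositiveMultiplicity n κ) {y : Plane}
    {f : Plane → ℝ} (hf : IsRadialSolution n κ y f) {z : Plane} (hz : IsRegular n z) :
    fderiv ℝ f z (quarterTurn z) + fderiv ℝ (fderiv ℝ f) z z (quarterTurn z) +
        ∑ k, mult n κ k * (angularCoeff n k z *
          (fderiv ℝ f z z - fderiv ℝ f (act (.sr k) z) (act (.sr k) z))) -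
        (inner ℝ (quarterTurn z) y * f z + inner ℝ (quarterTurn z) y * fderiv ℝ f z z) =
      inner ℝ z y * angularDefect n κ y f z -
        ∑ k, mult n κ k * (angularDefect n κ y f z + angularDefect n κ y f (act (.sr k) z)) := by
  set K := ∑ k, mult n κ k with hK
  have hsym : fderiv ℝ (fderiv ℝ f) z z (quarterTurn z) =
      fderiv ℝ (fderiv ℝ f) z (quarterTurn z) z :=
    (hf.smooth.contDiffAt.isSymmSndFDerivAt (by
      simpa using WithTop.coe_le_coe.2 (le_top (a := (2 : ℕ∞))))) z (quarterTurn z)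
  have hang := hf.fderiv_radial z (quarterTurn z)
  have hrad : ∀ x, fderiv ℝ f x x =
      inner ℝ x y * f x - K * f x + ∑ k, mult n κ k * f (act (.sr k) x) := by
    intro x
    have := hf.radial x
    simp only [mul_sub, sum_sub_distrib, ← sum_mul] at this
    linarith
  have hA : ∑ k, mult n κ k * (angularCoeff n k z *
      (fderiv ℝ f z z - fderiv ℝ f (act (.sr k) z) (act (.sr k) z))) =
      (inner ℝ z y - K) * ∑ k, mult n κ k * (angularCoeff n k z * (f z - f (act (.sr k) z))) +
      ∑ k, mult n κ k * ((inner ℝ (quarterTurn z) y +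
        inner ℝ (quarterTurn (act (.sr k) z)) y) * f (act (.sr k) z)) +
      ∑ k, mult n κ k * (angularCoeff n k z *
        ∑ i, mult n κ i * (f (act (.sr i) z) - f (act (.sr i) (act (.sr k) z)))) := by
    rw [mul_sum, ← sum_add_distrib, ← sum_add_distrib]
    refine sum_congr rfl fun k _ => ?_
    rw [← angularCoeff_mul hz k y, hrad z, hrad (act (.sr k) z)]
    simp only [mul_sub, sum_sub_distrib, inner_sub_left]
    ring
  have hB : ∑ k, mult n κ k * (angularCoeff n k z *
        ∑ i, mult n κ i * (f (act (.sr i) z) - f (act (.sr i) (act (.sr k) z)))) =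
      ∑ i, mult n κ i * ∑ k, mult n κ k * (angularCoeff n k z *
        (f (act (.sr i) z) - f (act (.sr i) (act (.sr k) z)))) := by
    simp only [mul_sum]
    rw [sum_comm]
    exact sum_congr rfl fun i _ => sum_congr rfl fun k _ => by ring
  have hC : ∑ k, mult n κ k * (angularDefect n κ y f z + angularDefect n κ y f (act (.sr k) z)) =
      K * angularDefect n κ y f z +
      (∑ k, mult n κ k * fderiv ℝ f (act (.sr k) z) (quarterTurn (act (.sr k) z)) -
      ∑ i, mult n κ i * ∑ k, mult n κ k * (angularCoeff n k z *
        (f (act (.sr i) z) - f (act (.sr i) (act (.sr k) z)))) -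
      ∑ k, mult n κ k * (inner ℝ (quarterTurn (act (.sr k) z)) y * f (act (.sr k) z))) := by
    rw [hK, sum_mul, ← sum_sub_distrib, ← sum_sub_distrib, ← sum_add_distrib]
    refine sum_congr rfl fun k _ => ?_
    rw [angularDefect_act_sr hκ]; ring
  have hD : ∑ k, mult n κ k * (fderiv ℝ f z (quarterTurn z) -
      fderiv ℝ f (act (.sr k) z) (act (.sr k) (quarterTurn z))) =
      K * fderiv ℝ f z (quarterTurn z) +
        ∑ k, mult n κ k * fderiv ℝ f (act (.sr k) z) (quarterTurn (act (.sr k) z)) := by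
    rw [hK, sum_mul, ← sum_add_distrib]
    refine sum_congr rfl fun k _ => ?_
    rw [quarterTurn_act_sr, map_neg]; ring
  have hE : ∑ k, mult n κ k * ((inner ℝ (quarterTurn z) y +
        inner ℝ (quarterTurn (act (.sr k) z)) y) * f (act (.sr k) z)) =
      inner ℝ (quarterTurn z) y * ∑ k, mult n κ k * f (act (.sr k) z) +
      ∑ k, mult n κ k * (inner ℝ (quarterTurn (act (.sr k) z)) y * f (act (.sr k) z)) := by
    rw [mul_sum, ← sum_add_distrib]
    exact sum_congr rfl fun k _ => by ring
  rw [hC, hA, hE, hsym, hrad z, hB, angularDefect]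
  rw [hD] at hang
  linear_combination hang

/-- In `angularDefect_ode` the reflected defects are added rather than subtracted. Multiplying by
the sign character restores the cooperative form, and the defect vanishes at the origin. -/
theorem IsRadialSolution.angularDefect_eq_zero (hκ : IsPositiveMultiplicity n κ) {y : Plane}
    {f : Plane → ℝ} (hf : IsRadialSolution n κ y f) {x : Plane} (hx : IsRegular n x) :
    angularDefect n κ y f x = 0 := by
  have key := eq_zero_of_cooperative (W := DihedralGroup n) (mult n κ)
    (fun k => (mult_pos hκ k).le) (fun k w => .sr k * w) (fun w => -inner ℝ (act w x) y)
    (fun w t => weylSign w * angularDefect n κ y f (t • act w x)) _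
    (fun w => continuousOn_const.mul fun t _ =>
      (hf.hasDerivAt_angularDefect _ t).continuousAt.continuousWithinAt)
    (fun w t _ => (hf.hasDerivAt_angularDefect _ t).const_mul _)
    (fun w => by simp [angularDefect])
    (fun w t ht => by
      have hreg : IsRegular n (t • DihedralDunkl.act w x) := (IsRegular.act hx w).smul ht.1.ne'
      have h := hf.angularDefect_ode hκ hreg
      simp only [angularCoeff_smul _ _ ht.1.ne', act_smul, map_smul, smul_apply, smul_eq_mul, inner_smul_left,
        RCLike.conj_to_real] at h
      have e₃ : ∑ k : ZMod n, mult n κ k * (weylSign w * angularDefect n κ y f (t • act w x) -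
          weylSign (.sr k * w) * angularDefect n κ y f (t • act (.sr k * w) x)) =
          weylSign w * ∑ k, mult n κ k * (angularDefect n κ y f (t • act w x) +
            angularDefect n κ y f (t • act (.sr k) (act w x))) := by
        rw [mul_sum]
        refine sum_congr rfl fun k _ => ?_
        rw [weylSign_sr_mul, act_mul]; ring
      rw [e₃]
      have e₄ : ∑ k, mult n κ k * (angularCoeff n k (act w x) *
          (t * fderiv ℝ f (t • act w x) (act w x) -
          t * fderiv ℝ f (t • act (.sr k) (act w x)) (act (.sr k) (act w x)))) =
          t * ∑ k, mult n κ k * (angularCoeff n k (act w x) *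
          (fderiv ℝ f (t • act w x) (act w x) -
          fderiv ℝ f (t • act (.sr k) (act w x)) (act (.sr k) (act w x)))) := by
        rw [mul_sum]
        exact sum_congr rfl fun k _ => by ring
      rw [e₄] at h
      linear_combination weylSign w * h)
  have h1 := key 1
  have h2 : weylSign (1 : DihedralGroup n) = 1 := rfl
  simpa [h2] using h1

/-- The Dunkl operator is linear in `ξ`, and at a regular `x` the plane is spanned by `x` and its
quarter turn, so the radial and angular equations suffice. -/
theorem IsRadialSolution.isDunklEigenfunction (hκ : IsPositiveMultiplicity n κ) {y : Plane}
    {f : Plane → ℝ} (hf : IsRadialSolution n κ y f) : IsDunklEigenfunction n κ y f := by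
  refine ⟨hf.smooth, fun ξ x hx => ?_, hf.map_zero⟩
  have hreg : IsRegular n x := (forall_posRoot_iff x).1 hx
  have hrad : dunklOp n κ x f x = inner ℝ x y * f x := by
    rw [← hf.radial x, dunklOp_eq]
    congr 1
    refine sum_congr rfl fun k _ => ?_
    have := hreg k
    field_simp
  have hang : dunklOp n κ (quarterTurn x) f x = inner ℝ (quarterTurn x) y * f x := by
    have h := hf.angularDefect_eq_zero hκ hreg
    rw [angularDefect, sub_eq_zero] at h
    rw [← h, dunklOp_eq]
    congr 1
    refine sum_congr rfl fun k _ => ?_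
    rw [angularCoeff]; ring
  have hlin : ∀ (a b : ℝ) (u v : Plane), dunklOp n κ (a • u + b • v) f x =
      a * dunklOp n κ u f x + b * dunklOp n κ v f x := by
    intro a b u v
    simp only [dunklOp_eq, map_add, map_smul, inner_add_right, inner_smul_right, smul_eq_mul,
      mul_add, mul_sum]
    rw [add_add_add_comm, ← sum_add_distrib]
    congr 1
    exact sum_congr rfl fun k _ => by ring
  have hx2 : x 0 ^ 2 + x 1 ^ 2 ≠ 0 := by
    intro h
    have h0 : x 0 = 0 := by nlinarith [sq_nonneg (x 0), sq_nonneg (x 1)]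
    have h1 : x 1 = 0 := by nlinarith [sq_nonneg (x 0), sq_nonneg (x 1)]
    exact hreg 0 (by rw [inner_eq, h0, h1]; simp)
  have hξ : ξ = ((ξ 0 * x 0 + ξ 1 * x 1) / (x 0 ^ 2 + x 1 ^ 2)) • x +
      ((ξ 1 * x 0 - ξ 0 * x 1) / (x 0 ^ 2 + x 1 ^ 2)) • quarterTurn x := by
    apply plane_ext <;> simp <;> field_simp <;> ring
  rw [hξ, hlin, hrad, hang, inner_add_left, inner_smul_left, inner_smul_left]
  simp only [RCLike.conj_to_real]
  ring

theorem existsUnique_isDunklEigenfunction (hκ : IsPositiveMultiplicity n κ) (y : Plane) :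
    ∃! f, IsDunklEigenfunction n κ y f := by
  obtain ⟨f, hf⟩ := exists_isRadialSolution hκ y
  exact ⟨f, hf.isDunklEigenfunction hκ, fun g hg => hg.unique hκ (hf.isDunklEigenfunction hκ)⟩

theorem isRadialSolution_dunklKernel (hκ : IsPositiveMultiplicity n κ) (y : Plane) :
    IsRadialSolution n κ y (fun x => dunklKernel n κ x y) := by
  obtain ⟨f, hf⟩ := exists_isRadialSolution hκ y
  have h1 : IsDunklEigenfunction n κ y (Classical.epsilon (IsDunklEigenfunction n κ y)) :=
    Classical.epsilon_spec ⟨f, hf.isDunklEigenfunction hκ⟩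
  have h2 := h1.unique hκ (hf.isDunklEigenfunction hκ)
  have h3 : (fun x => dunklKernel n κ x y) = f := h2
  rwa [h3]

/-- By invariance of `κ` under conjugation, both sides are radial solutions in `x` for the parameter
`act (.sr i) y`; uniqueness identifies them. -/
theorem dunklKernel_act_sr (hκ : IsPositiveMultiplicity n κ) (i : ZMod n) (x y : Plane) :
    dunklKernel n κ (act (.sr i) x) y = dunklKernel n κ x (act (.sr i) y) := by
  have hf := isRadialSolution_dunklKernel hκ y
  set f := fun x => dunklKernel n κ x y with hfdef
  have h : IsRadialSolution n κ (act (.sr i) y) (fun x => f (actL (.sr i) x)) := by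
    refine ⟨hf.smooth.comp (actL (.sr i)).contDiff, fun x => ?_, ?_⟩
    · have hd : fderiv ℝ (fun x => f (actL (.sr i) x)) x x =
          fderiv ℝ f (act (.sr i) x) (act (.sr i) x) := by
        have := ((hf.differentiable (actL (.sr i) x)).hasFDerivAt.comp x
          (actL (.sr i)).hasFDerivAt).fderiv
        change fderiv ℝ (f ∘ actL (.sr i)) x x = _
        rw [this]; rfl
      have hr := hf.radial (act (.sr i) x)
      rw [hd, ← inner_act_sr_left, actL_apply, ← hr, ← sum_conj hκ i]
      congr 1
      refine sum_congr rfl fun k _ => ?_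
      have : (.sr i : DihedralGroup n) * .sr (2 * i - k) = .sr k * .sr i := by
        simp only [DihedralGroup.sr_mul_sr]; congr 1; ring
      rw [actL_apply, ← act_mul, ← act_mul, this]
    · simpa using hf.map_zero
  exact congrFun (h.unique hκ (isRadialSolution_dunklKernel hκ _)) x

end

end DihedralDunkl

/-! ### Polynomial inequalities for the residuals of the barriers. -/

namespace DihedralDunkl

section

open Set Finset

section Algebra

variable {k0 k1 p K u0 u1 u : ℝ}

/-- Here `u0 = c/(c+tA0)` and similarly `u1`, `u`, so that `t u0' = -u0(1-u0)` and `tA0 u0 =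
c(1-u0)`; `p` is the total multiplicity of the other reflections. Every possibly negative term is
bounded by a multiple of `1 - u0`, which the decay term `2c(1-u0)` absorbs for large `c`. -/
theorem residual_simple_nonneg {c : ℝ} (h0 : 0 ≤ k0) (h1 : 0 ≤ k1) (hp : 0 ≤ p)
    (hK : K = k0 + k1 + p) (hu : 0 < u) (hu0 : u ≤ u0) (hu01 : u0 ≤ 1) (hu11 : u1 ≤ 1)
    (hc : 1 + 2 * K ≤ 2 * c) :
    0 ≤ -(u0 * (1 - u0)) + u0 * (k0 * u0 + k1 * u1 + p * u) + 2 * c * (1 - u0) -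
      (k0 + k1 * (u0 * u1) + p * ((u0 + u1) / 2 * u)) := by
  have e1 : 0 ≤ p * u * (1 - u0 + (u0 - u1)) :=
    mul_nonneg (mul_nonneg hp hu.le) (by linarith)
  have e2 : p * u * (1 - u0) ≤ p * 1 * (1 - u0) := by
    have : 0 ≤ 1 - u0 := by linarith
    have : u ≤ 1 := hu0.trans hu01
    gcongr
  have e3 : 0 ≤ (1 - u0) * (2 * c - u0 - k0 * (1 + u0) - p / 2) := by
    refine mul_nonneg (by linarith) ?_
    nlinarith
  nlinarith

/-- For small `c` the decay term is dominated by `-k0(1-u0²)`. The term `p u (u0-u1)/2` may still be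
positive; the factor `exp(M(u-1))` is there to supply the term in `M`, which compensates it. -/
theorem residual_simple_nonpos {c k M : ℝ} (h0 : k ≤ k0) (hk : 0 < k) (hp : 0 ≤ p)
    (hu : 0 < u) (hu0 : u ≤ u0) (hu1 : u ≤ u1) (hu01 : u0 ≤ 1)
    (hc : 2 * c ≤ k / 2) (hM : p / 2 ≤ M) :
    -(u0 * (1 - u0)) + u0 * (k0 * u0 + k1 * u1 + p * u) + 2 * c * (1 - u0) -
      (k0 + k1 * (u0 * u1) + p * ((u0 + u1) / 2 * u)) - M * (u * (1 - u)) * u0 ≤ 0 := by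
  have e1 : p / 2 * u * (u0 - u1) ≤ p / 2 * u * (u0 * (1 - u)) := by
    refine mul_le_mul_of_nonneg_left ?_ (by positivity)
    nlinarith
  have e2 : p / 2 * (u * (u0 * (1 - u))) ≤ M * (u * (u0 * (1 - u))) :=
    mul_le_mul_of_nonneg_right hM
      (mul_nonneg hu.le (mul_nonneg (hu.le.trans hu0) (by linarith)))
  have e3 : (1 - u0) * (2 * c - u0 - k0 * (1 + u0)) ≤ 0 := by
    refine mul_nonpos_of_nonneg_of_nonpos (by linarith) ?_
    nlinarith
  nlinarith

/-- All negative terms are controlled by `(1-u0)u1 + (1-u1)u0`, which up to `c` is `t(A0+A1)u0u1`.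
This is why the profile `u0 u1` fits a rate comparable to `A0 + A1`. -/
theorem residual_slow_rotation_nonneg {μ τ : ℝ} (h0 : 0 ≤ k0) (h1 : 0 ≤ k1) (hp : 0 ≤ p)
    (hK : K = k0 + k1 + p) (hu : 0 < u) (hu0 : u ≤ u0) (hu1 : u ≤ u1) (hu01 : u0 ≤ 1)
    (hu11 : u1 ≤ 1) (hμ : 1 + 2 * K ≤ μ)
    (hτ : μ * ((1 - u0) * u1 + (1 - u1) * u0) ≤ τ) :
    0 ≤ -(u0 * (1 - u0)) * u1 + u0 * -(u1 * (1 - u1)) +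
      u0 * u1 * (k0 * u0 + k1 * u1 + p * u) + τ - (k1 * u0 + k0 * u1 + p * u) := by
  have a0 : 0 ≤ (1 - u0) * u1 := mul_nonneg (by linarith) (by linarith)
  have a1 : 0 ≤ (1 - u1) * u0 := mul_nonneg (by linarith) (by linarith)
  have e0 : k0 * (((1 - u0) * u1) * (1 + u0)) ≤ k0 * (((1 - u0) * u1) * 2) := by
    gcongr; linarith
  have e1 : k1 * (((1 - u1) * u0) * (1 + u1)) ≤ k1 * (((1 - u1) * u0) * 2) := by
    gcongr; linarith
  have e2 : p * (u * (1 - u0 * u1)) ≤ p * ((1 - u0) * u1 + (1 - u1) * u0) := by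
    refine mul_le_mul_of_nonneg_left ?_ hp
    have b0 : u * (1 - u0) ≤ u1 * (1 - u0) := by
      refine mul_le_mul_of_nonneg_right hu1 (by linarith)
    have b1 : u * ((1 - u1) * u0) ≤ 1 * ((1 - u1) * u0) :=
      mul_le_mul_of_nonneg_right (by linarith) a1
    nlinarith
  have e3 : ((1 - u0) * u1) * u0 ≤ ((1 - u0) * u1) * 1 := mul_le_mul_of_nonneg_left hu01 a0
  have e4 : ((1 - u1) * u0) * u1 ≤ ((1 - u1) * u0) * 1 := mul_le_mul_of_nonneg_left hu11 a1
  have e5 : (1 + 2 * K) * ((1 - u0) * u1 + (1 - u1) * u0) ≤ τ :=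
    (mul_le_mul_of_nonneg_right hμ (add_nonneg a0 a1)).trans hτ
  have e6 : 0 ≤ k0 * ((1 - u1) * u0) := mul_nonneg h0 a1
  have e7 : 0 ≤ k1 * ((1 - u0) * u1) := mul_nonneg h1 a0
  have e8 : 0 ≤ p * ((1 - u0) * u1 + (1 - u1) * u0) := mul_nonneg hp (add_nonneg a0 a1)
  subst hK
  nlinarith

theorem residual_slow_rotation_nonpos {ν τ k M : ℝ} (hk : 0 ≤ k) (h0 : k ≤ k0) (h1 : k ≤ k1)
    (hp : 0 ≤ p) (hM : 0 ≤ M)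
    (hu : 0 < u) (hu0 : u ≤ u0) (hu1 : u ≤ u1) (hu01 : u0 ≤ 1) (hu11 : u1 ≤ 1) (hν : ν ≤ k)
    (hτ : τ ≤ ν * ((1 - u0) * u1 + (1 - u1) * u0)) :
    -(u0 * (1 - u0)) * u1 + u0 * -(u1 * (1 - u1)) +
      u0 * u1 * (k0 * u0 + k1 * u1 + p * u) + τ - (k1 * u0 + k0 * u1 + p * u) -
      M * (u * (1 - u)) * (u0 * u1) ≤ 0 := by
  have p0 : 0 < u0 := hu.trans_le hu0
  have p1 : 0 < u1 := hu.trans_le hu1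
  have a0 : 0 ≤ (1 - u0) * u1 := mul_nonneg (by linarith) p1.le
  have a1 : 0 ≤ (1 - u1) * u0 := mul_nonneg (by linarith) p0.le
  have e0 : k * ((1 - u0) * u1) ≤ k0 * ((1 - u0) * u1 * (1 + u0)) := by
    have : (1 - u0) * u1 ≤ (1 - u0) * u1 * (1 + u0) := by nlinarith
    exact mul_le_mul h0 this a0 (hk.trans h0)
  have e1 : k * ((1 - u1) * u0) ≤ k1 * ((1 - u1) * u0 * (1 + u1)) := by
    have : (1 - u1) * u0 ≤ (1 - u1) * u0 * (1 + u1) := by nlinarith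
    exact mul_le_mul h1 this a1 (hk.trans h1)
  have e2 : 0 ≤ p * u * (1 - u0 * u1) :=
    mul_nonneg (mul_nonneg hp hu.le) (by nlinarith)
  have e3 : 0 ≤ M * (u * (1 - u)) * (u0 * u1) :=
    mul_nonneg (mul_nonneg hM (mul_nonneg hu.le (by linarith))) (by positivity)
  have e5 : τ ≤ k * ((1 - u0) * u1 + (1 - u1) * u0) :=
    hτ.trans (mul_le_mul_of_nonneg_right hν (add_nonneg a0 a1))
  have e6 : 0 ≤ ((1 - u0) * u1) * u0 := mul_nonneg a0 p0.le
  have e7 : 0 ≤ ((1 - u1) * u0) * u1 := mul_nonneg a1 p1.le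
  nlinarith

theorem residual_fast_reflection_nonneg {μ τ a b : ℝ} (h0 : 0 ≤ k0) (h1 : 0 ≤ k1) (hp : 0 ≤ p)
    (hK : K = k0 + k1 + p) (hb : 0 ≤ b) (hab : a + b ≤ K)
    (hu : 0 < u) (hu0 : u ≤ u0) (hu1 : u ≤ u1) (hu01 : u0 ≤ 1) (hu11 : u1 ≤ 1)
    (hμ : 2 + 3 * K ≤ μ) (hτ : μ * (1 - u) ≤ τ) :
    0 ≤ -(u * (1 - u)) + u * (k0 * u0 + k1 * u1 + p * u) + τ -
      (K * ((u0 + u1) / 2 * u) + a * (1 - (u0 + u1) / 2 * u) +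
        b * (u0 * u1 - (u0 + u1) / 2 * u)) := by
  have hU : (u0 + u1) / 2 * u ≤ 1 := by nlinarith
  have e1 : (K - a - b) * ((u0 + u1) / 2 * u) ≤ (K - a - b) * 1 :=
    mul_le_mul_of_nonneg_left hU (by linarith)
  have e2 : b * (u0 * u1) ≤ b * 1 := mul_le_mul_of_nonneg_left (by nlinarith) hb
  have e3 : K * u ≤ k0 * u0 + k1 * u1 + p * u := by
    subst hK
    nlinarith [mul_le_mul_of_nonneg_left hu0 h0, mul_le_mul_of_nonneg_left hu1 h1]
  have e4 := mul_le_mul_of_nonneg_left e3 hu.le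
  have e5 : (2 + 3 * K) * (1 - u) ≤ τ :=
    (mul_le_mul_of_nonneg_right hμ (by linarith)).trans hτ
  have e6 : 0 ≤ (1 - u) * (2 + 3 * K - u - K * (1 + u)) := by
    refine mul_nonneg (by linarith) ?_
    have : 0 ≤ K := by linarith
    nlinarith
  nlinarith

theorem residual_fast_reflection_nonpos {ν τ a b k M : ℝ} (h0 : 0 ≤ k0) (h1 : 0 ≤ k1) (hp : 0 ≤ p)
    (hK : K = k0 + k1 + p) (hk : 0 < k) (ha : k ≤ a) (hb : 0 ≤ b) (hab : a + b ≤ K)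
    (hu : 0 < u) (hu0 : u ≤ u0) (hu1 : u ≤ u1) (hu01 : u0 ≤ 1) (hu11 : u1 ≤ 1)
    (hν : ν ≤ k / 2) (hM : K ^ 2 / (2 * k) ≤ M) (hτ : τ ≤ ν * (1 - u)) :
    -(u * (1 - u)) + u * (k0 * u0 + k1 * u1 + p * u) + τ -
      (K * ((u0 + u1) / 2 * u) + a * (1 - (u0 + u1) / 2 * u) +
        b * (u0 * u1 - (u0 + u1) / 2 * u)) - M * (u * (1 - u)) * u ≤ 0 := by
  have hU : u * u ≤ (u0 + u1) / 2 * u := mul_le_mul_of_nonneg_right (by linarith) hu.le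
  have e1 : (K - a - b) * (u * u) ≤ (K - a - b) * ((u0 + u1) / 2 * u) :=
    mul_le_mul_of_nonneg_left hU (by linarith)
  have e2 : b * (u * u) ≤ b * (u0 * u1) :=
    mul_le_mul_of_nonneg_left (mul_le_mul hu0 hu1 hu.le (hu.le.trans hu0)) hb
  have e3 : k0 * u0 + k1 * u1 + p * u ≤ K := by
    subst hK
    nlinarith [mul_le_mul_of_nonneg_left hu01 h0, mul_le_mul_of_nonneg_left hu11 h1,
      mul_le_mul_of_nonneg_left (hu0.trans hu01) hp]
  have e4 := mul_le_mul_of_nonneg_left e3 hu.le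
  have hu1' : 0 ≤ 1 - u := by linarith
  have e5 : τ ≤ k / 2 * (1 - u) := hτ.trans (mul_le_mul_of_nonneg_right hν hu1')
  have hM' : K ^ 2 ≤ M * (2 * k) := (div_le_iff₀ (by positivity)).1 hM
  -- Nonpositive discriminant: `K² ≤ 2kM`. This is the origin of the bound `K² / (2k)` on `M`.
  have e6 : 0 ≤ k / 2 - K * u + M * u ^ 2 := by
    have : 0 ≤ (2 * k) * (k / 2 - K * u + M * u ^ 2) := by
      nlinarith [sq_nonneg (k - K * u), mul_le_mul_of_nonneg_right hM' (sq_nonneg u)]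
    exact nonneg_of_mul_nonneg_right this (by positivity)
  have e7 : 0 ≤ (1 - u) * (a - k / 2 - (K - a) * u + M * u ^ 2 + u) := by
    refine mul_nonneg hu1' ?_
    nlinarith
  nlinarith

/-- The coefficients `a`, `b` are the multiplicities of the reflections leading from this rotation
to the two simple ones. All negative terms are bounded by multiples of `(1-u)(u0+u1)/2`, the shape
of the decay term for a rate comparable to `R`. -/
theorem residual_fast_rotation_nonneg {μ τ a b : ℝ} (h0 : 0 ≤ k0) (h1 : 0 ≤ k1) (hp : 0 ≤ p)
    (hK : K = k0 + k1 + p) (ha : 0 ≤ a) (hb : 0 ≤ b) (hab : a + b ≤ K)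
    (hu : 0 < u) (hu0 : u ≤ u0) (hu1 : u ≤ u1) (hu01 : u0 ≤ 1) (hu11 : u1 ≤ 1)
    (hμ : 2 + 3 * K ≤ μ) (hτ : μ * ((1 - u) * ((u0 + u1) / 2)) ≤ τ) :
    0 ≤ (-(u0 * (1 - u0)) + -(u1 * (1 - u1))) / 2 * u + (u0 + u1) / 2 * -(u * (1 - u)) +
      (u0 + u1) / 2 * u * (k0 * u0 + k1 * u1 + p * u) + τ -
      (K * u + a * (u0 - u) + b * (u1 - u)) := by
  set U := (u0 + u1) / 2 with hU
  have hUu : u ≤ U := by rw [hU]; linarith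
  have hU1 : U ≤ 1 := by rw [hU]; linarith
  have hu' : u ≤ 1 := by linarith
  have m0 : u0 ≤ U * (2 - u) := by rw [hU]; nlinarith
  have m1 : u1 ≤ U * (2 - u) := by rw [hU]; nlinarith
  have m2 : u ≤ U * (2 - u) := by nlinarith
  have e1 : K * u + a * (u0 - u) + b * (u1 - u) ≤ K * (U * (2 - u)) := by
    nlinarith [mul_le_mul_of_nonneg_left m0 ha, mul_le_mul_of_nonneg_left m1 hb,
      mul_le_mul_of_nonneg_left m2 (by linarith : (0 : ℝ) ≤ K - a - b)]
  have e3 : K * u ≤ k0 * u0 + k1 * u1 + p * u := by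
    subst hK
    nlinarith [mul_le_mul_of_nonneg_left hu0 h0, mul_le_mul_of_nonneg_left hu1 h1]
  have hUu0 : 0 ≤ U * u := mul_nonneg (by linarith) hu.le
  have e4 := mul_le_mul_of_nonneg_left e3 hUu0
  have hV : 0 ≤ (1 - u) * U := mul_nonneg (by linarith) (by linarith)
  have e5 : (2 + 3 * K) * ((1 - u) * U) ≤ τ := (mul_le_mul_of_nonneg_right hμ hV).trans hτ
  have e6 : (u0 * (1 - u0) + u1 * (1 - u1)) / 2 * u ≤ (1 - u) * U := by
    have : u0 * (1 - u0) + u1 * (1 - u1) ≤ 2 * ((1 - u) * U) := by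
      rw [hU]; nlinarith
    nlinarith
  have e7 : U * (u * (1 - u)) ≤ (1 - u) * U := by nlinarith
  have e8 : 0 ≤ K * (U * (1 - u) ^ 2) := by
    have : 0 ≤ K := by linarith
    have : 0 ≤ U := by linarith
    positivity
  nlinarith

theorem residual_fast_rotation_nonpos {ν τ a b k M : ℝ} (h0 : 0 ≤ k0) (h1 : 0 ≤ k1) (hp : 0 ≤ p)
    (hK : K = k0 + k1 + p) (hk : 0 < k) (ha : k ≤ a) (hb : k ≤ b) (hab : a + b ≤ K) (hM : 0 ≤ M)
    (hu : 0 < u) (hu0 : u ≤ u0) (hu1 : u ≤ u1) (hu01 : u0 ≤ 1) (hu11 : u1 ≤ 1)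
    (hν : ν ≤ k) (hτ : τ ≤ ν * ((1 - u) * ((u0 + u1) / 2))) :
    (-(u0 * (1 - u0)) + -(u1 * (1 - u1))) / 2 * u + (u0 + u1) / 2 * -(u * (1 - u)) +
      (u0 + u1) / 2 * u * (k0 * u0 + k1 * u1 + p * u) + τ -
      (K * u + a * (u0 - u) + b * (u1 - u)) -
      M * (u * (1 - u)) * ((u0 + u1) / 2 * u) ≤ 0 := by
  set U := (u0 + u1) / 2 with hU
  have hUu : u ≤ U := by rw [hU]; linarith
  have hU1 : U ≤ 1 := by rw [hU]; linarith
  have hu' : u ≤ 1 := by linarith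
  have e1 : 2 * k * U + (K - 2 * k) * (u * U) ≤ K * u + a * (u0 - u) + b * (u1 - u) := by
    have c1 : k * (u0 - u) ≤ a * (u0 - u) := mul_le_mul_of_nonneg_right ha (by linarith)
    have c2 : k * (u1 - u) ≤ b * (u1 - u) := mul_le_mul_of_nonneg_right hb (by linarith)
    have c3 : (K - 2 * k) * (u * U) ≤ (K - 2 * k) * (u * 1) :=
      mul_le_mul_of_nonneg_left (mul_le_mul_of_nonneg_left hU1 hu.le) (by linarith)
    have c4 : u0 + u1 = 2 * U := by rw [hU]; ring
    have c5 : k * (u0 + u1) = k * (2 * U) := by rw [c4]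
    nlinarith
  have e3 : k0 * u0 + k1 * u1 + p * u ≤ K := by
    subst hK
    nlinarith [mul_le_mul_of_nonneg_left hu01 h0, mul_le_mul_of_nonneg_left hu11 h1,
      mul_le_mul_of_nonneg_left (hu0.trans hu01) hp]
  have hUu0 : 0 ≤ U * u := mul_nonneg (by linarith) hu.le
  have e4 := mul_le_mul_of_nonneg_left e3 hUu0
  have hV : 0 ≤ (1 - u) * U := mul_nonneg (by linarith) (by linarith)
  have e5 : τ ≤ k * ((1 - u) * U) := hτ.trans (mul_le_mul_of_nonneg_right hν hV)
  have e6 : 0 ≤ (u0 * (1 - u0) + u1 * (1 - u1)) / 2 * u := by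
    have : 0 ≤ u0 * (1 - u0) := mul_nonneg (by linarith) (by linarith)
    have : 0 ≤ u1 * (1 - u1) := mul_nonneg (by linarith) (by linarith)
    positivity
  have e7 : 0 ≤ U * (u * (1 - u)) := mul_nonneg (by linarith) (mul_nonneg hu.le (by linarith))
  have e8 : 0 ≤ M * (u * (1 - u)) * (U * u) :=
    mul_nonneg (mul_nonneg hM (mul_nonneg hu.le (by linarith))) hUu0
  have e9 : 0 ≤ k * ((1 - u) * U) := mul_nonneg hk.le hV
  nlinarith

end Algebra

end

end DihedralDunkl

/-! ### Explicit barriers and two-sided bounds for the abstract system. -/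

namespace DihedralDunkl

section

open Set Finset

variable {n : ℕ}

/-- The size of the component `w` of the kernel relative to the component at the identity, where
`u0`, `u1` and `u` are the reciprocals of `1 + ⟪α_0, x⟫ ⟪α_0, y⟫`, `1 + ⟪α_{n-1}, x⟫ ⟪α_{n-1}, y⟫`
and `1 + ⟪x, y⟫`, and `r_ρ` is the slow rotation. -/
noncomputable def profile (ρ : ZMod n) (u0 u1 u : ℝ) : DihedralGroup n → ℝ
  | .r k => if k = 0 then 1 else if k = ρ then u0 * u1 else (u0 + u1) / 2 * u
  | .sr k => if k = 0 then u0 else if k = 1 then u1 else u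

/-- The derivative of `profile` in the direction `(v0, v1, v)`. -/
noncomputable def profileDeriv (ρ : ZMod n) (u0 u1 u v0 v1 v : ℝ) : DihedralGroup n → ℝ
  | .r k => if k = 0 then 0 else if k = ρ then v0 * u1 + u0 * v1 else
      (v0 + v1) / 2 * u + (u0 + u1) / 2 * v
  | .sr k => if k = 0 then v0 else if k = 1 then v1 else v

theorem hasDerivAt_profile (ρ : ZMod n) {f0 f1 f : ℝ → ℝ} {v0 v1 v t : ℝ}
    (h0 : HasDerivAt f0 v0 t) (h1 : HasDerivAt f1 v1 t) (h : HasDerivAt f v t)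
    (w : DihedralGroup n) :
    HasDerivAt (fun s => profile ρ (f0 s) (f1 s) (f s) w)
      (profileDeriv ρ (f0 t) (f1 t) (f t) v0 v1 v w) t := by
  rcases w with k | k <;> simp only [profile, profileDeriv] <;> split_ifs
  · exact hasDerivAt_const _ _
  · exact h0.mul h1
  · exact ((h0.add h1).div_const 2).mul h
  · exact h0
  · exact h1
  · exact h

theorem mul_profileDeriv (ρ : ZMod n) (u0 u1 u v0 v1 v t : ℝ) (w : DihedralGroup n) :
    t * profileDeriv ρ u0 u1 u v0 v1 v w =
      profileDeriv ρ u0 u1 u (t * v0) (t * v1) (t * v) w := by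
  rcases w with k | k <;> simp only [profileDeriv] <;> split_ifs <;> ring

/-- `ρ` labels the rotation `r_1` or its inverse. -/
def IsSlowLabel (ρ : ZMod n) : Prop := ρ = 1 ∨ ρ = -1

/-- The decay rates `lam w = ⟪x, y⟫ - ⟪x, w y⟫`, with `A0` and `A1` the products over the two simple
roots and `R = ⟪x, y⟫`. -/
structure RateBounds (ρ : ZMod n) (m m' A0 A1 R : ℝ) (lam : DihedralGroup n → ℝ) : Prop where
  A0_nonneg : 0 ≤ A0
  A1_nonneg : 0 ≤ A1
  A0_le : A0 ≤ R
  A1_le : A1 ≤ R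
  one : lam (.r 0) = 0
  simple_zero : lam (.sr 0) = 2 * A0
  simple_one : lam (.sr 1) = 2 * A1
  slow_le : m * (A0 + A1) ≤ lam (.r ρ)
  le_slow : lam (.r ρ) ≤ m' * (A0 + A1)
  fast_reflection_le : ∀ k, k ≠ 0 → k ≠ 1 → m * R ≤ lam (.sr k)
  le_fast_reflection : ∀ k, k ≠ 0 → k ≠ 1 → lam (.sr k) ≤ m' * R
  fast_rotation_le : ∀ k, k ≠ 0 → k ≠ ρ → m * R ≤ lam (.r k)
  le_fast_rotation : ∀ k, k ≠ 0 → k ≠ ρ → lam (.r k) ≤ m' * R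

/-- A multiplicity on the reflections of the dihedral group. -/
structure IsReflectionWeight (q : ZMod n → ℝ) (k : ℝ) : Prop where
  pos : 0 < k
  le : ∀ i, k ≤ q i
  conj : ∀ i j, q (2 * i - j) = q j

section Sums

variable [NeZero n] {q : ZMod n → ℝ} {k : ℝ}

theorem IsReflectionWeight.neg (hq : IsReflectionWeight q k) (i : ZMod n) : q (-i) = q i := by
  simpa using hq.conj 0 i

theorem IsReflectionWeight.add_le (hq : IsReflectionWeight q k) {i j : ZMod n} (hij : i ≠ j) :
    q i + q j ≤ ∑ l, q l := by
  rw [← sum_pair hij]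
  exact sum_le_sum_of_subset_of_nonneg (subset_univ _) fun l _ _ => hq.pos.le.trans (hq.le l)

theorem sum_mul_ite_ite (q : ZMod n → ℝ) {i j : ZMod n} (hij : i ≠ j) (a b c : ℝ) :
    ∑ l, q l * (if l = i then a else if l = j then b else c) =
      (∑ l, q l) * c + q i * (a - c) + q j * (b - c) := by
  have : ∀ l, q l * (if l = i then a else if l = j then b else c) =
      q l * c + (if l = i then q i * (a - c) else 0) + (if l = j then q j * (b - c) else 0) := by
    intro l
    by_cases h1 : l = i
    · subst h1
      simp [hij]; ring
    · by_cases h2 : l = j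
      · subst h2
        simp [h1]; ring
      · simp [h1, h2]
  simp only [this, sum_add_distrib, sum_ite_eq', Finset.mem_univ, if_true, sum_mul]

theorem sum_profile_rotation (hq : IsReflectionWeight q k) (h01 : (1 : ZMod n) ≠ 0) (ρ j : ZMod n)
    (u0 u1 u : ℝ) :
    ∑ l, q l * profile ρ u0 u1 u (.sr l * .r j) =
      (∑ l, q l) * u + q j * (u0 - u) + q (1 - j) * (u1 - u) := by
  rw [← hq.neg j, ← sum_mul_ite_ite q (i := -j) (j := 1 - j)]
  · refine sum_congr rfl fun l _ => ?_
    simp only [DihedralGroup.sr_mul_r, profile, eq_neg_iff_add_eq_zero, eq_sub_iff_add_eq]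
  · intro h
    exact h01 (by linear_combination -h)

theorem sum_profile_reflection {ρ : ZMod n} (hρ : ρ ≠ 0) (j : ZMod n) (u0 u1 u : ℝ) :
    ∑ l, q l * profile ρ u0 u1 u (.sr l * .sr j) =
      (∑ l, q l) * ((u0 + u1) / 2 * u) + q j * (1 - (u0 + u1) / 2 * u) +
        q (j - ρ) * (u0 * u1 - (u0 + u1) / 2 * u) := by
  rw [← sum_mul_ite_ite q (i := j) (j := j - ρ)]
  · refine sum_congr rfl fun l _ => ?_
    have h1 : j - l = 0 ↔ l = j := by rw [sub_eq_zero, eq_comm]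
    have h2 : j - l = ρ ↔ l = j - ρ := by
      constructor <;> intro h <;> linear_combination -h
    simp only [DihedralGroup.sr_mul_sr, profile, h1, h2]
  · intro h
    exact hρ (by linear_combination h)

/-- The residual of the differential system at the component `w`, for the barrier built from
`profile`, after division by the common factor. -/
noncomputable def residual (q : ZMod n → ℝ) (ρ : ZMod n) (u0 u1 u τ : ℝ) (w : DihedralGroup n) :
    ℝ :=
  profileDeriv ρ u0 u1 u (-(u0 * (1 - u0))) (-(u1 * (1 - u1))) (-(u * (1 - u))) w +
    profile ρ u0 u1 u w * (q 0 * u0 + q 1 * u1 + (∑ l, q l - q 0 - q 1) * u) +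
    τ * profile ρ u0 u1 u w - ∑ l, q l * profile ρ u0 u1 u (.sr l * w)

variable {ρ : ZMod n} {m m' A0 A1 R : ℝ} {lam : DihedralGroup n → ℝ}

theorem IsSlowLabel.ne_zero (hρ : IsSlowLabel ρ) (h01 : (1 : ZMod n) ≠ 0) : ρ ≠ 0 := by
  rcases hρ with rfl | rfl
  · exact h01
  · exact neg_ne_zero.2 h01

/-- Conjugation sends an index to its negative plus an even number, so `q` agrees at `1` and `-1`,
and at `0` and `2`. -/
theorem IsReflectionWeight.slow (hq : IsReflectionWeight q k) (hρ : IsSlowLabel ρ) :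
    q ρ = q 1 ∧ q (1 - ρ) = q 0 ∧ q (-ρ) = q 1 := by
  have h2 : q 2 = q 0 := by simpa using hq.conj 1 0
  rcases hρ with rfl | rfl
  · exact ⟨rfl, by simp, hq.neg 1⟩
  · refine ⟨hq.neg 1, ?_, by simp⟩
    rw [← h2]; congr 1; ring

theorem RateBounds.ratio_bounds (hb : RateBounds ρ m m' A0 A1 R lam) {c t : ℝ} (hc : 0 < c)
    (ht : 0 ≤ t) :
    0 < c / (c + t * R) ∧ c / (c + t * R) ≤ c / (c + t * A0) ∧
      c / (c + t * R) ≤ c / (c + t * A1) ∧ c / (c + t * A0) ≤ 1 ∧ c / (c + t * A1) ≤ 1 := by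
  have h0 := mul_nonneg ht hb.A0_nonneg
  have h1 := mul_nonneg ht hb.A1_nonneg
  have h2 := mul_le_mul_of_nonneg_left hb.A0_le ht
  have h3 := mul_le_mul_of_nonneg_left hb.A1_le ht
  have h4 : 0 < c + t * A0 := by linarith
  have h5 : 0 < c + t * A1 := by linarith
  refine ⟨by apply div_pos <;> linarith, ?_, ?_, ?_, ?_⟩
  · gcongr
  · gcongr
  · rw [div_le_one h4]; linarith
  · rw [div_le_one h5]; linarith

/-- This converts each decay rate into `c(1-u)`, making `c` the free parameter that decides the sign
of the residual. -/
theorem mul_ratio {c s : ℝ} (hc : 0 < c) (hs : 0 ≤ s) :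
    s * (c / (c + s)) = c * (1 - c / (c + s)) := by
  have : c + s ≠ 0 := by linarith
  field_simp; ring

theorem residual_nonneg (hq : IsReflectionWeight q k) (hρ : IsSlowLabel ρ)
    (h01 : (1 : ZMod n) ≠ 0) {c t : ℝ} (hc : 0 < c) (hc1 : 1 + 2 * ∑ l, q l ≤ 2 * c)
    (hc2 : 2 + 3 * ∑ l, q l ≤ m * c) (hb : RateBounds ρ m m' A0 A1 R lam) (ht : 0 ≤ t)
    (w : DihedralGroup n) :
    0 ≤ residual q ρ (c / (c + t * A0)) (c / (c + t * A1)) (c / (c + t * R)) (t * lam w) w := by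
  obtain ⟨hu, hu0, hu1, hu01, hu11⟩ := hb.ratio_bounds hc ht
  have t0 := mul_ratio hc (mul_nonneg ht hb.A0_nonneg)
  have t1 := mul_ratio hc (mul_nonneg ht hb.A1_nonneg)
  have t2 := mul_ratio hc (mul_nonneg ht (hb.A0_nonneg.trans hb.A0_le))
  set u0 := c / (c + t * A0)
  set u1 := c / (c + t * A1)
  set u := c / (c + t * R)
  have hq0 : ∀ i, 0 ≤ q i := fun i => hq.pos.le.trans (hq.le i)
  have hp : 0 ≤ ∑ l, q l - q 0 - q 1 := by linarith [hq.add_le h01.symm]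
  have hK : ∑ l, q l = q 0 + q 1 + (∑ l, q l - q 0 - q 1) := by ring
  have hK0 : 0 ≤ ∑ l, q l := sum_nonneg fun i _ => hq0 i
  have hρ0 := hρ.ne_zero h01
  obtain ⟨hs1, hs2, hs3⟩ := hq.slow hρ
  have p0 : 0 < u0 := hu.trans_le hu0
  have p1 : 0 < u1 := hu.trans_le hu1
  rcases w with j | j
  · simp only [residual, sum_profile_rotation hq h01]
    simp only [profile, profileDeriv]
    split_ifs with h h'
    · subst h
      rw [hb.one, sub_zero]
      linarith
    · subst h'
      rw [hs1, hs2]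
      have := residual_slow_rotation_nonneg (hq0 0) (hq0 1) hp hK hu hu0 hu1 hu01 hu11
        (μ := m * c) (τ := t * lam (.r j) * (u0 * u1)) (by linarith) (by
          have := mul_le_mul_of_nonneg_right (mul_le_mul_of_nonneg_left hb.slow_le ht)
            (mul_nonneg p0.le p1.le)
          linear_combination this - m * u1 * t0 - m * u0 * t1)
      linarith
    · refine (residual_fast_rotation_nonneg (hq0 0) (hq0 1) hp hK (hq0 j) (hq0 (1 - j)) ?_
        hu hu0 hu1 hu01 hu11 hc2 (τ := t * lam (.r j) * ((u0 + u1) / 2 * u)) ?_).trans_eq ?_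
      · rw [← hq.neg j]
        exact hq.add_le fun h => h01 (by linear_combination -h)
      · have := mul_le_mul_of_nonneg_right
          (mul_le_mul_of_nonneg_left (hb.fast_rotation_le j h h') ht)
          (show 0 ≤ (u0 + u1) / 2 * u by positivity)
        linear_combination this - m * (u0 + u1) / 2 * t2
      · ring
  · simp only [residual, sum_profile_reflection hρ0]
    simp only [profile, profileDeriv]
    split_ifs with h h'
    · subst h
      rw [zero_sub, hs3, hb.simple_zero]
      refine (residual_simple_nonneg (hq0 0) (hq0 1) hp hK hu hu0 hu01 hu11 hc1).trans_eq ?_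
      linear_combination -2 * t0
    · subst h'
      rw [hs2, hb.simple_one]
      refine (residual_simple_nonneg (hq0 1) (hq0 0) hp (K := ∑ l, q l) (by ring) hu hu1 hu11 hu01
        hc1).trans_eq ?_
      linear_combination -2 * t1
    · refine (residual_fast_reflection_nonneg (hq0 0) (hq0 1) hp hK (hq0 (j - ρ)) ?_
        hu hu0 hu1 hu01 hu11 hc2 (τ := t * lam (.sr j) * u) (a := q j) ?_).trans_eq ?_
      · exact hq.add_le fun h => hρ0 (by linear_combination h)
      · have := mul_le_mul_of_nonneg_right
          (mul_le_mul_of_nonneg_left (hb.fast_reflection_le j h h') ht) hu.le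
        linear_combination this - m * t2
      · ring

theorem residual_nonpos (hq : IsReflectionWeight q k) (hρ : IsSlowLabel ρ)
    (h01 : (1 : ZMod n) ≠ 0) {c t M : ℝ} (hc : 0 < c) (hc1 : 2 * c ≤ k / 2)
    (hc2 : m' * c ≤ k / 2) (hM : (∑ l, q l) / 2 ≤ M) (hM2 : (∑ l, q l) ^ 2 / (2 * k) ≤ M)
    (hb : RateBounds ρ m m' A0 A1 R lam) (ht : 0 ≤ t)
    (w : DihedralGroup n) :
    residual q ρ (c / (c + t * A0)) (c / (c + t * A1)) (c / (c + t * R)) (t * lam w) w -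
      M * (c / (c + t * R) * (1 - c / (c + t * R))) *
        profile ρ (c / (c + t * A0)) (c / (c + t * A1)) (c / (c + t * R)) w ≤ 0 := by
  obtain ⟨hu, hu0, hu1, hu01, hu11⟩ := hb.ratio_bounds hc ht
  have t0 := mul_ratio hc (mul_nonneg ht hb.A0_nonneg)
  have t1 := mul_ratio hc (mul_nonneg ht hb.A1_nonneg)
  have t2 := mul_ratio hc (mul_nonneg ht (hb.A0_nonneg.trans hb.A0_le))
  set u0 := c / (c + t * A0)
  set u1 := c / (c + t * A1)
  set u := c / (c + t * R)
  have hk := hq.pos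
  have hq0 : ∀ i, 0 ≤ q i := fun i => hq.pos.le.trans (hq.le i)
  have hp : 0 ≤ ∑ l, q l - q 0 - q 1 := by linarith [hq.add_le h01.symm]
  have hK : ∑ l, q l = q 0 + q 1 + (∑ l, q l - q 0 - q 1) := by ring
  have hK0 : 0 ≤ ∑ l, q l := sum_nonneg fun i _ => hq0 i
  have hM0 : 0 ≤ M := le_trans (by positivity) hM
  have hpM : (∑ l, q l - q 0 - q 1) / 2 ≤ M := by linarith [hq0 0, hq0 1]
  have hρ0 := hρ.ne_zero h01
  obtain ⟨hs1, hs2, hs3⟩ := hq.slow hρ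
  have p0 : 0 < u0 := hu.trans_le hu0
  have p1 : 0 < u1 := hu.trans_le hu1
  rcases w with j | j
  · simp only [residual, sum_profile_rotation hq h01]
    simp only [profile, profileDeriv]
    split_ifs with h h'
    · subst h
      rw [hb.one, sub_zero]
      have : 0 ≤ M * (u * (1 - u)) := mul_nonneg hM0 (mul_nonneg hu.le (by linarith))
      linarith
    · subst h'
      rw [hs1, hs2]
      refine le_trans (le_of_eq ?_) (residual_slow_rotation_nonpos hk.le (hq.le 0) (hq.le 1) hp hM0
        hu hu0 hu1 hu01 hu11 (ν := m' * c) (τ := t * lam (.r j) * (u0 * u1)) (by linarith) ?_)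
      · ring
      · have := mul_le_mul_of_nonneg_right (mul_le_mul_of_nonneg_left hb.le_slow ht)
            (mul_nonneg p0.le p1.le)
        linear_combination this + m' * u1 * t0 + m' * u0 * t1
    · refine le_trans (le_of_eq ?_) (residual_fast_rotation_nonpos (hq0 0) (hq0 1) hp hK hk
        (hq.le j) (hq.le (1 - j)) ?_ hM0 hu hu0 hu1 hu01 hu11 (ν := m' * c) (by linarith)
        (τ := t * lam (.r j) * ((u0 + u1) / 2 * u)) ?_)
      · ring
      · rw [← hq.neg j]
        exact hq.add_le fun h => h01 (by linear_combination -h)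
      · have := mul_le_mul_of_nonneg_right
          (mul_le_mul_of_nonneg_left (hb.le_fast_rotation j h h') ht)
          (show 0 ≤ (u0 + u1) / 2 * u by positivity)
        linear_combination this + m' * (u0 + u1) / 2 * t2
  · simp only [residual, sum_profile_reflection hρ0]
    simp only [profile, profileDeriv]
    split_ifs with h h'
    · subst h
      rw [zero_sub, hs3, hb.simple_zero]
      refine le_trans (le_of_eq ?_) (residual_simple_nonpos (k1 := q 1) (hq.le 0) hk hp
        hu hu0 hu1 hu01 hc1 hpM)
      linear_combination 2 * t0
    · subst h'
      rw [hs2, hb.simple_one]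
      refine le_trans (le_of_eq ?_) (residual_simple_nonpos (k1 := q 0) (hq.le 1) hk hp
        hu hu1 hu0 hu11 hc1 hpM)
      linear_combination 2 * t1
    · refine le_trans (le_of_eq ?_) (residual_fast_reflection_nonpos (hq0 0) (hq0 1) hp hK hk
        (hq.le j) (hq0 (j - ρ)) ?_ hu hu0 hu1 hu01 hu11 hc2 hM2 (τ := t * lam (.sr j) * u) ?_)
      · ring
      · exact hq.add_le fun h => hρ0 (by linear_combination h)
      · have := mul_le_mul_of_nonneg_right
          (mul_le_mul_of_nonneg_left (hb.le_fast_reflection j h h') ht) hu.le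
        linear_combination this + m' * t2

/-- The barrier for the differential system. -/
noncomputable def barrier (q : ZMod n → ℝ) (ρ : ZMod n) (M u0 u1 u : ℝ) (w : DihedralGroup n) : ℝ :=
  profile ρ u0 u1 u w * (u0 ^ q 0 * u1 ^ q 1 * u ^ (∑ l, q l - q 0 - q 1) * Real.exp (M * (u - 1)))

/-- The time derivative of the barrier, in terms of its residual. -/
theorem exists_hasDerivAt_barrier (q : ZMod n → ℝ) (ρ : ZMod n) (M : ℝ) {c t : ℝ} (hc : 0 < c)
    (ht : 0 < t) (hb : RateBounds ρ m m' A0 A1 R lam) (w : DihedralGroup n) :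
    ∃ d, HasDerivAt (fun s => barrier q ρ M (c / (c + s * A0)) (c / (c + s * A1))
        (c / (c + s * R)) w) d t ∧
      t * d + t * lam w * barrier q ρ M (c / (c + t * A0)) (c / (c + t * A1)) (c / (c + t * R)) w +
        ∑ l, q l * (barrier q ρ M (c / (c + t * A0)) (c / (c + t * A1)) (c / (c + t * R)) w -
          barrier q ρ M (c / (c + t * A0)) (c / (c + t * A1)) (c / (c + t * R)) (.sr l * w)) =
      (residual q ρ (c / (c + t * A0)) (c / (c + t * A1)) (c / (c + t * R)) (t * lam w) w -
        M * (c / (c + t * R) * (1 - c / (c + t * R))) *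
          profile ρ (c / (c + t * A0)) (c / (c + t * A1)) (c / (c + t * R)) w) *
        ((c / (c + t * A0)) ^ q 0 * (c / (c + t * A1)) ^ q 1 *
          (c / (c + t * R)) ^ (∑ l, q l - q 0 - q 1) *
            Real.exp (M * (c / (c + t * R) - 1))) := by
  -- The logistic form `t u' = -u(1-u)` is what makes the residual a function of `u0`, `u1`, `u` and
  -- `t * lam w` alone.
  have hder : ∀ A : ℝ, 0 ≤ A → HasDerivAt (fun s => c / (c + s * A))
      (-(c / (c + t * A) * (1 - c / (c + t * A))) / t) t := by
    intro A hA
    have h1 : c + t * A ≠ 0 := by positivity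
    have h2 : HasDerivAt (fun s => c + s * A) A t := by
      simpa using ((hasDerivAt_id t).mul_const A).const_add c
    refine ((hasDerivAt_const t c).div h2 h1).congr_deriv ?_
    field_simp; ring
  have hpos : ∀ A : ℝ, 0 ≤ A → 0 < c / (c + t * A) := fun A hA => by positivity
  have hR := hb.A0_nonneg.trans hb.A0_le
  have d0 := hder A0 hb.A0_nonneg
  have d1 := hder A1 hb.A1_nonneg
  have d2 := hder R hR
  have p0 := hpos A0 hb.A0_nonneg
  have p1 := hpos A1 hb.A1_nonneg
  have p2 := hpos R hR
  have hprof := hasDerivAt_profile ρ d0 d1 d2 w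
  have hG := (((d0.rpow_const (p := q 0) (Or.inl p0.ne')).mul
    (d1.rpow_const (p := q 1) (Or.inl p1.ne'))).mul
    (d2.rpow_const (p := ∑ l, q l - q 0 - q 1) (Or.inl p2.ne'))).mul
    (((d2.sub_const 1).const_mul M).exp)
  refine ⟨_, hprof.mul hG, ?_⟩
  simp only [Pi.mul_apply]
  rw [mul_add, ← mul_assoc t (profileDeriv _ _ _ _ _ _ _ _), mul_profileDeriv]
  simp only [mul_div_cancel₀ _ ht.ne']
  simp only [barrier, residual, mul_sub, sum_sub_distrib]
  set u0 := c / (c + t * A0)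
  set u1 := c / (c + t * A1)
  set u := c / (c + t * R)
  rw [Real.rpow_sub_one p0.ne', Real.rpow_sub_one p1.ne', Real.rpow_sub_one p2.ne']
  set K := ∑ l, q l with hK
  set E := Real.exp (M * u - M * 1)
  set G := u0 ^ q 0 * u1 ^ q 1 * u ^ (K - q 0 - q 1) * E with hGdef
  have s1 : ∑ l, q l * (profile ρ u0 u1 u w * G) = K * (profile ρ u0 u1 u w * G) := by
    rw [hK, sum_mul]
  have s2 : ∑ l, q l * (profile ρ u0 u1 u (.sr l * w) * G) =
      (∑ l, q l * profile ρ u0 u1 u (.sr l * w)) * G := by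
    rw [sum_mul]; exact sum_congr rfl fun l _ => by ring
  rw [s1, s2, hGdef]
  field_simp
  ring

theorem continuousOn_barrier (q : ZMod n → ℝ) (ρ : ZMod n) (M : ℝ) {c : ℝ} (hc : 0 < c)
    (hb : RateBounds ρ m m' A0 A1 R lam) (w : DihedralGroup n) :
    ContinuousOn (fun s => barrier q ρ M (c / (c + s * A0)) (c / (c + s * A1))
        (c / (c + s * R)) w) (Icc 0 1) := by
  intro t ht
  have hR := hb.A0_nonneg.trans hb.A0_le
  have hder : ∀ A : ℝ, 0 ≤ A → ∃ d, HasDerivAt (fun s => c / (c + s * A)) d t := by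
    intro A hA
    have ht' := ht.1
    have h1 : c + t * A ≠ 0 := by positivity
    have h2 : HasDerivAt (fun s => c + s * A) A t := by
      simpa using ((hasDerivAt_id t).mul_const A).const_add c
    exact ⟨_, (hasDerivAt_const t c).div h2 h1⟩
  have hpos : ∀ A : ℝ, 0 ≤ A → c / (c + t * A) ≠ 0 := fun A hA => by
    have ht' := ht.1
    positivity
  obtain ⟨_, d0⟩ := hder A0 hb.A0_nonneg
  obtain ⟨_, d1⟩ := hder A1 hb.A1_nonneg
  obtain ⟨_, d2⟩ := hder R hR
  exact ((hasDerivAt_profile ρ d0 d1 d2 w).mul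
    ((((d0.rpow_const (p := q 0) (Or.inl (hpos A0 hb.A0_nonneg))).mul
    (d1.rpow_const (p := q 1) (Or.inl (hpos A1 hb.A1_nonneg)))).mul
    (d2.rpow_const (p := ∑ l, q l - q 0 - q 1) (Or.inl (hpos R hR)))).mul
    (((d2.sub_const 1).const_mul M).exp))).continuousAt.continuousWithinAt

theorem barrier_one (q : ZMod n → ℝ) (ρ : ZMod n) (M : ℝ) (w : DihedralGroup n) :
    barrier q ρ M 1 1 1 w = 1 := by
  rcases w with j | j <;> simp [barrier, profile]

variable {ψ ψ' : DihedralGroup n → ℝ → ℝ}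

/-- Comparison applied to barrier minus solution; no exponential correction is needed for the
supersolution, hence `M = 0`. -/
theorem le_barrier (hq : IsReflectionWeight q k) (hρ : IsSlowLabel ρ)
    (h01 : (1 : ZMod n) ≠ 0) {c : ℝ} (hc : 0 < c) (hc1 : 1 + 2 * ∑ l, q l ≤ 2 * c)
    (hc2 : 2 + 3 * ∑ l, q l ≤ m * c) (hb : RateBounds ρ m m' A0 A1 R lam)
    (hψ : ∀ w t, HasDerivAt (ψ w) (ψ' w t) t) (hψ0 : ∀ w, ψ w 0 = 1)
    (hode : ∀ w t, t * ψ' w t + t * lam w * ψ w t + ∑ l, q l * (ψ w t - ψ (.sr l * w) t) = 0)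
    (w : DihedralGroup n) :
    ψ w 1 ≤ barrier q ρ 0 (c / (c + A0)) (c / (c + A1)) (c / (c + R)) w := by
  have hq0 : ∀ i, 0 ≤ q i := fun i => hq.pos.le.trans (hq.le i)
  set B : DihedralGroup n → ℝ → ℝ := fun w s => barrier q ρ 0 (c / (c + s * A0)) (c / (c + s * A1))
        (c / (c + s * R)) w with hB
  have hder : ∀ w t, ∃ d, t ∈ Ioc (0 : ℝ) 1 → (HasDerivAt (B w) d t ∧
      0 ≤ t * d + t * lam w * B w t + ∑ l, q l * (B w t - B (.sr l * w) t)) := by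
    intro w t
    by_cases ht : t ∈ Ioc (0 : ℝ) 1
    · obtain ⟨d, hd, he⟩ := exists_hasDerivAt_barrier q ρ 0 hc ht.1 hb w
      refine ⟨d, fun _ => ⟨hd, ?_⟩⟩
      simp only [hB]
      rw [he, zero_mul, zero_mul, sub_zero]
      have h1 := residual_nonneg hq hρ h01 hc hc1 hc2 hb ht.1.le w
      obtain ⟨hu, hu0, hu1, -, -⟩ := hb.ratio_bounds hc ht.1.le
      have := hu.trans_le hu0
      have := hu.trans_le hu1
      positivity
    · exact ⟨0, fun h => absurd h ht⟩
  choose B' hB' using hder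
  have key := nonneg_of_cooperative q hq0 (fun l w => .sr l * w) lam (fun w t => B w t - ψ w t)
    (fun w t => B' w t - ψ' w t)
    (fun w => (continuousOn_barrier q ρ 0 hc hb w).sub
      fun t _ => (hψ w t).continuousAt.continuousWithinAt)
    (fun w t ht => (hB' w t ht).1.sub (hψ w t))
    (fun w => by
      have : c / c = 1 := div_self hc.ne'
      simp [hB, hψ0, this, barrier_one])
    (fun w t ht => by
      have h1 := (hB' w t ht).2
      have h2 := hode w t
      have h3 : ∑ l, q l * (B w t - ψ w t - (B (.sr l * w) t - ψ (.sr l * w) t)) =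
          ∑ l, q l * (B w t - B (.sr l * w) t) - ∑ l, q l * (ψ w t - ψ (.sr l * w) t) := by
        rw [← sum_sub_distrib]; exact sum_congr rfl fun l _ => by ring
      rw [h3]
      linarith) w 1 (by simp)
  simpa [hB] using key

theorem barrier_le (hq : IsReflectionWeight q k) (hρ : IsSlowLabel ρ)
    (h01 : (1 : ZMod n) ≠ 0) {c M : ℝ} (hc : 0 < c) (hc1 : 2 * c ≤ k / 2)
    (hc2 : m' * c ≤ k / 2) (hM : (∑ l, q l) / 2 ≤ M) (hM2 : (∑ l, q l) ^ 2 / (2 * k) ≤ M)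
    (hb : RateBounds ρ m m' A0 A1 R lam)
    (hψ : ∀ w t, HasDerivAt (ψ w) (ψ' w t) t) (hψ0 : ∀ w, ψ w 0 = 1)
    (hode : ∀ w t, t * ψ' w t + t * lam w * ψ w t + ∑ l, q l * (ψ w t - ψ (.sr l * w) t) = 0)
    (w : DihedralGroup n) :
    barrier q ρ M (c / (c + A0)) (c / (c + A1)) (c / (c + R)) w ≤ ψ w 1 := by
  have hq0 : ∀ i, 0 ≤ q i := fun i => hq.pos.le.trans (hq.le i)
  set B : DihedralGroup n → ℝ → ℝ := fun w s => barrier q ρ M (c / (c + s * A0)) (c / (c + s * A1))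
        (c / (c + s * R)) w with hB
  have hder : ∀ w t, ∃ d, t ∈ Ioc (0 : ℝ) 1 → (HasDerivAt (B w) d t ∧
      t * d + t * lam w * B w t + ∑ l, q l * (B w t - B (.sr l * w) t) ≤ 0) := by
    intro w t
    by_cases ht : t ∈ Ioc (0 : ℝ) 1
    · obtain ⟨d, hd, he⟩ := exists_hasDerivAt_barrier q ρ M hc ht.1 hb w
      refine ⟨d, fun _ => ⟨hd, ?_⟩⟩
      simp only [hB]
      rw [he]
      have h1 := residual_nonpos hq hρ h01 hc hc1 hc2 hM hM2 hb ht.1.le w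
      obtain ⟨hu, hu0, hu1, -, -⟩ := hb.ratio_bounds hc ht.1.le
      have := hu.trans_le hu0
      have := hu.trans_le hu1
      exact mul_nonpos_of_nonpos_of_nonneg h1 (by positivity)
    · exact ⟨0, fun h => absurd h ht⟩
  choose B' hB' using hder
  have key := nonneg_of_cooperative q hq0 (fun l w => .sr l * w) lam (fun w t => ψ w t - B w t)
    (fun w t => ψ' w t - B' w t)
    (fun w => ContinuousOn.sub (fun t _ => (hψ w t).continuousAt.continuousWithinAt)
      (continuousOn_barrier q ρ M hc hb w))
    (fun w t ht => (hψ w t).sub (hB' w t ht).1)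
    (fun w => by
      have : c / c = 1 := div_self hc.ne'
      simp [hB, hψ0, this, barrier_one])
    (fun w t ht => by
      have h1 := (hB' w t ht).2
      have h2 := hode w t
      have h3 : ∑ l, q l * (ψ w t - B w t - (ψ (.sr l * w) t - B (.sr l * w) t)) =
          ∑ l, q l * (ψ w t - ψ (.sr l * w) t) - ∑ l, q l * (B w t - B (.sr l * w) t) := by
        rw [← sum_sub_distrib]; exact sum_congr rfl fun l _ => by ring
      rw [h3]
      linarith) w 1 (by simp)
  simpa [hB] using key

/-- The size of the solution of the differential system. -/
noncomputable def model (q : ZMod n → ℝ) (ρ : ZMod n) (A0 A1 R : ℝ) (w : DihedralGroup n) : ℝ :=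
  barrier q ρ 0 (1 + A0)⁻¹ (1 + A1)⁻¹ (1 + R)⁻¹ w

theorem profile_mono (ρ : ZMod n) {u0 u1 u v0 v1 v : ℝ} (h0 : 0 ≤ u0) (h1 : 0 ≤ u1) (h : 0 ≤ u)
    (g0 : u0 ≤ v0) (g1 : u1 ≤ v1) (g : u ≤ v) (w : DihedralGroup n) :
    profile ρ u0 u1 u w ≤ profile ρ v0 v1 v w := by
  have := h0.trans g0
  have := h1.trans g1
  rcases w with j | j <;> simp only [profile] <;> split_ifs <;>
    first | exact le_rfl | assumption | gcongr

/-- Each component is homogeneous of degree 0, 1 or 2 in the ratios, so these factors cover all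
cases at once. -/
theorem profile_mul (ρ : ZMod n) {u0 u1 u s : ℝ} (h0 : 0 ≤ u0) (h1 : 0 ≤ u1) (h : 0 ≤ u)
    (hs : 0 < s) (w : DihedralGroup n) :
    min 1 (s ^ 2) * profile ρ u0 u1 u w ≤ profile ρ (s * u0) (s * u1) (s * u) w ∧
      profile ρ (s * u0) (s * u1) (s * u) w ≤ max 1 (s ^ 2) * profile ρ u0 u1 u w := by
  have a1 : min 1 (s ^ 2) ≤ s := by
    rcases le_total s 1 with h' | h'
    · exact (min_le_right _ _).trans (by nlinarith)
    · exact (min_le_left _ _).trans h'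
  have a2 : s ≤ max 1 (s ^ 2) := by
    rcases le_total s 1 with h' | h'
    · exact h'.trans (le_max_left _ _)
    · exact le_trans (by nlinarith) (le_max_right _ _)
  have b1 := min_le_right 1 (s ^ 2)
  have b2 := le_max_right 1 (s ^ 2)
  have e1 : s * u0 * (s * u1) = s ^ 2 * (u0 * u1) := by ring
  have e2 : (s * u0 + s * u1) / 2 * (s * u) = s ^ 2 * ((u0 + u1) / 2 * u) := by ring
  rcases w with j | j <;> simp only [profile] <;> split_ifs
  · simp
  · rw [e1]; constructor <;> gcongr
  · rw [e2]; constructor <;> gcongr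
  all_goals constructor <;> gcongr

theorem exists_le_mul_model (hq : IsReflectionWeight q k) (h01 : (1 : ZMod n) ≠ 0) (hm : 0 < m) :
    ∃ C, 0 < C ∧ ∀ (ρ : ZMod n) (A0 A1 R : ℝ) (lam : DihedralGroup n → ℝ)
      (ψ ψ' : DihedralGroup n → ℝ → ℝ), IsSlowLabel ρ → RateBounds ρ m m' A0 A1 R lam →
      (∀ w t, HasDerivAt (ψ w) (ψ' w t) t) → (∀ w, ψ w 0 = 1) →
      (∀ w t, t * ψ' w t + t * lam w * ψ w t + ∑ l, q l * (ψ w t - ψ (.sr l * w) t) = 0) →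
      ∀ w, ψ w 1 ≤ C * model q ρ A0 A1 R w := by
  have hq0 : ∀ i, 0 ≤ q i := fun i => hq.pos.le.trans (hq.le i)
  have hK0 : 0 ≤ ∑ l, q l := sum_nonneg fun i _ => hq0 i
  have hp : 0 ≤ ∑ l, q l - q 0 - q 1 := by linarith [hq.add_le h01.symm]
  -- The last two entries are the thresholds of `residual_nonneg`; `c ≥ 1` gives `c/(c+A) ≤
  -- c/(1+A)`. The choice involves only `q` and `m`, so the constant is uniform in the rates and in
  -- `ρ`.
  set c := max 1 (max ((1 + 2 * ∑ l, q l) / 2) ((2 + 3 * ∑ l, q l) / m)) with hc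
  have hc0 : 1 ≤ c := le_max_left _ _
  have hc1 : (1 + 2 * ∑ l, q l) / 2 ≤ c := (le_max_left _ _).trans (le_max_right _ _)
  have hc2 : (2 + 3 * ∑ l, q l) / m ≤ c := (le_max_right _ _).trans (le_max_right _ _)
  rw [div_le_iff₀ hm] at hc2
  have hcpos : 0 < c := by linarith
  refine ⟨max 1 (c ^ 2) * (c ^ q 0 * c ^ q 1 * c ^ (∑ l, q l - q 0 - q 1)), by positivity,
    fun ρ A0 A1 R lam ψ ψ' hρ hb hψ hψ0 hode w => ?_⟩
  refine (le_barrier hq hρ h01 hcpos (by linarith) (by linarith) hb hψ hψ0 hode w).trans ?_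
  have hA0 := hb.A0_nonneg
  have hA1 := hb.A1_nonneg
  have hR := hb.A0_nonneg.trans hb.A0_le
  have hle : ∀ A : ℝ, 0 ≤ A → c / (c + A) ≤ c * (1 + A)⁻¹ := fun A hA => by
    rw [div_eq_mul_inv]; gcongr
  have p0 := hle _ hA0
  have p1 := hle _ hA1
  have p2 := hle _ hR
  have r1 : profile ρ (c / (c + A0)) (c / (c + A1)) (c / (c + R)) w ≤
      max 1 (c ^ 2) * profile ρ (1 + A0)⁻¹ (1 + A1)⁻¹ (1 + R)⁻¹ w :=
    (profile_mono ρ (by positivity) (by positivity) (by positivity) p0 p1 p2 w).trans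
      (profile_mul ρ (by positivity) (by positivity) (by positivity) hcpos w).2
  have r0 : 0 ≤ profile ρ (1 + A0)⁻¹ (1 + A1)⁻¹ (1 + R)⁻¹ w := by
    rcases w with j | j <;> simp only [profile] <;> split_ifs <;> positivity
  have hrp : ∀ A e : ℝ, 0 ≤ A → 0 ≤ e → (c / (c + A)) ^ e ≤ c ^ e * ((1 + A)⁻¹) ^ e := by
    intro A e hA he
    rw [← Real.mul_rpow hcpos.le (by positivity)]
    exact Real.rpow_le_rpow (by positivity) (hle A hA) he
  have g0 := hrp A0 _ hA0 (hq0 0)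
  have g1 := hrp A1 _ hA1 (hq0 1)
  have g2 := hrp R _ hR hp
  rw [model, barrier, barrier, zero_mul, zero_mul, Real.exp_zero, mul_one, mul_one]
  calc _ ≤ (max 1 (c ^ 2) * profile ρ (1 + A0)⁻¹ (1 + A1)⁻¹ (1 + R)⁻¹ w) *
        ((c ^ q 0 * ((1 + A0)⁻¹) ^ q 0) * (c ^ q 1 * ((1 + A1)⁻¹) ^ q 1) *
          (c ^ (∑ l, q l - q 0 - q 1) * ((1 + R)⁻¹) ^ (∑ l, q l - q 0 - q 1))) := by
        gcongr
    _ = _ := by ring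

theorem exists_mul_model_le (hq : IsReflectionWeight q k) (h01 : (1 : ZMod n) ≠ 0) (hm : 0 < m') :
    ∃ C, 0 < C ∧ ∀ (ρ : ZMod n) (A0 A1 R : ℝ) (lam : DihedralGroup n → ℝ)
      (ψ ψ' : DihedralGroup n → ℝ → ℝ), IsSlowLabel ρ → RateBounds ρ m m' A0 A1 R lam →
      (∀ w t, HasDerivAt (ψ w) (ψ' w t) t) → (∀ w, ψ w 0 = 1) →
      (∀ w t, t * ψ' w t + t * lam w * ψ w t + ∑ l, q l * (ψ w t - ψ (.sr l * w) t) = 0) →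
      ∀ w, C * model q ρ A0 A1 R w ≤ ψ w 1 := by
  have hk := hq.pos
  have hq0 : ∀ i, 0 ≤ q i := fun i => hq.pos.le.trans (hq.le i)
  have hK0 : 0 ≤ ∑ l, q l := sum_nonneg fun i _ => hq0 i
  have hp : 0 ≤ ∑ l, q l - q 0 - q 1 := by linarith [hq.add_le h01.symm]
  -- Thresholds of `residual_nonpos`, with `c ≤ 1` now giving `c/(1+A) ≤ c/(c+A)`. The factor
  -- `exp(-M)` below is a lower bound for `exp(M(u-1))`.
  set c := min 1 (min (k / 4) (k / 2 / m')) with hc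
  have hc0 : c ≤ 1 := min_le_left _ _
  have hc1 : c ≤ k / 4 := (min_le_right _ _).trans (min_le_left _ _)
  have hc2 : c ≤ k / 2 / m' := (min_le_right _ _).trans (min_le_right _ _)
  rw [le_div_iff₀ hm] at hc2
  have hcpos : 0 < c := by positivity
  set M := max ((∑ l, q l) / 2) ((∑ l, q l) ^ 2 / (2 * k)) with hM
  have hM0 : 0 ≤ M := le_trans (by positivity) (le_max_left _ _)
  refine ⟨min 1 (c ^ 2) * (c ^ q 0 * c ^ q 1 * c ^ (∑ l, q l - q 0 - q 1) * Real.exp (-M)),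
    by positivity, fun ρ A0 A1 R lam ψ ψ' hρ hb hψ hψ0 hode w => ?_⟩
  refine le_trans ?_ (barrier_le hq hρ h01 hcpos (by linarith) (by linarith) (le_max_left _ _)
    (le_max_right _ _) hb hψ hψ0 hode w)
  have hA0 := hb.A0_nonneg
  have hA1 := hb.A1_nonneg
  have hR := hb.A0_nonneg.trans hb.A0_le
  have hle : ∀ A : ℝ, 0 ≤ A → c * (1 + A)⁻¹ ≤ c / (c + A) := fun A hA => by
    rw [div_eq_mul_inv]; gcongr
  have p0 := hle _ hA0
  have p1 := hle _ hA1
  have p2 := hle _ hR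
  have r1 : min 1 (c ^ 2) * profile ρ (1 + A0)⁻¹ (1 + A1)⁻¹ (1 + R)⁻¹ w ≤
      profile ρ (c / (c + A0)) (c / (c + A1)) (c / (c + R)) w :=
    (profile_mul ρ (by positivity) (by positivity) (by positivity) hcpos w).1.trans
      (profile_mono ρ (by positivity) (by positivity) (by positivity) p0 p1 p2 w)
  have r0 : 0 ≤ profile ρ (1 + A0)⁻¹ (1 + A1)⁻¹ (1 + R)⁻¹ w := by
    rcases w with j | j <;> simp only [profile] <;> split_ifs <;> positivity
  have hrp : ∀ A e : ℝ, 0 ≤ A → 0 ≤ e → c ^ e * ((1 + A)⁻¹) ^ e ≤ (c / (c + A)) ^ e := by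
    intro A e hA he
    rw [← Real.mul_rpow hcpos.le (by positivity)]
    exact Real.rpow_le_rpow (by positivity) (hle A hA) he
  have g0 := hrp A0 _ hA0 (hq0 0)
  have g1 := hrp A1 _ hA1 (hq0 1)
  have g2 := hrp R _ hR hp
  have g3 : Real.exp (-M) ≤ Real.exp (M * (c / (c + R) - 1)) := by
    refine Real.exp_le_exp.2 ?_
    have : 0 ≤ c / (c + R) := by positivity
    nlinarith
  rw [model, barrier, barrier, zero_mul, Real.exp_zero, mul_one]
  have r2 := (mul_nonneg (le_min zero_le_one (sq_nonneg c)) r0).trans r1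
  calc _ = (min 1 (c ^ 2) * profile ρ (1 + A0)⁻¹ (1 + A1)⁻¹ (1 + R)⁻¹ w) *
        ((c ^ q 0 * ((1 + A0)⁻¹) ^ q 0) * (c ^ q 1 * ((1 + A1)⁻¹) ^ q 1) *
          (c ^ (∑ l, q l - q 0 - q 1) * ((1 + R)⁻¹) ^ (∑ l, q l - q 0 - q 1)) *
          Real.exp (-M)) := by ring
    _ ≤ _ := by gcongr

end Sums

end

end DihedralDunkl

/-! ### Polar coordinates in the chamber and the decay rates. -/

namespace DihedralDunkl

section

open Set Finset Real

section Trigonometry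

variable {β θ θ' η η' S : ℝ}

theorem sin_half_pos (hβ : 0 < β) (hβ3 : β ≤ π / 3) : 0 < sin (β / 2) :=
  sin_pos_of_pos_of_lt_pi (by linarith) (by linarith [pi_pos])

theorem sin_half_le {φ : ℝ} (hβ : 0 < β) (h1 : β / 2 ≤ φ) (h2 : φ ≤ π - β / 2) :
    sin (β / 2) ≤ sin φ := by
  rcases le_total φ (π / 2) with h | h
  · exact sin_le_sin_of_le_of_le_pi_div_two (by linarith [pi_pos]) h h1
  · rw [← sin_pi_sub φ]
    exact sin_le_sin_of_le_of_le_pi_div_two (by linarith [pi_pos]) (by linarith) (by linarith)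

theorem half_le_cos {φ : ℝ} (h1 : -(π / 3) ≤ φ) (h2 : φ ≤ π / 3) : 1 / 2 ≤ cos φ := by
  rw [← cos_pi_div_three, ← cos_abs φ]
  exact cos_le_cos_of_nonneg_of_le_pi (abs_nonneg _) (by linarith [pi_pos]) (abs_le.2 ⟨h1, h2⟩)

/-- The primed angles are measured from the other wall. If `x` lies in the half `θ ≤ β/2`, then `θ'
+ η` stays away from `0` and `π`, while `sin (θ + η')` is small only when `x` and `y` approach
opposite walls, exactly when both simple root products are small relative to `S`. -/
theorem slow_angle_bounds (hβ : 0 < β) (hβ3 : β ≤ π / 3) (hθ0 : 0 ≤ θ) (hη0 : 0 ≤ η)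
    (hη0' : 0 ≤ η') (hθ : θ + θ' = β) (hη : η + η' = β) (h : θ ≤ β / 2) (hS : 0 ≤ S) :
    sin (β / 2) * S ≤ S * sin (θ' + η) ∧
    1 / 2 * (S * (sin θ * sin η) + S * (sin θ' * sin η')) ≤ S * sin (θ + η') ∧
    S * sin (θ + η') ≤
      2 / sin (β / 2) ^ 2 * (S * (sin θ * sin η) + S * (sin θ' * sin η')) := by
  have hπ := pi_pos
  have hσ := sin_half_pos hβ hβ3
  have hσ1 := sin_le_one (β / 2)
  set σ := sin (β / 2) with hσdef
  have s1 : 0 ≤ sin θ := sin_nonneg_of_nonneg_of_le_pi hθ0 (by linarith)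
  have s2 : 0 ≤ sin η := sin_nonneg_of_nonneg_of_le_pi hη0 (by linarith)
  have s3 : 0 ≤ sin η' := sin_nonneg_of_nonneg_of_le_pi hη0' (by linarith)
  have s4 : σ ≤ sin θ' := sin_half_le hβ (by linarith) (by linarith)
  have c1 := half_le_cos (φ := θ) (by linarith) (by linarith)
  have c2 := half_le_cos (φ := η') (by linarith) (by linarith)
  have t1 := sin_le_one θ
  have t2 := sin_le_one η
  have t3 := sin_le_one η'
  have t4 := sin_le_one θ'
  have g1 := cos_le_one θ
  have g2 := cos_le_one η'
  refine ⟨?_, ?_, ?_⟩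
  · rw [mul_comm]
    exact mul_le_mul_of_nonneg_left (sin_half_le hβ (by linarith) (by linarith)) hS
  · rw [sin_add, ← mul_add, mul_left_comm]
    refine mul_le_mul_of_nonneg_left ?_ hS
    nlinarith [mul_le_mul_of_nonneg_left t2 s1, mul_le_mul_of_nonneg_right t4 s3,
      mul_le_mul_of_nonneg_left c2 s1, mul_le_mul_of_nonneg_left c1 s3]
  · rw [sin_add, ← mul_add, mul_left_comm]
    refine mul_le_mul_of_nonneg_left ?_ hS
    rw [div_mul_eq_mul_div, le_div_iff₀ (by positivity)]
    have hle : sin θ * cos η' + cos θ * sin η' ≤ sin θ + sin η' := by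
      nlinarith [mul_le_mul_of_nonneg_left g2 s1, mul_le_mul_of_nonneg_right g1 s3]
    have key : (sin θ + sin η') * σ ^ 2 ≤ 2 * (sin θ * sin η + sin θ' * sin η') := by
      have hσ2 : σ ^ 2 ≤ σ := by nlinarith
      have e1 : σ * sin η' ≤ sin θ' * sin η' := mul_le_mul_of_nonneg_right s4 s3
      have e2 : sin η' * σ ^ 2 ≤ sin η' * σ := mul_le_mul_of_nonneg_left hσ2 s3
      -- If `y` is away from the first wall, each of the two products bounds one of the sines.
      -- Otherwise `sin θ'` and `sin η'` are both at least `σ`, and the second product suffices.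
      rcases le_total (β / 2) η with h' | h'
      · have s5 : σ ≤ sin η := sin_half_le hβ h' (by linarith)
        have e3 : sin θ * σ ≤ sin θ * sin η := mul_le_mul_of_nonneg_left s5 s1
        have e4 : sin θ * σ ^ 2 ≤ sin θ * σ := mul_le_mul_of_nonneg_left hσ2 s1
        have : 0 ≤ σ * sin η' := by positivity
        have : 0 ≤ sin θ * σ := by positivity
        nlinarith
      · have s5 : σ ≤ sin η' := sin_half_le hβ (by linarith) (by linarith)
        have e3 : σ * σ ≤ σ * sin η' := mul_le_mul_of_nonneg_left s5 hσ.le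
        have e4 : sin θ * σ ^ 2 ≤ 1 * σ ^ 2 := mul_le_mul_of_nonneg_right t1 (sq_nonneg _)
        have : 0 ≤ sin θ * sin η := by positivity
        nlinarith
    exact (mul_le_mul_of_nonneg_right hle (sq_nonneg σ)).trans key

end Trigonometry

variable {n : ℕ}

/-- Polar coordinates in the closed chamber, the angle being measured from the wall of `α_0`. -/
structure IsPolar (n : ℕ) (x : Plane) (s θ : ℝ) : Prop where
  s_nonneg : 0 ≤ s
  θ_nonneg : 0 ≤ θ
  θ_le : θ ≤ π / n
  zero : x 0 = s * sin θ
  one : x 1 = s * cos θ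

theorem inner_posRoot {x : Plane} {s θ : ℝ} (h0 : x 0 = s * sin θ) (h1 : x 1 = s * cos θ) (j : ℕ) :
    inner ℝ (posRoot n j) x = s * sin (π * j / n + θ) := by
  rw [inner_eq, h0, h1, sin_add]
  simp [posRoot]; ring

theorem exists_isPolar (hn : 3 ≤ n) {x : Plane} (hx : x ∈ closedChamber n) :
    ∃ s θ, IsPolar n x s θ := by
  have hn0 : (0 : ℝ) < n := by positivity
  have hn1 : π / n ≤ π := div_le_self pi_pos.le (by exact_mod_cast (by omega : 1 ≤ n))
  have hβ : 0 < π / n := by positivity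
  -- The coordinates are swapped so that the argument is measured from the second axis, the wall of
  -- `α_0`.
  set z : ℂ := ⟨x 1, x 0⟩
  have h0 : x 0 = ‖z‖ * sin z.arg := (Complex.norm_mul_sin_arg z).symm
  have h1 : x 1 = ‖z‖ * cos z.arg := (Complex.norm_mul_cos_arg z).symm
  obtain ⟨hx0, hx1⟩ := hx
  rw [inner_posRoot h0 h1] at hx0 hx1
  have hcast : π * ((n - 1 : ℕ) : ℝ) / n = π - π / n := by
    rw [Nat.cast_sub (by omega)]; push_cast; field_simp
  rw [hcast, show π - π / n + z.arg = π - (π / n - z.arg) by ring, sin_pi_sub] at hx1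
  have harg : 0 ≤ z.arg := by
    rw [Complex.arg_nonneg_iff]
    simpa [h0] using hx0
  refine ⟨‖z‖, z.arg, norm_nonneg _, harg, ?_, h0, h1⟩
  rcases (norm_nonneg z).eq_or_lt with hz | hz
  -- At the origin the argument takes its default value `0`, an admissible angle.
  · rw [norm_eq_zero.1 hz.symm, Complex.arg_zero]; exact hβ.le
  · by_contra! hlt
    have : 0 ≤ sin (π / n - z.arg) := nonneg_of_mul_nonneg_right hx1 hz
    have h2 := sin_neg_of_neg_of_neg_pi_lt (x := π / n - z.arg) (by linarith)
      (by linarith [Complex.arg_le_pi z])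
    linarith

theorem inner_rot {x y : Plane} {s θ r η : ℝ} (hx : IsPolar n x s θ) (hy : IsPolar n y r η)
    (φ : ℝ) : inner ℝ x (rot φ y) = s * r * cos (θ - η + φ) := by
  rw [inner_eq, rot_zero', rot_one', hx.zero, hx.one, hy.zero, hy.one, cos_add, cos_sub, sin_sub]
  ring

theorem inner_rot_left {x y : Plane} {s θ r η : ℝ} (hx : IsPolar n x s θ) (hy : IsPolar n y r η)
    (φ : ℝ) : inner ℝ (rot φ x) y = s * r * cos (θ - η - φ) := by
  rw [inner_eq, rot_zero', rot_one', hx.zero, hx.one, hy.zero, hy.one, cos_sub, cos_sub, sin_sub]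
  ring

theorem inner_polar {x y : Plane} {s θ r η : ℝ} (hx : IsPolar n x s θ) (hy : IsPolar n y r η) :
    inner ℝ x y = s * r * cos (θ - η) := by
  rw [inner_eq, hx.zero, hx.one, hy.zero, hy.one, cos_sub]
  ring

theorem inner_rTilde {x y : Plane} {s θ r η : ℝ} (hx : IsPolar n x s θ) (hy : IsPolar n y r η) :
    inner ℝ x (rTilde n y) = s * r * sin (π / n - θ + η) := by
  rw [rTilde, inner_rot hx hy, ← cos_pi_div_two_sub, ← cos_neg]
  rw [← cos_neg]
  congr 2; ring

theorem inner_rTilde_left {x y : Plane} {s θ r η : ℝ} (hx : IsPolar n x s θ)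
    (hy : IsPolar n y r η) :
    inner ℝ (rTilde n x) y = s * r * sin (π / n - η + θ) := by
  rw [rTilde, inner_rot_left hx hy, ← cos_pi_div_two_sub, ← cos_neg]
  congr 2; ring

/-- The product of the values of the `k`-th root at `x` and `y`. -/
noncomputable def rootProd (k : ZMod n) (x y : Plane) : ℝ := inner ℝ (root n k) x * inner ℝ (root n k) y

/-- The decay rate of the component of the kernel at `w`. -/
noncomputable def rate (x y : Plane) (w : DihedralGroup n) : ℝ := inner ℝ x y - inner ℝ x (act w y)

theorem rate_sr [NeZero n] (k : ZMod n) (x y : Plane) : rate x y (.sr k) = 2 * rootProd k x y := by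
  rw [rate, act_sr_eq, inner_sub_right, inner_smul_right, rootProd, real_inner_comm x (root n k)]
  ring

theorem rate_r {x y : Plane} {s θ r η : ℝ} (hx : IsPolar n x s θ) (hy : IsPolar n y r η)
    (k : ZMod n) :
    rate x y (.r k) = 2 * sin (π * k.val / n) * (s * r * sin (π * k.val / n + θ - η)) := by
  rw [rate, act_r, inner_rot hx hy, inner_polar hx hy, ← mul_sub, cos_sub_cos]
  have e1 : (θ - η + (θ - η + 2 * π * k.val / n)) / 2 = π * k.val / n + θ - η := by ring
  have e2 : (θ - η - (θ - η + 2 * π * k.val / n)) / 2 = -(π * k.val / n) := by ring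
  rw [e1, e2, sin_neg]; ring

section Geometry

variable [NeZero n] {x y : Plane} {s θ r η : ℝ}

theorem val_one_of_three_le (hn : 3 ≤ n) : (1 : ZMod n).val = 1 := by
  have : Fact (1 < n) := ⟨by omega⟩
  exact ZMod.val_one n

theorem val_neg_one_of_three_le (hn : 3 ≤ n) : (-1 : ZMod n).val = n - 1 := by
  obtain ⟨m, rfl⟩ : ∃ m, n = m + 1 := ⟨n - 1, by omega⟩
  simp [ZMod.val_neg_one m]

theorem one_ne_zero_of_three_le (hn : 3 ≤ n) : (1 : ZMod n) ≠ 0 := by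
  intro h
  have := val_one_of_three_le hn
  rw [h, ZMod.val_zero] at this
  omega

theorem one_ne_neg_one_of_three_le (hn : 3 ≤ n) : (1 : ZMod n) ≠ -1 := by
  intro h
  have h1 := val_one_of_three_le hn
  rw [h, val_neg_one_of_three_le hn] at h1
  omega

theorem root_zero_eq : root n 0 = posRoot n 0 := by simp [root]

theorem root_one_eq (hn : 3 ≤ n) : root n 1 = posRoot n (n - 1) := by
  rw [root, val_neg_one_of_three_le hn]

theorem rootProd_zero (hx : IsPolar n x s θ) (hy : IsPolar n y r η) :
    rootProd (0 : ZMod n) x y = s * r * (sin θ * sin η) := by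
  rw [rootProd, root_zero_eq, inner_posRoot hx.zero hx.one, inner_posRoot hy.zero hy.one]
  simp; ring

theorem rootProd_one (hn : 3 ≤ n) (hx : IsPolar n x s θ) (hy : IsPolar n y r η) :
    rootProd (1 : ZMod n) x y = s * r * (sin (π / n - θ) * sin (π / n - η)) := by
  have hn0 : (n : ℝ) ≠ 0 := by positivity
  have hcast : π * ((n - 1 : ℕ) : ℝ) / n = π - π / n := by
    rw [Nat.cast_sub (by omega)]; push_cast; field_simp
  rw [rootProd, root_one_eq hn, inner_posRoot hx.zero hx.one, inner_posRoot hy.zero hy.one, hcast,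
    ← sin_pi_sub (π / n - θ), ← sin_pi_sub (π / n - η),
    show π - (π / n - θ) = π - π / n + θ by ring, show π - (π / n - η) = π - π / n + η by ring]
  ring

theorem angle_bounds_of_ne (hn : 3 ≤ n) {j : ℕ} (h0 : 1 ≤ j) (h1 : j + 2 ≤ n) :
    π / n ≤ π * j / n ∧ π * j / n ≤ π - 2 * (π / n) := by
  have hn0 : (0 : ℝ) < n := by positivity
  have c0 : (1 : ℝ) ≤ j := by exact_mod_cast h0
  have c1 : (j : ℝ) + 2 ≤ n := by exact_mod_cast h1
  constructor
  · rw [div_le_div_iff_of_pos_right hn0]; nlinarith [pi_pos]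
  · rw [show π - 2 * (π / n) = π * (n - 2) / n by field_simp, div_le_div_iff_of_pos_right hn0]
    nlinarith [pi_pos]

theorem pi_div_bounds (hn : 3 ≤ n) : 0 < π / n ∧ π / n ≤ π / 3 := by
  have c : (3 : ℝ) ≤ n := by exact_mod_cast hn
  constructor
  · positivity
  · gcongr

/-- Only the simple roots have mirrors bounding the chamber. For the others the angles in the sines
lie in `[π/n, π - π/n]`. -/
theorem rootProd_bounds (hn : 3 ≤ n) (hx : IsPolar n x s θ) (hy : IsPolar n y r η) {k : ZMod n}
    (hk0 : k ≠ 0) (hk1 : k ≠ 1) :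
    sin (π / n / 2) ^ 2 * (s * r) ≤ rootProd k x y ∧ rootProd k x y ≤ s * r := by
  have hS : 0 ≤ s * r := mul_nonneg hx.s_nonneg hy.s_nonneg
  obtain ⟨hβ, hβ3⟩ := pi_div_bounds hn
  have hval0 : 1 ≤ (-k).val := by
    rw [Nat.one_le_iff_ne_zero, Ne, ZMod.val_eq_zero]; exact neg_ne_zero.2 hk0
  have hval1 : (-k).val + 2 ≤ n := by
    have h1 := ZMod.val_lt (-k)
    have h2 : (-k).val ≠ n - 1 := by
      rw [← val_neg_one_of_three_le hn]
      intro h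
      exact hk1 (neg_injective (ZMod.val_injective n h))
    omega
  obtain ⟨a0, a1⟩ := angle_bounds_of_ne hn hval0 hval1
  have hσ := sin_half_pos hβ hβ3
  have b1 := sin_half_le hβ (φ := π * (-k).val / n + θ) (by linarith [hx.θ_nonneg])
    (by linarith [hx.θ_le])
  have b2 := sin_half_le hβ (φ := π * (-k).val / n + η) (by linarith [hy.θ_nonneg])
    (by linarith [hy.θ_le])
  have t1 := sin_le_one (π * (-k).val / n + θ)
  have t2 := sin_le_one (π * (-k).val / n + η)
  have e : rootProd k x y =
      s * r * (sin (π * (-k).val / n + θ) * sin (π * (-k).val / n + η)) := by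
    rw [rootProd, root, inner_posRoot hx.zero hx.one, inner_posRoot hy.zero hy.one]; ring
  rw [e]
  have b3 := hσ.le.trans b1
  constructor
  · rw [mul_comm, sq]
    gcongr
  · refine mul_le_of_le_one_right hS ?_
    nlinarith

theorem rate_r_bounds (hn : 3 ≤ n) (hx : IsPolar n x s θ) (hy : IsPolar n y r η) {k : ZMod n}
    (hk0 : k ≠ 0) (hk1 : k ≠ 1) (hk2 : k ≠ -1) :
    2 * sin (π / n / 2) ^ 2 * (s * r) ≤ rate x y (.r k) ∧ rate x y (.r k) ≤ 2 * (s * r) := by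
  have hS : 0 ≤ s * r := mul_nonneg hx.s_nonneg hy.s_nonneg
  obtain ⟨hβ, hβ3⟩ := pi_div_bounds hn
  have hval0 : 2 ≤ k.val := by
    have h1 : k.val ≠ 0 := by rw [Ne, ZMod.val_eq_zero]; exact hk0
    have h2 : k.val ≠ 1 := by
      rw [← val_one_of_three_le hn]; exact fun h => hk1 (ZMod.val_injective n h)
    omega
  have hval1 : k.val + 2 ≤ n := by
    have h1 := ZMod.val_lt k
    have h2 : k.val ≠ n - 1 := by
      rw [← val_neg_one_of_three_le hn]; exact fun h => hk2 (ZMod.val_injective n h)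
    omega
  obtain ⟨a0, a1⟩ := angle_bounds_of_ne hn (by omega : 1 ≤ k.val) hval1
  obtain ⟨a2, -⟩ := angle_bounds_of_ne hn (j := k.val - 1) (by omega) (by omega)
  have a3 : 2 * (π / n) ≤ π * k.val / n := by
    have : ((k.val - 1 : ℕ) : ℝ) = k.val - 1 := by rw [Nat.cast_sub (by omega)]; simp
    rw [this, mul_sub, sub_div, mul_one] at a2
    linarith
  have hσ := sin_half_pos hβ hβ3
  have b1 := sin_half_le hβ (φ := π * k.val / n) (by linarith) (by linarith)
  have b2 := sin_half_le hβ (φ := π * k.val / n + θ - η) (by linarith [hx.θ_nonneg, hy.θ_le])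
    (by linarith [hx.θ_le, hy.θ_nonneg])
  have t1 := sin_le_one (π * k.val / n)
  have t2 := sin_le_one (π * k.val / n + θ - η)
  rw [rate_r hx hy, show 2 * sin (π * k.val / n) * (s * r * sin (π * k.val / n + θ - η)) =
    2 * (s * r) * (sin (π * k.val / n) * sin (π * k.val / n + θ - η)) by ring,
    show 2 * sin (π / n / 2) ^ 2 * (s * r) =
      2 * (s * r) * (sin (π / n / 2) * sin (π / n / 2)) by ring]
  have b3 := hσ.le.trans b1
  constructor
  · gcongr
  · refine mul_le_of_le_one_right (by positivity) ?_
    nlinarith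

/-- By `inner_rTilde_left` the rate is `2 sin(π/n)` times the inner product of `rTilde n x` with
`y`. That is the quantity in the rational factor of `r₋₁`, not of `r₁`; for `r₋₁` the roles are
exchanged. -/
theorem rate_r_one (hn : 3 ≤ n) (hx : IsPolar n x s θ) (hy : IsPolar n y r η) :
    rate x y (.r (1 : ZMod n)) = 2 * sin (π / n) * (s * r * sin (π / n - η + θ)) := by
  rw [rate_r hx hy, val_one_of_three_le hn]
  simp only [Nat.cast_one, mul_one]
  congr 3; ring

theorem rate_r_neg_one (hn : 3 ≤ n) (hx : IsPolar n x s θ) (hy : IsPolar n y r η) :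
    rate x y (.r (-1 : ZMod n)) = 2 * sin (π / n) * (s * r * sin (π / n - θ + η)) := by
  have hn0 : (n : ℝ) ≠ 0 := by positivity
  have hcast : π * ((n - 1 : ℕ) : ℝ) / n = π - π / n := by
    rw [Nat.cast_sub (by omega)]; push_cast; field_simp
  rw [rate_r hx hy, val_neg_one_of_three_le hn, hcast, sin_pi_sub,
    show π - π / n + θ - η = π - (π / n - θ + η) by ring, sin_pi_sub]

end Geometry

end

end DihedralDunkl

/-! ### Comparison of the barriers with the stated factors, and the kernel bounds. -/

namespace DihedralDunkl

section

open Set Finset Real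

variable {n : ℕ} [NeZero n] {x y : Plane}

/-- The rotation `r_ρ` decays like the sum of the two simple root products and `r_ρ⁻¹` like
`S`, the product of the norms; `Qs` and `Qf` are the two quantities in the rational factor. -/
structure SlowRotation (σ : ℝ) (x y : Plane) (ρ : ZMod n) (S Qs Qf : ℝ) : Prop where
  label : IsSlowLabel ρ
  rate_slow : σ * Qs ≤ rate x y (.r ρ) ∧ rate x y (.r ρ) ≤ 2 * Qs
  rate_fast : σ * Qf ≤ rate x y (.r (-ρ)) ∧ rate x y (.r (-ρ)) ≤ 2 * Qf
  fast_ge : σ * S ≤ Qf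
  fast_le : Qf ≤ S
  slow_ge : 1 / 2 * (rootProd (0 : ZMod n) x y + rootProd (1 : ZMod n) x y) ≤ Qs
  slow_le : Qs ≤ 2 / σ ^ 2 * (rootProd (0 : ZMod n) x y + rootProd (1 : ZMod n) x y)
  weyl_slow : weylFactor n x y (.r ρ) = (1 + Qf) /
    ((1 + rootProd (0 : ZMod n) x y) * (1 + rootProd (1 : ZMod n) x y) * (1 + inner ℝ x y))
  weyl_fast : weylFactor n x y (.r (-ρ)) = (1 + Qs) /
    ((1 + rootProd (0 : ZMod n) x y) * (1 + rootProd (1 : ZMod n) x y) * (1 + inner ℝ x y))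
  weyl_other : ∀ k, k ≠ 0 → k ≠ ρ → k ≠ -ρ → weylFactor n x y (.r k) = (1 + Qs) * (1 + Qf) /
    ((1 + rootProd (0 : ZMod n) x y) * (1 + rootProd (1 : ZMod n) x y) * (1 + inner ℝ x y) ^ 2)

variable {s θ r η : ℝ}

/-- The angle between two vectors of the chamber is at most `π/n ≤ π/3`, so its cosine is at least
`1/2`. -/
theorem simple_bounds (hn : 3 ≤ n) (hx : IsPolar n x s θ) (hy : IsPolar n y r η) :
    0 ≤ rootProd (0 : ZMod n) x y ∧ 0 ≤ rootProd (1 : ZMod n) x y ∧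
    rootProd (0 : ZMod n) x y ≤ inner ℝ x y ∧ rootProd (1 : ZMod n) x y ≤ inner ℝ x y ∧
    s * r ≤ 2 * inner ℝ x y ∧ inner ℝ x y ≤ s * r := by
  have hS : 0 ≤ s * r := mul_nonneg hx.s_nonneg hy.s_nonneg
  obtain ⟨hβ, hβ3⟩ := pi_div_bounds hn
  have hπ := pi_pos
  have hθ := hx.θ_nonneg
  have hη := hy.θ_nonneg
  have hθ' := hx.θ_le
  have hη' := hy.θ_le
  have s1 : 0 ≤ sin θ := sin_nonneg_of_nonneg_of_le_pi hθ (by linarith)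
  have s2 : 0 ≤ sin η := sin_nonneg_of_nonneg_of_le_pi hη (by linarith)
  have s3 : 0 ≤ sin (π / n - θ) := sin_nonneg_of_nonneg_of_le_pi (by linarith) (by linarith)
  have s4 : 0 ≤ sin (π / n - η) := sin_nonneg_of_nonneg_of_le_pi (by linarith) (by linarith)
  have c1 := half_le_cos (φ := θ) (by linarith) (by linarith)
  have c2 := half_le_cos (φ := η) (by linarith) (by linarith)
  have c3 := half_le_cos (φ := π / n - θ) (by linarith) (by linarith)
  have c4 := half_le_cos (φ := π / n - η) (by linarith) (by linarith)
  have c5 := half_le_cos (φ := θ - η) (by linarith) (by linarith)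
  have e1 : cos (θ - η) = cos (π / n - θ) * cos (π / n - η) + sin (π / n - θ) * sin (π / n - η) := by
    rw [← cos_sub, ← cos_neg]; congr 1; ring
  rw [rootProd_zero hx hy, rootProd_one hn hx hy, inner_polar hx hy]
  refine ⟨by positivity, by positivity, ?_, ?_, ?_, ?_⟩
  · refine mul_le_mul_of_nonneg_left ?_ hS
    rw [cos_sub]; nlinarith
  · refine mul_le_mul_of_nonneg_left ?_ hS
    rw [e1]; nlinarith
  · nlinarith
  · exact mul_le_of_le_one_right hS (cos_le_one _)

theorem exists_slowRotation (hn : 3 ≤ n) (hx : IsPolar n x s θ) (hy : IsPolar n y r η) :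
    ∃ (ρ : ZMod n) (Qs Qf : ℝ), SlowRotation (sin (π / n / 2)) x y ρ (s * r) Qs Qf := by
  have hS : 0 ≤ s * r := mul_nonneg hx.s_nonneg hy.s_nonneg
  obtain ⟨hβ, hβ3⟩ := pi_div_bounds hn
  have hθ := hx.θ_nonneg
  have hη := hy.θ_nonneg
  have hθ' := hx.θ_le
  have hη' := hy.θ_le
  have hσ := sin_half_pos hβ hβ3
  have h01 := one_ne_zero_of_three_le hn
  have hne := one_ne_neg_one_of_three_le hn
  have b1 := sin_half_le hβ (φ := π / n) (by linarith) (by linarith [pi_pos])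
  have b2 := sin_le_one (π / n)
  have r1 := rate_r_one hn hx hy
  have r2 := rate_r_neg_one hn hx hy
  have hP0 : 0 ≤ s * r * sin (π / n - θ + η) := mul_nonneg hS
    (sin_nonneg_of_nonneg_of_le_pi (by linarith) (by linarith [pi_pos]))
  have hQ0 : 0 ≤ s * r * sin (π / n - η + θ) := mul_nonneg hS
    (sin_nonneg_of_nonneg_of_le_pi (by linarith) (by linarith [pi_pos]))
  have hrate : ∀ Z : ℝ, 0 ≤ Z → sin (π / n / 2) * Z ≤ 2 * sin (π / n) * Z ∧
      2 * sin (π / n) * Z ≤ 2 * Z := fun Z hZ =>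
    ⟨mul_le_mul_of_nonneg_right (by linarith) hZ, mul_le_mul_of_nonneg_right (by linarith) hZ⟩
  have hle : ∀ φ, s * r * sin φ ≤ s * r := fun φ => mul_le_of_le_one_right hS (sin_le_one φ)
  have w1 : weylFactor n x y (.r 1) = (1 + s * r * sin (π / n - θ + η)) /
    ((1 + rootProd (0 : ZMod n) x y) * (1 + rootProd (1 : ZMod n) x y) * (1 + inner ℝ x y)) := by
    simp only [weylFactor, h01, if_false, if_true, rootProd, root_zero_eq, root_one_eq hn,
      inner_rTilde hx hy]
  have w2 : weylFactor n x y (.r (-1)) = (1 + s * r * sin (π / n - η + θ)) /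
    ((1 + rootProd (0 : ZMod n) x y) * (1 + rootProd (1 : ZMod n) x y) * (1 + inner ℝ x y)) := by
    simp only [weylFactor, neg_eq_zero, h01, hne.symm, if_false, if_true, rootProd, root_zero_eq,
      root_one_eq hn, inner_rTilde_left hx hy]
  have w3 : ∀ k : ZMod n, k ≠ 0 → k ≠ 1 → k ≠ -1 → weylFactor n x y (.r k) =
      (1 + s * r * sin (π / n - η + θ)) * (1 + s * r * sin (π / n - θ + η)) /
    ((1 + rootProd (0 : ZMod n) x y) * (1 + rootProd (1 : ZMod n) x y) * (1 + inner ℝ x y) ^ 2) := by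
    intro k h0 h1 h2
    simp only [weylFactor, h0, h1, h2, if_false, rootProd, root_zero_eq, root_one_eq hn,
      inner_rTilde_left hx hy, inner_rTilde hx hy]
  have a0 := rootProd_zero hx hy
  have a1 := rootProd_one hn hx hy
  -- The half of the chamber containing `x` selects the slow rotation; the second case is the mirror
  -- image under `θ ↦ π/n - θ`.
  rcases le_total θ (π / n / 2) with h | h
  · obtain ⟨g1, g2, g3⟩ := slow_angle_bounds (θ := θ) (θ' := π / n - θ) (η := η)
      (η' := π / n - η) hβ hβ3 hθ hη (by linarith) (by ring) (by ring) h hS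
    rw [← a0, ← a1, add_comm θ] at g2 g3
    exact ⟨1, s * r * sin (π / n - η + θ), s * r * sin (π / n - θ + η), Or.inl rfl,
      by rw [r1]; exact hrate _ hQ0, by rw [r2]; exact hrate _ hP0, g1, hle _, g2, g3, w1, w2, w3⟩
  · obtain ⟨g1, g2, g3⟩ := slow_angle_bounds (θ := π / n - θ) (θ' := θ) (η := π / n - η)
      (η' := η) hβ hβ3 (by linarith) (by linarith) hη (by ring) (by ring) (by linarith) hS
    rw [← a0, ← a1, add_comm (rootProd 1 x y)] at g2 g3
    rw [add_comm θ] at g1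
    refine ⟨-1, s * r * sin (π / n - θ + η), s * r * sin (π / n - η + θ), Or.inr rfl,
      by rw [r2]; exact hrate _ hP0, by rw [neg_neg, r1]; exact hrate _ hQ0, g1, hle _, g2, g3,
      w2, by rw [neg_neg]; exact w1, fun k h0 h1 h2 => ?_⟩
    rw [neg_neg] at h2
    rw [w3 k h0 h2 h1, mul_comm (1 + s * r * sin (π / n - θ + η))]

theorem SlowRotation.rateBounds {ρ : ZMod n} {Qs Qf : ℝ} (hn : 3 ≤ n) (hx : IsPolar n x s θ)
    (hy : IsPolar n y r η) (h : SlowRotation (sin (π / n / 2)) x y ρ (s * r) Qs Qf) :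
    RateBounds ρ (sin (π / n / 2) ^ 2 / 2) (4 / sin (π / n / 2) ^ 2) (rootProd (0 : ZMod n) x y)
      (rootProd (1 : ZMod n) x y) (inner ℝ x y) (rate x y) := by
  obtain ⟨hβ, hβ3⟩ := pi_div_bounds hn
  have hσ := sin_half_pos hβ hβ3
  have hσ1 := sin_le_one (π / n / 2)
  obtain ⟨hA0, hA1, hA0R, hA1R, hSR, hRS⟩ := simple_bounds hn hx hy
  have hS : 0 ≤ s * r := mul_nonneg hx.s_nonneg hy.s_nonneg
  have hk : ∀ k : ZMod n, k ≠ ρ → k ≠ -ρ → k ≠ 1 ∧ k ≠ -1 := by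
    intro k h1 h2
    rcases h.label with rfl | rfl
    · exact ⟨h1, h2⟩
    · rw [neg_neg] at h2; exact ⟨h2, h1⟩
  obtain ⟨s1, s2⟩ := h.rate_slow
  obtain ⟨f1, f2⟩ := h.rate_fast
  have q1 := h.fast_ge
  have q2 := h.fast_le
  have q3 := h.slow_ge
  have q4 := h.slow_le
  set σ := sin (π / n / 2) with hσdef
  set A0 := rootProd (0 : ZMod n) x y
  set A1 := rootProd (1 : ZMod n) x y
  set R : ℝ := inner ℝ x y with hR
  have hσ2 : σ ^ 2 ≤ 1 := by nlinarith
  have hinv : 4 ≤ 4 / σ ^ 2 := by rw [le_div_iff₀ (by positivity)]; linarith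
  have hR0 : 0 ≤ R := hA0.trans hA0R
  have hup : ∀ Z, Z ≤ 2 * (s * r) → Z ≤ 4 / σ ^ 2 * R := fun Z hZ =>
    hZ.trans ((by linarith : 2 * (s * r) ≤ 4 * R).trans (mul_le_mul_of_nonneg_right hinv hR0))
  have hlow : ∀ Z, σ ^ 2 * (s * r) ≤ Z → σ ^ 2 / 2 * R ≤ Z := fun Z hZ => by
    refine le_trans ?_ hZ
    have : σ ^ 2 * R ≤ σ ^ 2 * (s * r) := mul_le_mul_of_nonneg_left hRS (sq_nonneg σ)
    have : 0 ≤ σ ^ 2 * R := by positivity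
    linarith
  refine ⟨hA0, hA1, hA0R, hA1R, ?_, rate_sr 0 x y, rate_sr 1 x y, ?_, ?_, ?_, ?_, ?_, ?_⟩
  · have : act (.r (0 : ZMod n)) y = y := act_one y
    rw [rate, this, sub_self]
  · refine le_trans ?_ s1
    have e1 : σ ^ 2 / 2 * (A0 + A1) ≤ σ * (1 / 2 * (A0 + A1)) := by
      have : 0 ≤ A0 + A1 := by linarith
      nlinarith [mul_nonneg hσ.le this]
    exact e1.trans (mul_le_mul_of_nonneg_left q3 hσ.le)
  · refine s2.trans ?_
    calc 2 * Qs ≤ 2 * (2 / σ ^ 2 * (A0 + A1)) := by linarith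
      _ = _ := by ring
  · intro k h0 h1
    rw [rate_sr]
    have := (rootProd_bounds hn hx hy h0 h1).1
    refine hlow _ (this.trans ?_)
    have : 0 ≤ rootProd k x y := le_trans (by positivity) this
    linarith
  · intro k h0 h1
    rw [rate_sr]
    have := (rootProd_bounds hn hx hy h0 h1).2
    exact hup _ (by linarith)
  · intro k h0 h1
    by_cases h2 : k = -ρ
    · subst h2
      refine hlow _ (le_trans ?_ f1)
      rw [sq, mul_assoc]
      exact mul_le_mul_of_nonneg_left q1 hσ.le
    · obtain ⟨h3, h4⟩ := hk k h1 h2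
      have := (rate_r_bounds hn hx hy h0 h3 h4).1
      refine hlow _ (le_trans ?_ this)
      have : 0 ≤ σ ^ 2 * (s * r) := by positivity
      linarith
  · intro k h0 h1
    by_cases h2 : k = -ρ
    · subst h2
      exact hup _ (by linarith)
    · obtain ⟨h3, h4⟩ := hk k h1 h2
      exact hup _ (rate_r_bounds hn hx hy h0 h3 h4).2

theorem rational_bounds {σ A0 A1 R S Qs Qf : ℝ} (hσ : 0 < σ) (hσ1 : σ ≤ 1)
    (hSR : S ≤ 2 * R) (hRS : R ≤ S) (q1 : σ * S ≤ Qf) (q2 : Qf ≤ S)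
    (q3 : 1 / 2 * (A0 + A1) ≤ Qs) (q4 : Qs ≤ 2 / σ ^ 2 * (A0 + A1)) :
    σ * (1 + R) ≤ 1 + Qf ∧ 1 + Qf ≤ 2 * (1 + R) ∧ 1 / 2 * (2 + A0 + A1) ≤ 1 + Qs ∧
      1 + Qs ≤ 2 / σ ^ 2 * (2 + A0 + A1) := by
  have hinv : 1 ≤ 2 / σ ^ 2 := by rw [le_div_iff₀ (by positivity)]; nlinarith
  refine ⟨?_, by linarith, by linarith, by linarith⟩
  nlinarith

/-- Since `1 + Qf` is comparable to `1 + R`, one factor `1 + R` cancels at the slow rotation,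
leaving `u0 u1`. Since `1 + Qs` is comparable to `(1 + A0) + (1 + A1)`, the remaining nontrivial
rotations give `(u0 + u1) u` up to constants. -/
theorem SlowRotation.weylFactor_bounds {ρ : ZMod n} {Qs Qf : ℝ} (hn : 3 ≤ n)
    (hx : IsPolar n x s θ) (hy : IsPolar n y r η)
    (h : SlowRotation (sin (π / n / 2)) x y ρ (s * r) Qs Qf) (w : DihedralGroup n) :
    sin (π / n / 2) * profile ρ (1 + rootProd (0 : ZMod n) x y)⁻¹ (1 + rootProd (1 : ZMod n) x y)⁻¹
        (1 + inner ℝ x y)⁻¹ w ≤ weylFactor n x y w ∧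
      weylFactor n x y w ≤ 8 / sin (π / n / 2) ^ 2 *
        profile ρ (1 + rootProd (0 : ZMod n) x y)⁻¹ (1 + rootProd (1 : ZMod n) x y)⁻¹
        (1 + inner ℝ x y)⁻¹ w := by
  obtain ⟨hβ, hβ3⟩ := pi_div_bounds hn
  have hσ := sin_half_pos hβ hβ3
  have hσ1 := sin_le_one (π / n / 2)
  obtain ⟨hA0, hA1, hA0R, hA1R, hSR, hRS⟩ := simple_bounds hn hx hy
  have hR0 := hA0.trans hA0R
  obtain ⟨b1, b2, b3, b4⟩ := rational_bounds hσ hσ1 hSR hRS h.fast_ge h.fast_le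
    h.slow_ge h.slow_le
  have hinv : 8 ≤ 8 / sin (π / n / 2) ^ 2 := by
    rw [le_div_iff₀ (by positivity)]; nlinarith
  have ws := h.weyl_slow
  have wf := h.weyl_fast
  have wo := h.weyl_other
  have w0 : weylFactor n x y (.sr 0) = (1 + rootProd (0 : ZMod n) x y)⁻¹ := by
    simp only [weylFactor, if_true, rootProd, root_zero_eq, one_div]
  have w1 : weylFactor n x y (.sr 1) = (1 + rootProd (1 : ZMod n) x y)⁻¹ := by
    simp only [weylFactor, one_ne_zero_of_three_le hn, if_false, if_true, rootProd, root_one_eq hn,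
      one_div]
  set σ := sin (π / n / 2) with hσdef
  set A0 := rootProd (0 : ZMod n) x y
  set A1 := rootProd (1 : ZMod n) x y
  set R : ℝ := inner ℝ x y with hR
  have trivial_case : ∀ Z : ℝ, 0 ≤ Z → σ * Z ≤ Z ∧ Z ≤ 8 / σ ^ 2 * Z := fun Z hZ =>
    ⟨by nlinarith, by nlinarith⟩
  have d0 : 0 < 1 + A0 := by linarith
  have d1 : 0 < 1 + A1 := by linarith
  have d2 : 0 < 1 + R := by linarith
  rcases w with k | k
  · simp only [profile]
    split_ifs with h0 h1
    · subst h0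
      simp only [weylFactor, if_true]
      exact trivial_case 1 zero_le_one
    · subst h1
      rw [ws]
      have e : (1 + A0)⁻¹ * (1 + A1)⁻¹ = (1 + R) / ((1 + A0) * (1 + A1) * (1 + R)) := by
        field_simp
      rw [e, ← mul_div_assoc, ← mul_div_assoc]
      constructor
      · gcongr
      · gcongr
        exact b2.trans (mul_le_mul_of_nonneg_right (by linarith) d2.le)
    · have e : ((1 + A0)⁻¹ + (1 + A1)⁻¹) / 2 * (1 + R)⁻¹ =
          1 / 2 * (2 + A0 + A1) / ((1 + A0) * (1 + A1) * (1 + R)) := by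
        field_simp; ring
      have hpos : 0 ≤ 2 + A0 + A1 := by linarith
      by_cases h2 : k = -ρ
      · subst h2
        rw [wf, e, ← mul_div_assoc, ← mul_div_assoc]
        constructor
        · gcongr
          exact le_trans (by nlinarith) b3
        · gcongr
          refine b4.trans ?_
          rw [← mul_assoc]
          refine mul_le_mul_of_nonneg_right ?_ hpos
          rw [show 8 / σ ^ 2 * (1 / 2) = 4 / σ ^ 2 by ring]
          gcongr; norm_num
      · rw [wo k h0 h1 h2, e, show 1 / 2 * (2 + A0 + A1) / ((1 + A0) * (1 + A1) * (1 + R)) =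
          1 / 2 * (2 + A0 + A1) * (1 + R) / ((1 + A0) * (1 + A1) * (1 + R) ^ 2) by
            field_simp, ← mul_div_assoc, ← mul_div_assoc]
        have hQs : 0 ≤ 1 + Qs := le_trans (by positivity) b3
        constructor
        · refine div_le_div_of_nonneg_right ?_ (by positivity)
          calc σ * (1 / 2 * (2 + A0 + A1) * (1 + R)) =
              (1 / 2 * (2 + A0 + A1)) * (σ * (1 + R)) := by ring
            _ ≤ _ := mul_le_mul b3 b1 (by positivity) hQs
        · refine div_le_div_of_nonneg_right ?_ (by positivity)
          calc (1 + Qs) * (1 + Qf) ≤ (2 / σ ^ 2 * (2 + A0 + A1)) * (2 * (1 + R)) :=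
              mul_le_mul b4 b2 (le_trans (by positivity) b1) (by positivity)
            _ = _ := by ring
  · simp only [profile]
    split_ifs with h0 h1
    · subst h0
      rw [w0]; exact trivial_case _ (by positivity)
    · subst h1
      rw [w1]; exact trivial_case _ (by positivity)
    · have : weylFactor n x y (.sr k) = (1 + R)⁻¹ := by
        simp only [weylFactor, h0, h1, if_false, one_div, ← hR]
      rw [this]; exact trivial_case _ (by positivity)

theorem prod_range_eq_prod_zmod (f : ℕ → ℝ) :
    ∏ j ∈ Finset.range n, f j = ∏ k : ZMod n, f (-k).val := by
  rw [Fintype.prod_equiv (Equiv.neg (ZMod n)) (fun k => f (-k).val) (fun k => f k.val)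
    (fun k => by simp)]
  refine (Finset.prod_bij (fun k _ => k.val) ?_ ?_ ?_ ?_).symm
  · intro k _; exact Finset.mem_range.2 (ZMod.val_lt k)
  · intro a _ b _ h; exact ZMod.val_injective n h
  · intro j hj; exact ⟨(j : ZMod n), Finset.mem_univ _, ZMod.val_cast_of_lt (Finset.mem_range.1 hj)⟩
  · intros; rfl

/-- The common factor without the exponential, with the products over the roots that are not simple
replaced by `⟪x, y⟫`. -/
theorem commonFactor_bounds {κ : Plane → ℝ} (hκ : IsPositiveMultiplicity n κ) (hn : 3 ≤ n)
    (hx : IsPolar n x s θ) (hy : IsPolar n y r η) :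
    let G := (1 + rootProd (0 : ZMod n) x y)⁻¹ ^ mult n κ 0 *
      (1 + rootProd (1 : ZMod n) x y)⁻¹ ^ mult n κ 1 *
      (1 + inner ℝ x y : ℝ)⁻¹ ^ (∑ l, mult n κ l - mult n κ 0 - mult n κ 1)
    (∏ k, (2 : ℝ) ^ (-mult n κ k)) * (exp (inner ℝ x y) * G) ≤ commonFactor n κ x y ∧
    commonFactor n κ x y ≤
      (∏ k, (sin (π / n / 2) ^ 2) ^ (-mult n κ k)) * (exp (inner ℝ x y) * G) := by
  intro G
  obtain ⟨hβ, hβ3⟩ := pi_div_bounds hn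
  have hσ := sin_half_pos hβ hβ3
  have hσ1 := sin_le_one (π / n / 2)
  obtain ⟨hA0, hA1, hA0R, hA1R, hSR, hRS⟩ := simple_bounds hn hx hy
  have hR0 := hA0.trans hA0R
  have h01 := one_ne_zero_of_three_le hn
  set b : ZMod n → ℝ := fun k => if k = 0 then rootProd (0 : ZMod n) x y else
    if k = 1 then rootProd (1 : ZMod n) x y else inner ℝ x y with hb
  have hb0 : ∀ k, 0 ≤ b k := fun k => by simp only [hb]; split_ifs <;> assumption
  have hab : ∀ k, sin (π / n / 2) ^ 2 * (1 + b k) ≤ 1 + rootProd k x y ∧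
      1 + rootProd k x y ≤ 2 * (1 + b k) := by
    intro k
    have hσ2 : sin (π / n / 2) ^ 2 ≤ 1 := by nlinarith
    have := hb0 k
    by_cases h0 : k = 0
    · have e : b k = rootProd k x y := by simp [hb, h0]
      rw [← e]; constructor <;> nlinarith
    · by_cases h1 : k = 1
      · have e : b k = rootProd k x y := by simp [hb, h1, h01]
        rw [← e]; constructor <;> nlinarith
      · have e : b k = inner ℝ x y := by simp [hb, h1, h0]
        obtain ⟨g1, g2⟩ := rootProd_bounds hn hx hy h0 h1
        have g3 : sin (π / n / 2) ^ 2 * inner ℝ x y ≤ sin (π / n / 2) ^ 2 * (s * r) := by gcongr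
        rw [e]; constructor <;> nlinarith
  -- Passing to logarithms turns the product into a weighted sum with two exceptional indices, to
  -- which `sum_mul_ite_ite` applies.
  have hG : G = ∏ k, (1 + b k) ^ (-mult n κ k) := by
    have hlog : ∀ a : ℝ, 0 ≤ a → ∀ e : ℝ, (1 + a)⁻¹ ^ e = exp (-(log (1 + a) * e)) := by
      intro a ha e
      rw [rpow_def_of_pos (by positivity), log_inv, neg_mul]
    have h2 : ∀ k, (1 + b k) ^ (-mult n κ k) = exp (-(mult n κ k * log (1 + b k))) := by
      intro k
      rw [rpow_def_of_pos (by linarith [hb0 k])]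
      congr 1; ring
    simp only [G, h2, ← exp_sum, hlog _ hA0, hlog _ hA1, hlog _ hR0, ← exp_add]
    rw [sum_neg_distrib]
    congr 1
    have h3 : ∀ k, mult n κ k * log (1 + b k) = mult n κ k *
        (if k = 0 then log (1 + rootProd (0 : ZMod n) x y) else
          if k = 1 then log (1 + rootProd (1 : ZMod n) x y) else log (1 + inner ℝ x y)) := by
      intro k
      simp only [hb]; split_ifs <;> rfl
    simp only [h3]
    rw [sum_mul_ite_ite (mult n κ) h01.symm]
    ring
  have hC : commonFactor n κ x y =
      exp (inner ℝ x y) * ∏ k : ZMod n, (1 + rootProd k x y) ^ (-mult n κ k) := by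
    have h := prod_range_eq_prod_zmod (n := n) fun j =>
      (1 + inner ℝ (posRoot n j) x * inner ℝ (posRoot n j) y : ℝ) ^ (-κ (posRoot n j))
    rw [commonFactor, h]; rfl
  have hpos : ∀ k : ZMod n, 0 < 1 + rootProd k x y := fun k =>
    lt_of_lt_of_le (by have := hb0 k; positivity) (hab k).1
  have hm := fun k => (mult_pos hκ k).le
  rw [hC, hG, mul_left_comm, mul_left_comm (∏ k : ZMod n, (sin (π / n / 2) ^ 2) ^ (-mult n κ k)),
    ← prod_mul_distrib, ← prod_mul_distrib]
  constructor
  · refine mul_le_mul_of_nonneg_left (prod_le_prod (fun k _ => ?_) fun k _ => ?_) (exp_pos _).le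
    · have := hb0 k
      positivity
    · rw [← mul_rpow (by norm_num) (by linarith [hb0 k])]
      exact rpow_le_rpow_of_nonpos (hpos k) (hab k).2 (by linarith [hm k])
  · refine mul_le_mul_of_nonneg_left (prod_le_prod (fun k _ => ?_) fun k _ => ?_) (exp_pos _).le
    · exact rpow_nonneg (hpos k).le _
    · have := hb0 k
      rw [← mul_rpow (by positivity) (by linarith [hb0 k])]
      exact rpow_le_rpow_of_nonpos (by positivity) (hab k).1 (by linarith [hm k])

theorem exists_isReflectionWeight {κ : Plane → ℝ} (hκ : IsPositiveMultiplicity n κ) :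
    ∃ k, IsReflectionWeight (mult n κ) k := by
  obtain ⟨i, -, hi⟩ := exists_min_image Finset.univ (mult n κ) ⟨0, mem_univ _⟩
  exact ⟨mult n κ i, mult_pos hκ i, fun j => hi j (mem_univ j), mult_conj hκ⟩

/-- The normalized kernel along a ray, and the differential system that it satisfies. -/
theorem exists_normalized_system {κ : Plane → ℝ} (hκ : IsPositiveMultiplicity n κ) (x y : Plane) :
    ∃ ψ ψ' : DihedralGroup n → ℝ → ℝ, (∀ w t, HasDerivAt (ψ w) (ψ' w t) t) ∧ (∀ w, ψ w 0 = 1) ∧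
      (∀ w t, t * ψ' w t + t * rate x y w * ψ w t +
        ∑ l, mult n κ l * (ψ w t - ψ (.sr l * w) t) = 0) ∧
      ∀ w, dunklKernel n κ x (act w y) = exp (inner ℝ x y) * ψ w 1 := by
  have hf := fun w : DihedralGroup n => isRadialSolution_dunklKernel hκ (act w y)
  set f : DihedralGroup n → Plane → ℝ := fun w z => dunklKernel n κ z (act w y) with hfdef
  set R : ℝ := inner ℝ x y with hR
  refine ⟨fun w t => exp (-(R * t)) * f w (t • x), fun w t =>
    exp (-(R * t)) * -R * f w (t • x) + exp (-(R * t)) * fderiv ℝ (f w) (t • x) x,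
    fun w t => ?_, fun w => ?_, fun w t => ?_, fun w => ?_⟩
  · have h1 : HasDerivAt (fun s : ℝ => exp (-(R * s))) (exp (-(R * t)) * -R) t := by
      simpa using (((hasDerivAt_id t).const_mul R).neg).exp
    exact h1.mul (hasDerivAt_ray (hf w).differentiable x t)
  · simpa using (hf w).map_zero
  · have h1 := (hf w).radial (t • x)
    -- Equivariance moves the reflection from the space variable to the index, which closes the
    -- system on a single ray.
    have h2 : ∀ l : ZMod n, f w (act (.sr l) (t • x)) = f (.sr l * w) (t • x) := by
      intro l
      simp only [hfdef]
      rw [dunklKernel_act_sr hκ, act_mul]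
    have h3 : ∑ l, mult n κ l * (exp (-(R * t)) * f w (t • x) -
        exp (-(R * t)) * f (.sr l * w) (t • x)) =
        exp (-(R * t)) * ∑ l, mult n κ l * (f w (t • x) - f w (act (.sr l) (t • x))) := by
      rw [mul_sum]
      exact sum_congr rfl fun l _ => by rw [h2]; ring
    have h4 : fderiv ℝ (f w) (t • x) (t • x) = t * fderiv ℝ (f w) (t • x) x := by
      rw [map_smul, smul_eq_mul]
    have h5 : (inner ℝ (t • x) (act w y) : ℝ) = t * inner ℝ x (act w y) := by
      rw [inner_smul_left]; rfl
    rw [h3, rate, ← hR]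
    change fderiv ℝ (f w) (t • x) (t • x) +
      ∑ l, mult n κ l * (f w (t • x) - f w (act (.sr l) (t • x))) =
        inner ℝ (t • x) (act w y) * f w (t • x) at h1
    rw [h4, h5] at h1
    linear_combination exp (-(R * t)) * h1
  · simp only [mul_one, one_smul]
    rw [← mul_assoc, ← exp_add]
    simp [hfdef]

theorem exists_dunklKernel_bounds {κ : Plane → ℝ} (hκ : IsPositiveMultiplicity n κ) (hn : 3 ≤ n) :
    ∃ C₁ C₂ : ℝ, 0 < C₁ ∧ 0 < C₂ ∧
      ∀ w : DihedralGroup n, ∀ x ∈ closedChamber n, ∀ y ∈ closedChamber n,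
        C₁ * (commonFactor n κ x y * weylFactor n x y w) ≤ dunklKernel n κ x (act w y) ∧
          dunklKernel n κ x (act w y) ≤ C₂ * (commonFactor n κ x y * weylFactor n x y w) := by
  obtain ⟨k, hq⟩ := exists_isReflectionWeight hκ
  obtain ⟨hβ, hβ3⟩ := pi_div_bounds hn
  have h01 := one_ne_zero_of_three_le hn
  have hσ := sin_half_pos hβ hβ3
  -- The constants are fixed before `x`, `y` and hence before the slow label `ρ`, which depends on
  -- `x`.
  obtain ⟨c₂, hc₂, hupper⟩ := exists_le_mul_model (m := sin (π / n / 2) ^ 2 / 2)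
    (m' := 4 / sin (π / n / 2) ^ 2) hq h01 (by positivity)
  obtain ⟨c₁, hc₁, hlower⟩ := exists_mul_model_le (m := sin (π / n / 2) ^ 2 / 2)
    (m' := 4 / sin (π / n / 2) ^ 2) hq h01 (by positivity)
  set σ := sin (π / n / 2) with hσdef
  set a : ℝ := ∏ k, (2 : ℝ) ^ (-mult n κ k) with ha
  set b : ℝ := ∏ k, (σ ^ 2) ^ (-mult n κ k) with hb
  have ha0 : 0 < a := prod_pos fun k _ => by positivity
  have hb0 : 0 < b := prod_pos fun k _ => by positivity
  refine ⟨c₁ / (b * (8 / σ ^ 2)), c₂ / (a * σ), by positivity, by positivity,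
    fun w x hx y hy => ?_⟩
  obtain ⟨s, θ, hx⟩ := exists_isPolar hn hx
  obtain ⟨r, η, hy⟩ := exists_isPolar hn hy
  obtain ⟨ρ, Qs, Qf, hslow⟩ := exists_slowRotation hn hx hy
  obtain ⟨ψ, ψ', hψ, hψ0, hode, hE⟩ := exists_normalized_system hκ x y
  have hrb := hslow.rateBounds hn hx hy
  have hu := hupper ρ _ _ _ _ ψ ψ' hslow.label hrb hψ hψ0 hode w
  have hl := hlower ρ _ _ _ _ ψ ψ' hslow.label hrb hψ hψ0 hode w
  obtain ⟨w1, w2⟩ := hslow.weylFactor_bounds hn hx hy w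
  obtain ⟨g1, g2⟩ := commonFactor_bounds hκ hn hx hy
  obtain ⟨hA0, hA1, hA0R, hA1R, hSR, hRS⟩ := simple_bounds hn hx hy
  have hR0 := hA0.trans hA0R
  rw [model, barrier, zero_mul, exp_zero, mul_one] at hu hl
  rw [← hσdef] at w1 w2 g2
  rw [← ha] at g1
  rw [← hb] at g2
  set G := (1 + rootProd (0 : ZMod n) x y)⁻¹ ^ mult n κ 0 *
      (1 + rootProd (1 : ZMod n) x y)⁻¹ ^ mult n κ 1 *
      (1 + inner ℝ x y : ℝ)⁻¹ ^ (∑ l, mult n κ l - mult n κ 0 - mult n κ 1) with hG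
  set F := profile ρ (1 + rootProd (0 : ZMod n) x y)⁻¹ (1 + rootProd (1 : ZMod n) x y)⁻¹
        (1 + inner ℝ x y)⁻¹ w with hF
  set e := exp (inner ℝ x y) with he
  have hG0 : 0 ≤ G := by positivity
  have hF0 : 0 ≤ F := by
    rw [hF]
    rcases w with j | j <;> simp only [profile] <;> split_ifs <;> positivity
  have he0 : 0 < e := exp_pos _
  have hC0 : 0 ≤ commonFactor n κ x y := le_trans (by positivity) g1
  have hW0 : 0 ≤ weylFactor n x y w := le_trans (by positivity) w1
  rw [hE w]
  constructor
  · rw [div_mul_eq_mul_div, div_le_iff₀ (by positivity)]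
    calc c₁ * (commonFactor n κ x y * weylFactor n x y w)
        ≤ c₁ * ((b * (e * G)) * (8 / σ ^ 2 * F)) := by gcongr
      _ = e * (c₁ * (F * G)) * (b * (8 / σ ^ 2)) := by ring
      _ ≤ e * ψ w 1 * (b * (8 / σ ^ 2)) := by gcongr
  · rw [div_mul_eq_mul_div, le_div_iff₀ (by positivity)]
    calc e * ψ w 1 * (a * σ) ≤ e * (c₂ * (F * G)) * (a * σ) := by gcongr
      _ = c₂ * ((a * (e * G)) * (σ * F)) := by ring
      _ ≤ c₂ * (commonFactor n κ x y * weylFactor n x y w) := by gcongr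

end

end DihedralDunkl

theorem theorem1 (n : ℕ) (hn : 3 ≤ n) (κ : DihedralDunkl.Plane → ℝ)
    (hκ : DihedralDunkl.IsPositiveMultiplicity n κ) :
    (∀ y : DihedralDunkl.Plane,
      ∃! f : DihedralDunkl.Plane → ℝ, DihedralDunkl.IsDunklEigenfunction n κ y f) ∧
    ∃ C₁ C₂ : ℝ, 0 < C₁ ∧ 0 < C₂ ∧
      ∀ w : DihedralGroup n,
      ∀ x ∈ DihedralDunkl.closedChamber n, ∀ y ∈ DihedralDunkl.closedChamber n,
        C₁ * (DihedralDunkl.commonFactor n κ x y * DihedralDunkl.weylFactor n x y w) ≤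
            DihedralDunkl.dunklKernel n κ x (DihedralDunkl.act w y) ∧
          DihedralDunkl.dunklKernel n κ x (DihedralDunkl.act w y) ≤
            C₂ * (DihedralDunkl.commonFactor n κ x y * DihedralDunkl.weylFactor n x y w) := by
  have : NeZero n := ⟨by omega⟩
  exact ⟨DihedralDunkl.existsUnique_isDunklEigenfunction hκ,
    DihedralDunkl.exists_dunklKernel_bounds hκ hn⟩
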